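/- Let $r_1,r_2\ge 1$ be integers, let $Q=\sum_{a,b}Q_{ab}p_ap_b$ be a positive definite quadratic form on $\mathbb{R}^{r_1+r_2}$, let $\alpha_{ijkl}\in\mathbb{R}$ ($1\le i,j\le r_1$, $1\le k,l\le r_2$), $L_1\in\mathbb{R}^{r_1}$, $L_2\in\mathbb{R}^{r_2}$. Write $q=(q_1,q_2)\in\mathbb{R}^{r_1}\times\mathbb{R}^{r_2}$, $$V(q_1,q_2)=\sum_{i,j=1}^{r_1}\sum_{k,l=1}^{r_2}\alpha_{ijkl}\,q_{1,i}q_{1,j}q_{2,k}q_{2,l},$$ and consider on $L^2(\mathbb{R}^{r_1+r_2})$ the operator $$P=Q(iD)+V(q_1,q_2)+\sum_{i=1}^{r_1}L_{1,i}q_{1,i}+\sum_{k=1}^{r_2}L_{2,k}q_{2,k},\qquad Q(iD)=-\sum_{a,b}Q_{ab}\,\partial_a\partial_b,$$ that is, the closure of this differential operator defined on the Schwartz space. Let $Q_1,Q_2$ be the restrictions of $Q$ to $\mathbb{R}^{r_1}\times\{0\}$ and $\{0\}\times\mathbb{R}^{r_2}$. Assume: 1. $V(q_1,q_2)\ge 0$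 for all $(q_1,q_2)$; 2. for every $q_1\neq 0$, $Q_2(iD)+V(q_1,\cdot)>\sum_i L_{1,i}q_{1,i}$ as operators on $L^2(\mathbb{R}^{r_2})$, i.e. the bottom of the spectrum of the left-hand side is greater than the number on the right; 3. for every $q_2\neq 0$, $Q_1(iD)+V(\cdot,q_2)>\sum_k L_{2,k}q_{2,k}$ as operators on $L^2(\mathbb{R}^{r_1})$, in the same sense; 4. $r_1=r_2$; 5. for all $q_1\neq0$ and $q_2\neq0$, the matrices $\big[\sum_{i,j}\alpha_{ijkl}q_{1,i}q_{1,j}\big]_{k,l}$ and $\big[\sum_{k,l}\alpha_{ijkl}q_{2,k}q_{2,l}\big]_{i,j}$ are positive (have positive definite quadratic forms). For $\Lambda>0$ let $N_\Lambda$ be the number of eigenvalues of $P$ less than $\Lambda$, counted with multiplicity. Then there are constants $C>c>0$ such that, for all sufficiently large $\Lambda$, $$c\,\Lambda^{\frac32 r_1}\log\Lambda\;\le\;N_\Lambda\;\le\;C\,\Lambda^{\frac32 r_1}\log\Lambda .$$ -/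

import Mathlib

open scoped SchwartzMap LineDeriv ENNReal Matrix

noncomputable section

namespace CrossingModel

/-- The Hilbert space `L²(ℝ^ι; ℂ)` with Lebesgue measure. -/
abbrev L2 (ι : Type) [Fintype ι] : Type :=
  MeasureTheory.Lp ℂ 2 (MeasureTheory.volume : MeasureTheory.Measure (EuclideanSpace ℝ ι))

/-- The inclusion of the Schwartz functions into `L²(ℝ^ι; ℂ)`. -/
def incl (ι : Type) [Fintype ι] : 𝓢(EuclideanSpace ℝ ι, ℂ) →ₗ[ℂ] L2 ι :=
  (SchwartzMap.toLpCLM ℂ ℂ 2 MeasureTheory.volume).toLinearMap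

theorem incl_injective (ι : Type) [Fintype ι] : Function.Injective (incl ι) :=
  SchwartzMap.injective_toLp 2 MeasureTheory.volume

/-- For the quadratic form `p ↦ ∑ A i j p_i p_j`, the differential operator
`A(iD) = - ∑ A i j ∂_i ∂_j` (where `D` is differentiation, so that `(iD)² = - D²`),
on Schwartz functions. -/
def quadD {ι : Type} [Fintype ι] [DecidableEq ι] (A : Matrix ι ι ℝ) :
    𝓢(EuclideanSpace ℝ ι, ℂ) →ₗ[ℂ] 𝓢(EuclideanSpace ℝ ι, ℂ) :=
  -∑ i, ∑ j, ((A i j : ℝ) : ℂ) •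
    ((LineDeriv.lineDerivOpCLM ℂ 𝓢(EuclideanSpace ℝ ι, ℂ) (EuclideanSpace.single i (1 : ℝ))).comp
      (LineDeriv.lineDerivOpCLM ℂ 𝓢(EuclideanSpace ℝ ι, ℂ)
        (EuclideanSpace.single j (1 : ℝ)))).toLinearMap

/-- The operator `A(iD) + V` on Schwartz functions, for a potential `V` that is smooth and of
temperate growth (here always a polynomial). -/
def schrodinger {ι : Type} [Fintype ι] [DecidableEq ι] (A : Matrix ι ι ℝ)
    (V : EuclideanSpace ℝ ι → ℝ) :
    𝓢(EuclideanSpace ℝ ι, ℂ) →ₗ[ℂ] 𝓢(EuclideanSpace ℝ ι, ℂ) :=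
  quadD A + (SchwartzMap.smulLeftCLM ℂ (fun x => ((V x : ℝ) : ℂ))).toLinearMap

/-- An operator on Schwartz functions, seen as a densely defined operator on `L²`. -/
def onL2 {ι : Type} [Fintype ι]
    (T : 𝓢(EuclideanSpace ℝ ι, ℂ) →ₗ[ℂ] 𝓢(EuclideanSpace ℝ ι, ℂ)) : L2 ι →ₗ.[ℂ] L2 ι where
  domain := LinearMap.range (incl ι)
  toFun := ((incl ι).comp T).comp
    (LinearEquiv.ofInjective (incl ι) (incl_injective ι)).symm.toLinearMap

/-- The operator inequality `T > m` for a real number `m`: the bottom of the spectrum of `T`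
(the infimum of `⟪φ, Tφ⟫ / ‖φ‖²`) is greater than `m`. -/
def OperatorGT {ι : Type} [Fintype ι]
    (T : 𝓢(EuclideanSpace ℝ ι, ℂ) →ₗ[ℂ] 𝓢(EuclideanSpace ℝ ι, ℂ)) (m : ℝ) : Prop :=
  ∃ ε > 0, ∀ φ : 𝓢(EuclideanSpace ℝ ι, ℂ),
    (m + ε) * ‖incl ι φ‖ ^ 2 ≤ (inner ℂ (incl ι φ) (incl ι (T φ))).re

/-- The eigenspace `{u ∈ dom T : T u = μ u}` of an unbounded operator. -/
def eigenspace {H : Type} [AddCommGroup H] [Module ℂ H] (T : H →ₗ.[ℂ] H) (μ : ℝ) :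
    Submodule ℂ H :=
  T.graph.comap (LinearMap.id.prod ((μ : ℂ) • LinearMap.id))

/-- The number of eigenvalues of `T` less than `Λ`, counted with multiplicity. -/
def eigenvalueCount {H : Type} [AddCommGroup H] [Module ℂ H] (T : H →ₗ.[ℂ] H) (Λ : ℝ) : ℝ≥0∞ :=
  ∑' μ : Set.Iio Λ, ((Cardinal.toENat (Module.rank ℂ (eigenspace T μ)) : ℕ∞) : ℝ≥0∞)

section Model

variable {r₁ r₂ : ℕ}

/-- The quartic form `∑ α_{ijkl} q_{1,i} q_{1,j} q_{2,k} q_{2,l}`. -/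
def quartic (α : Fin r₁ → Fin r₁ → Fin r₂ → Fin r₂ → ℝ) (q₁ : Fin r₁ → ℝ) (q₂ : Fin r₂ → ℝ) : ℝ :=
  ∑ i, ∑ j, ∑ k, ∑ l, α i j k l * q₁ i * q₁ j * q₂ k * q₂ l

/-- The matrix `[∑_{i,j} α_{ijkl} q_{1,i} q_{1,j}]_{k,l}`. -/
def partial₁ (α : Fin r₁ → Fin r₁ → Fin r₂ → Fin r₂ → ℝ) (q₁ : Fin r₁ → ℝ) :
    Matrix (Fin r₂) (Fin r₂) ℝ :=
  Matrix.of fun k l => ∑ i, ∑ j, α i j k l * q₁ i * q₁ j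

/-- The matrix `[∑_{k,l} α_{ijkl} q_{2,k} q_{2,l}]_{i,j}`. -/
def partial₂ (α : Fin r₁ → Fin r₁ → Fin r₂ → Fin r₂ → ℝ) (q₂ : Fin r₂ → ℝ) :
    Matrix (Fin r₁) (Fin r₁) ℝ :=
  Matrix.of fun i j => ∑ k, ∑ l, α i j k l * q₂ k * q₂ l

/-- Positivity of the quadratic form of a (not necessarily symmetric) real matrix. -/
def MatrixPositive {n : ℕ} (M : Matrix (Fin n) (Fin n) ℝ) : Prop :=
  ∀ x : Fin n → ℝ, x ≠ 0 → 0 < x ⬝ᵥ (M *ᵥ x)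

/-- The full potential on `ℝ^{r₁+r₂}`: the quartic form plus the linear terms. -/
def potential (α : Fin r₁ → Fin r₁ → Fin r₂ → Fin r₂ → ℝ) (L₁ : Fin r₁ → ℝ) (L₂ : Fin r₂ → ℝ)
    (q : EuclideanSpace ℝ (Fin r₁ ⊕ Fin r₂)) : ℝ :=
  quartic α (fun i => q (Sum.inl i)) (fun k => q (Sum.inr k))
    + ∑ i, L₁ i * q (Sum.inl i) + ∑ k, L₂ k * q (Sum.inr k)

/-- The model operator `P = Q(iD) + quartic + linear` on Schwartz functions. -/
def modelSchwartz (Q : Matrix (Fin r₁ ⊕ Fin r₂) (Fin r₁ ⊕ Fin r₂) ℝ)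
    (α : Fin r₁ → Fin r₁ → Fin r₂ → Fin r₂ → ℝ) (L₁ : Fin r₁ → ℝ) (L₂ : Fin r₂ → ℝ) :
    𝓢(EuclideanSpace ℝ (Fin r₁ ⊕ Fin r₂), ℂ) →ₗ[ℂ] 𝓢(EuclideanSpace ℝ (Fin r₁ ⊕ Fin r₂), ℂ) :=
  schrodinger Q (potential α L₁ L₂)

/-- The model operator `P` as an unbounded operator on `L²(ℝ^{r₁+r₂})`: the closure of its
restriction to the Schwartz functions. -/
def modelOperator (Q : Matrix (Fin r₁ ⊕ Fin r₂) (Fin r₁ ⊕ Fin r₂) ℝ)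
    (α : Fin r₁ → Fin r₁ → Fin r₂ → Fin r₂ → ℝ) (L₁ : Fin r₁ → ℝ) (L₂ : Fin r₂ → ℝ) :
    L2 (Fin r₁ ⊕ Fin r₂) →ₗ.[ℂ] L2 (Fin r₁ ⊕ Fin r₂) :=
  (onL2 (modelSchwartz Q α L₁ L₂)).closure

/-- The standing conditions on the model operator. The blocks `Q.toBlocks₁₁` and `Q.toBlocks₂₂`
are the restrictions `Q₁`, `Q₂` of the quadratic form to the two coordinate subspaces. -/
structure Admissible (Q : Matrix (Fin r₁ ⊕ Fin r₂) (Fin r₁ ⊕ Fin r₂) ℝ)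
    (α : Fin r₁ → Fin r₁ → Fin r₂ → Fin r₂ → ℝ) (L₁ : Fin r₁ → ℝ) (L₂ : Fin r₂ → ℝ) : Prop where
  quadratic_pos : Q.PosDef
  quartic_nonneg : ∀ q₁ q₂, 0 ≤ quartic α q₁ q₂
  transverse₁ : ∀ q₁ : Fin r₁ → ℝ, q₁ ≠ 0 →
    OperatorGT (schrodinger Q.toBlocks₂₂ (fun q₂ => quartic α q₁ q₂)) (∑ i, L₁ i * q₁ i)
  transverse₂ : ∀ q₂ : Fin r₂ → ℝ, q₂ ≠ 0 →
    OperatorGT (schrodinger Q.toBlocks₁₁ (fun q₁ => quartic α q₁ q₂)) (∑ k, L₂ k * q₂ k)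

theorem coord_hasTemperateGrowth {ι : Type} [Fintype ι] (i : ι) :
    (fun x : EuclideanSpace ℝ ι => x i).HasTemperateGrowth :=
  (EuclideanSpace.proj i : EuclideanSpace ℝ ι →L[ℝ] ℝ).hasTemperateGrowth

/-- The potentials above are of temperate growth, so that the multiplication operators are the
intended ones. -/
theorem potential_hasTemperateGrowth (α : Fin r₁ → Fin r₁ → Fin r₂ → Fin r₂ → ℝ)
    (L₁ : Fin r₁ → ℝ) (L₂ : Fin r₂ → ℝ) :
    (fun q => ((potential α L₁ L₂ q : ℝ) : ℂ)).HasTemperateGrowth := by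
  have h := coord_hasTemperateGrowth (ι := Fin r₁ ⊕ Fin r₂)
  have : (potential α L₁ L₂).HasTemperateGrowth := by
    unfold potential quartic
    fun_prop
  fun_prop

theorem quartic_hasTemperateGrowth₂ (α : Fin r₁ → Fin r₁ → Fin r₂ → Fin r₂ → ℝ)
    (q₁ : Fin r₁ → ℝ) :
    (fun q₂ : EuclideanSpace ℝ (Fin r₂) => ((quartic α q₁ q₂ : ℝ) : ℂ)).HasTemperateGrowth := by
  have h := coord_hasTemperateGrowth (ι := Fin r₂)
  have : (fun q₂ : EuclideanSpace ℝ (Fin r₂) => quartic α q₁ q₂).HasTemperateGrowth := by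
    unfold quartic
    fun_prop
  fun_prop

theorem quartic_hasTemperateGrowth₁ (α : Fin r₁ → Fin r₁ → Fin r₂ → Fin r₂ → ℝ)
    (q₂ : Fin r₂ → ℝ) :
    (fun q₁ : EuclideanSpace ℝ (Fin r₁) => ((quartic α q₁ q₂ : ℝ) : ℂ)).HasTemperateGrowth := by
  have h := coord_hasTemperateGrowth (ι := Fin r₁)
  have : (fun q₁ : EuclideanSpace ℝ (Fin r₁) => quartic α q₁ q₂).HasTemperateGrowth := by
    unfold quartic
    fun_prop
  fun_prop

/-- The pointwise formula for `A(iD) + V`. -/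
theorem schrodinger_apply {ι : Type} [Fintype ι] [DecidableEq ι] (A : Matrix ι ι ℝ)
    (V : EuclideanSpace ℝ ι → ℝ) (hV : (fun x => ((V x : ℝ) : ℂ)).HasTemperateGrowth)
    (φ : 𝓢(EuclideanSpace ℝ ι, ℂ)) (x : EuclideanSpace ℝ ι) :
    schrodinger A V φ x =
      -∑ i, ∑ j, (A i j : ℂ) * lineDeriv ℝ (fun y => lineDeriv ℝ φ y (EuclideanSpace.single j 1)) x
          (EuclideanSpace.single i 1) + (V x : ℂ) * φ x := by
  have h : ∀ j : ι, ((∂_{EuclideanSpace.single j (1 : ℝ)} φ : 𝓢(EuclideanSpace ℝ ι, ℂ)) : EuclideanSpace ℝ ι → ℂ) =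
      fun y => lineDeriv ℝ φ y (EuclideanSpace.single j 1) :=
    fun j => funext fun y => SchwartzMap.lineDerivOp_apply _ φ y
  simp [schrodinger, quadD, SchwartzMap.smulLeftCLM_apply_apply hV, LinearMap.sum_apply,
    SchwartzMap.lineDerivOp_apply, h]

theorem inner_lineDeriv {ι : Type} [Fintype ι] (v : EuclideanSpace ℝ ι)
    (φ ψ : 𝓢(EuclideanSpace ℝ ι, ℂ)) :
    inner ℂ (incl ι (∂_{v} φ)) (incl ι ψ) = -inner ℂ (incl ι φ) (incl ι (∂_{v} ψ)) := by
  have h := SchwartzMap.integral_bilinear_lineDerivOp_right_eq_neg_left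
    (μ := MeasureTheory.volume) φ ψ
    ((ContinuousLinearMap.mul ℝ ℂ).comp (Complex.conjCLE : ℂ →L[ℝ] ℂ)) v
  have h' : ∀ f g : 𝓢(EuclideanSpace ℝ ι, ℂ), inner ℂ (incl ι f) (incl ι g) =
      ∫ x, (starRingEnd ℂ) (f x) * g x := by
    intro f g
    simp [incl, mul_comm]
  rw [h', h', eq_neg_iff_add_eq_zero, add_comm, ← eq_neg_iff_add_eq_zero]
  simpa using h

theorem quadD_symm {ι : Type} [Fintype ι] [DecidableEq ι] (A : Matrix ι ι ℝ) (hA : A.IsSymm)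
    (φ ψ : 𝓢(EuclideanSpace ℝ ι, ℂ)) :
    inner ℂ (incl ι (quadD A φ)) (incl ι ψ) = inner ℂ (incl ι φ) (incl ι (quadD A ψ)) := by
  simp only [quadD, LinearMap.neg_apply, LinearMap.sum_apply, LinearMap.smul_apply, map_neg,
    map_sum, map_smul, inner_neg_left, inner_neg_right, sum_inner, inner_sum, inner_smul_left,
    inner_smul_right, Complex.conj_ofReal]
  rw [Finset.sum_comm]
  congr 1
  refine Finset.sum_congr rfl fun i _ => Finset.sum_congr rfl fun j _ => ?_
  rw [hA.apply i j]
  congr 1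
  simp [inner_lineDeriv]

theorem schrodinger_symm {ι : Type} [Fintype ι] [DecidableEq ι] (A : Matrix ι ι ℝ)
    (hA : A.IsSymm) (V : EuclideanSpace ℝ ι → ℝ)
    (hV : (fun x => ((V x : ℝ) : ℂ)).HasTemperateGrowth) (φ ψ : 𝓢(EuclideanSpace ℝ ι, ℂ)) :
    inner ℂ (incl ι (schrodinger A V φ)) (incl ι ψ) =
      inner ℂ (incl ι φ) (incl ι (schrodinger A V ψ)) := by
  simp only [schrodinger, LinearMap.add_apply, map_add, inner_add_left, inner_add_right,
    quadD_symm A hA]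
  congr 1
  simp [incl, SchwartzMap.smulLeftCLM_apply_apply hV]
  congr 1
  ext x
  ring

/-- A symmetric operator is closable, so that the closure above is a genuine operator. -/
theorem onL2_isClosable {ι : Type} [Fintype ι]
    (T : 𝓢(EuclideanSpace ℝ ι, ℂ) →ₗ[ℂ] 𝓢(EuclideanSpace ℝ ι, ℂ))
    (hT : ∀ φ ψ, inner ℂ (incl ι (T φ)) (incl ι ψ) = inner ℂ (incl ι φ) (incl ι (T ψ))) :
    (onL2 T).IsClosable := by
  have hd : Dense ((onL2 T).domain : Set (L2 ι)) :=
    SchwartzMap.denseRange_toLpCLM (F := ℂ) (p := 2) (by simp)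
  have happ : ∀ φ : 𝓢(EuclideanSpace ℝ ι, ℂ), ∀ h, onL2 T ⟨incl ι φ, h⟩ = incl ι (T φ) := by
    intro φ h
    have : (LinearEquiv.ofInjective (incl ι) (incl_injective ι)).symm ⟨incl ι φ, h⟩ = φ := by
      rw [LinearEquiv.symm_apply_eq]; rfl
    exact congrArg (fun χ => incl ι (T χ)) this
  refine LinearPMap.isClosable_iff_exists_closed_extension.2
    ⟨(onL2 T).adjoint, LinearPMap.adjoint_isClosed hd, LinearPMap.IsFormalAdjoint.le_adjoint hd ?_⟩
  rintro ⟨_, φ, rfl⟩ ⟨_, ψ, rfl⟩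
  exact (congrArg (fun z => inner ℂ z (incl ι ψ)) (happ φ ⟨φ, rfl⟩)).trans
    ((hT φ ψ).trans (congrArg (fun z => inner ℂ (incl ι φ) z) (happ ψ ⟨ψ, rfl⟩)).symm)

theorem model_isClosable (Q : Matrix (Fin r₁ ⊕ Fin r₂) (Fin r₁ ⊕ Fin r₂) ℝ) (hQ : Q.PosDef)
    (α : Fin r₁ → Fin r₁ → Fin r₂ → Fin r₂ → ℝ) (L₁ : Fin r₁ → ℝ) (L₂ : Fin r₂ → ℝ) :
    (onL2 (modelSchwartz Q α L₁ L₂)).IsClosable :=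
  onL2_isClosable _ fun φ ψ => schrodinger_symm Q (by simpa using hQ.isHermitian) _
    (potential_hasTemperateGrowth α L₁ L₂) φ ψ

end Model

end CrossingModel

end

/-! The quartic form is comparable to `‖q₁‖² ‖q₂‖²`, so it vanishes along both coordinate subspaces,
and the region where it is below `Λ` has infinite volume: the plain phase-space count diverges along
two families of horns. The transverse hypotheses close the horns. At a point `q₁` of a horn, the
transverse operator has ground energy of order `‖q₁‖`, and by compactness and scaling it exceeds the
linear term by a uniform `ε ‖q₁‖`. Hence `P` behaves like `Q(iD) + V + ‖q‖`, and only the region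
`‖q₁‖ ‖q₂‖ ≲ Λ^(1/2)`, `‖q‖ ≲ Λ` counts. On cubes of side about `Λ^(-1/2)`, the uncertainty scale,
this becomes counting lattice points with `|m₁| |m₂| ≲ Λ^(3/2)` and `|m| ≲ Λ^(3/2)`. For equal
dimensions `r`, each of the roughly `log Λ` dyadic scales of `|m₁|` contributes about `Λ^(3r/2)`
points.

The upper bound rests on the coercivity estimate `coerciveOn_univ`, that is `P + C ≥ δ (Q(iD) + V +
‖q‖)` in the sense of forms. It is proved on three regions: in the two horns by restricting to
fibres of a shear adapted to `Q` and applying `exists_uniform_transverse`, and away from both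
subspaces directly from the quartic growth. A quadratic partition of unity glues the regions. The
Poincaré inequality on the cubes turns coercivity into a lower bound modulo one functional per
relevant cube (`formBound_of_cells`, `exists_formBound`). The lower bound uses disjointly supported
bumps, one per cube, each of energy below `Λ` (`exists_testFunctions`).

Eigenvalues of the closure are handled through a bounded inverse `R` of `P + s`. It exists because a
Schrödinger operator bounded below on Schwartz functions is essentially self-adjoint
(`denseRange_schrodinger`). The eigenspaces of the closure are those of `R` (`exists_resolvent`),
form bounds make `R` compact, and both halves of the min-max principle are proved for `R`
(`eigenvalueCount_le`, `le_eigenvalueCount`). -/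

noncomputable section

namespace CrossingModel

open MeasureTheory

/-! ### Energy integrals of Schwartz functions -/

section Energy

variable {ι : Type} [Fintype ι]

/-- The Hermitian extension to `ℂ^ι` of the real quadratic form with matrix `A`. -/
def hermForm (A : Matrix ι ι ℝ) (ξ : ι → ℂ) : ℝ :=
  ∑ i, ∑ j, A i j * ((starRingEnd ℂ) (ξ i) * ξ j).re

/-- The vector of partial derivatives. -/
def grad [DecidableEq ι] (f : EuclideanSpace ℝ ι → ℂ) (x : EuclideanSpace ℝ ι) : ι → ℂ :=
  fun i => fderiv ℝ f x (EuclideanSpace.single i 1)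

/-- The quadratic form of `A(iD) + W`. -/
def energy [DecidableEq ι] (A : Matrix ι ι ℝ) (W : EuclideanSpace ℝ ι → ℝ)
    (f : EuclideanSpace ℝ ι → ℂ) : ℝ :=
  ∫ x, (hermForm A (grad f x) + W x * ‖f x‖ ^ 2)

/-- Continuous functions of at most polynomial growth. -/
structure PolyBounded {E : Type} [NormedAddCommGroup E] (W : E → ℝ) : Prop where
  cont : Continuous W
  bound : ∃ (k : ℕ) (C : ℝ), ∀ x, |W x| ≤ C * (1 + ‖x‖) ^ k

theorem PolyBounded.of_hasTemperateGrowth {E : Type} [NormedAddCommGroup E] [NormedSpace ℝ E]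
    {W : E → ℝ} (h : W.HasTemperateGrowth) : PolyBounded W := by
  refine ⟨h.1.continuous, ?_⟩
  obtain ⟨k, C, hC⟩ := h.2 0
  exact ⟨k, C, fun x => by simpa using hC x⟩

theorem PolyBounded.exists_nonneg {E : Type} [NormedAddCommGroup E] {W : E → ℝ}
    (h : PolyBounded W) : ∃ (k : ℕ) (C : ℝ), 0 ≤ C ∧ ∀ x, |W x| ≤ C * (1 + ‖x‖) ^ k := by
  obtain ⟨k, C, hC⟩ := h.bound
  refine ⟨k, C, ?_, hC⟩
  simpa using (abs_nonneg _).trans (hC 0)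

theorem PolyBounded.const {E : Type} [NormedAddCommGroup E] (c : ℝ) :
    PolyBounded (fun _ : E => c) :=
  ⟨continuous_const, 0, |c|, fun x => by simp⟩

/-- The reason for working with this class: `weight` contains `‖q‖`, which is not smooth at the
origin, so temperate growth would be too strong a requirement. -/
theorem PolyBounded.norm {E : Type} [NormedAddCommGroup E] : PolyBounded (fun x : E => ‖x‖) :=
  ⟨continuous_norm, 1, 1, fun x => by simp⟩

theorem PolyBounded.add {E : Type} [NormedAddCommGroup E] {W W' : E → ℝ}
    (h : PolyBounded W) (h' : PolyBounded W') : PolyBounded (fun x => W x + W' x) := by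
  obtain ⟨k, C, hC0, hC⟩ := h.exists_nonneg
  obtain ⟨k', C', hC0', hC'⟩ := h'.exists_nonneg
  refine ⟨h.cont.add h'.cont, k + k', C + C', fun x => ?_⟩
  have h1 : (1 : ℝ) ≤ 1 + ‖x‖ := by linarith [norm_nonneg x]
  have e1 : C * (1 + ‖x‖) ^ k ≤ C * (1 + ‖x‖) ^ (k + k') :=
    mul_le_mul_of_nonneg_left (pow_le_pow_right₀ h1 (by omega)) hC0
  have e2 : C' * (1 + ‖x‖) ^ k' ≤ C' * (1 + ‖x‖) ^ (k + k') :=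
    mul_le_mul_of_nonneg_left (pow_le_pow_right₀ h1 (by omega)) hC0'
  calc |W x + W' x| ≤ |W x| + |W' x| := abs_add_le _ _
    _ ≤ _ := by linarith [hC x, hC' x]

/-- The moments of `φ` absorb the polynomial factor, while `ψ` only needs its supremum. -/
theorem integrable_polyBounded_mul {F G : Type} [NormedAddCommGroup F] [NormedSpace ℝ F]
    [NormedAddCommGroup G] [NormedSpace ℝ G]
    {W : EuclideanSpace ℝ ι → ℝ} (hW : PolyBounded W)
    (φ : 𝓢(EuclideanSpace ℝ ι, F)) (ψ : 𝓢(EuclideanSpace ℝ ι, G)) :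
    Integrable (fun x => W x * (‖φ x‖ * ‖ψ x‖)) := by
  obtain ⟨k, C, hC0, hC⟩ := hW.exists_nonneg
  set M := SchwartzMap.seminorm ℝ 0 0 ψ
  have hM : ∀ x, ‖ψ x‖ ≤ M := fun x => SchwartzMap.norm_le_seminorm ℝ ψ x
  have hM0 : 0 ≤ M := (norm_nonneg _).trans (hM 0)
  have hi : Integrable (fun x => C * M * 2 ^ k * (‖φ x‖ + ‖x‖ ^ k * ‖φ x‖)) :=
    ((φ.integrable.norm).add (φ.integrable_pow_mul _ k)).const_mul _
  refine hi.mono' ((hW.cont.mul (φ.continuous.norm.mul ψ.continuous.norm)).aestronglyMeasurable)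
    (Filter.Eventually.of_forall fun x => ?_)
  have h1 : (1 + ‖x‖) ^ k ≤ 2 ^ k * (1 + ‖x‖ ^ k) := by
    have := add_pow_le (zero_le_one) (norm_nonneg x) k
    rw [one_pow] at this
    refine this.trans (mul_le_mul_of_nonneg_right (pow_le_pow_right₀ one_le_two (by omega))
      (by positivity))
  rw [norm_mul, norm_mul, norm_norm, norm_norm, Real.norm_eq_abs]
  calc |W x| * (‖φ x‖ * ‖ψ x‖) ≤ (C * (2 ^ k * (1 + ‖x‖ ^ k))) * (‖φ x‖ * M) := by
        refine mul_le_mul ((hC x).trans (mul_le_mul_of_nonneg_left h1 hC0))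
          (mul_le_mul_of_nonneg_left (hM x) (norm_nonneg _)) (by positivity) (by positivity)
    _ = _ := by ring

theorem integrable_polyBounded_normSq {F : Type} [NormedAddCommGroup F] [NormedSpace ℝ F]
    {W : EuclideanSpace ℝ ι → ℝ} (hW : PolyBounded W) (φ : 𝓢(EuclideanSpace ℝ ι, F)) :
    Integrable (fun x => W x * ‖φ x‖ ^ 2) := by
  simpa [sq] using integrable_polyBounded_mul hW φ φ

theorem integrable_normSq {F : Type} [NormedAddCommGroup F] [NormedSpace ℝ F]
    (φ : 𝓢(EuclideanSpace ℝ ι, F)) : Integrable (fun x => ‖φ x‖ ^ 2) := by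
  simpa using integrable_polyBounded_normSq (PolyBounded.const 1) φ

theorem integrable_conj_mul (φ ψ : 𝓢(EuclideanSpace ℝ ι, ℂ)) :
    Integrable (fun x => (starRingEnd ℂ) (φ x) * ψ x) := by
  refine (integrable_polyBounded_mul (PolyBounded.const 1) φ ψ).mono'
    (by have := φ.continuous; have := ψ.continuous; fun_prop) (Filter.Eventually.of_forall fun x => ?_)
  simp

theorem inner_incl (f g : 𝓢(EuclideanSpace ℝ ι, ℂ)) :
    inner ℂ (incl ι f) (incl ι g) = ∫ x, (starRingEnd ℂ) (f x) * g x := by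
  simp [incl, mul_comm]

theorem norm_incl_sq (φ : 𝓢(EuclideanSpace ℝ ι, ℂ)) :
    ‖incl ι φ‖ ^ 2 = ∫ x, ‖φ x‖ ^ 2 := by
  have h := inner_self_eq_norm_sq (𝕜 := ℂ) (incl ι φ)
  rw [← h, inner_incl]
  have : ∀ x, (starRingEnd ℂ) (φ x) * φ x = ((‖φ x‖ ^ 2 : ℝ) : ℂ) := fun x => by
    rw [mul_comm, Complex.mul_conj, Complex.normSq_eq_norm_sq]
  simp_rw [this]
  rw [integral_complex_ofReal]
  simp

section

variable [DecidableEq ι]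

theorem grad_apply (φ : 𝓢(EuclideanSpace ℝ ι, ℂ)) (x : EuclideanSpace ℝ ι) (i : ι) :
    grad φ x i = (∂_{EuclideanSpace.single i (1 : ℝ)} φ : 𝓢(EuclideanSpace ℝ ι, ℂ)) x := rfl

theorem integrable_hermForm_grad (A : Matrix ι ι ℝ) (φ : 𝓢(EuclideanSpace ℝ ι, ℂ)) :
    Integrable (fun x => hermForm A (grad φ x)) := by
  unfold hermForm
  refine integrable_finsetSum _ fun i _ => integrable_finsetSum _ fun j _ => ?_
  simp only [grad_apply]
  exact (integrable_conj_mul _ _).re.const_mul _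

theorem integrable_energy (A : Matrix ι ι ℝ) {W : EuclideanSpace ℝ ι → ℝ} (hW : PolyBounded W)
    (φ : 𝓢(EuclideanSpace ℝ ι, ℂ)) :
    Integrable (fun x => hermForm A (grad φ x) + W x * ‖φ x‖ ^ 2) :=
  (integrable_hermForm_grad A φ).add (integrable_polyBounded_normSq hW φ)

/-- One integration by parts; its sign cancels the minus sign in `quadD`. From here on the operator
enters only through its quadratic form. -/
theorem re_inner_schrodinger (A : Matrix ι ι ℝ) {W : EuclideanSpace ℝ ι → ℝ}
    (hW : (fun x => ((W x : ℝ) : ℂ)).HasTemperateGrowth) (φ : 𝓢(EuclideanSpace ℝ ι, ℂ)) :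
    (inner ℂ (incl ι φ) (incl ι (schrodinger A W φ))).re = energy A W φ := by
  have hWr : PolyBounded W := by
    have h2 : (fun x => Complex.reCLM ((W x : ℝ) : ℂ)).HasTemperateGrowth :=
      (Complex.reCLM.hasTemperateGrowth).comp hW
    exact .of_hasTemperateGrowth (by simpa using h2)
  have hq : (inner ℂ (incl ι φ) (incl ι (quadD A φ))).re = ∫ x, hermForm A (grad φ x) := by
    simp only [quadD, LinearMap.neg_apply, LinearMap.sum_apply, LinearMap.smul_apply, map_neg,
      map_sum, map_smul, inner_neg_right, inner_sum, inner_smul_right]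
    have hint : ∀ i j, Integrable
        (fun x => A i j * ((starRingEnd ℂ) (grad φ x i) * grad φ x j).re) := fun i j => by
      simp only [grad_apply]
      exact (integrable_conj_mul _ _).re.const_mul _
    unfold hermForm
    rw [integral_finsetSum _ fun i _ => integrable_finsetSum _ fun j _ => hint i j,
      Complex.neg_re, Complex.re_sum, ← Finset.sum_neg_distrib]
    refine Finset.sum_congr rfl fun i _ => ?_
    rw [integral_finsetSum _ fun j _ => hint i j, Complex.re_sum, ← Finset.sum_neg_distrib]
    refine Finset.sum_congr rfl fun j _ => ?_
    rw [integral_const_mul, Complex.re_ofReal_mul, ← mul_neg]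
    congr 1
    have h3 := congrArg Complex.re (inner_lineDeriv (EuclideanSpace.single i (1 : ℝ)) φ
      (∂_{EuclideanSpace.single j (1 : ℝ)} φ))
    rw [inner_incl, Complex.neg_re] at h3
    exact h3.symm.trans (integral_re (𝕜 := ℂ) (integrable_conj_mul
      (∂_{EuclideanSpace.single i (1 : ℝ)} φ) (∂_{EuclideanSpace.single j (1 : ℝ)} φ))).symm
  simp only [schrodinger, LinearMap.add_apply, map_add, inner_add_right, Complex.add_re, hq, energy]
  rw [integral_add (integrable_hermForm_grad A φ) (integrable_polyBounded_normSq hWr φ)]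
  congr 1
  rw [inner_incl]
  have : ∀ x, (starRingEnd ℂ) (φ x) * ((SchwartzMap.smulLeftCLM ℂ (fun x => ((W x : ℝ) : ℂ)) φ) x)
      = ((W x * ‖φ x‖ ^ 2 : ℝ) : ℂ) := fun x => by
    rw [SchwartzMap.smulLeftCLM_apply_apply hW, Complex.ofReal_mul, ← Complex.normSq_eq_norm_sq,
      ← Complex.mul_conj, smul_eq_mul]
    ring
  refine (congrArg Complex.re (integral_congr_ae (Filter.Eventually.of_forall this))).trans ?_
  rw [integral_complex_ofReal]
  simp

end

end Energy

/-! ### Min-max principle for a bounded symmetric inverse -/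

section Spectral

variable {H : Type} [NormedAddCommGroup H] [InnerProductSpace ℂ H]

/-- The `μ`-eigenspace of `R⁻¹ - s`, expressed through `R`. -/
def resolventEigenspace (R : H →L[ℂ] H) (s μ : ℝ) : Submodule ℂ H :=
  LinearMap.ker ((LinearMap.id : H →ₗ[ℂ] H) - ((μ + s : ℝ) : ℂ) • R.toLinearMap)

theorem mem_resolventEigenspace {R : H →L[ℂ] H} {s μ : ℝ} {u : H} :
    u ∈ resolventEigenspace R s μ ↔ ((μ + s : ℝ) : ℂ) • R u = u := by
  rw [resolventEigenspace, LinearMap.mem_ker, LinearMap.sub_apply, sub_eq_zero, eq_comm]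
  rfl

theorem resolventEigenspace_inner_eq_zero {R : H →L[ℂ] H} (hR : R.IsSymmetric) {s μ μ' : ℝ}
    (h : μ ≠ μ') {u w : H} (hu : u ∈ resolventEigenspace R s μ)
    (hw : w ∈ resolventEigenspace R s μ') : inner ℂ u w = 0 := by
  rw [mem_resolventEigenspace] at hu hw
  have h1 : inner ℂ u w = ((μ + s : ℝ) : ℂ) * inner ℂ (R u) w := by
    conv_lhs => rw [← hu]
    rw [inner_smul_left, Complex.conj_ofReal]
  have h2 : inner ℂ u w = ((μ' + s : ℝ) : ℂ) * inner ℂ (R u) w := by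
    conv_lhs => rw [← hw]
    rw [inner_smul_right]
    congr 1
    exact (hR u w).symm
  have h3 : (((μ + s : ℝ) : ℂ) - ((μ' + s : ℝ) : ℂ)) * inner ℂ (R u) w = 0 := by
    rw [sub_mul, ← h1, ← h2, sub_self]
  rcases mul_eq_zero.1 h3 with h4 | h4
  · exfalso
    rw [sub_eq_zero] at h4
    exact h (by simpa using Complex.ofReal_injective h4)
  · rw [h1, h4, mul_zero]

/-- Norms and forms of sums of eigenvectors are all instances of this, with different real
coefficients. -/
theorem re_inner_finset_sum_of_orthogonal {σ : Type} (t : Finset σ) (v : σ → H)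
    (hv : ∀ i ∈ t, ∀ j ∈ t, i ≠ j → inner ℂ (v i) (v j) = 0) (a b : σ → ℝ) :
    (inner ℂ (∑ i ∈ t, (a i : ℂ) • v i) (∑ i ∈ t, (b i : ℂ) • v i)).re
      = ∑ i ∈ t, a i * b i * ‖v i‖ ^ 2 := by
  rw [sum_inner, Complex.re_sum]
  refine Finset.sum_congr rfl fun i hi => ?_
  rw [inner_sum, Finset.sum_eq_single i]
  · rw [inner_smul_left, inner_smul_right, Complex.conj_ofReal, Complex.re_ofReal_mul,
      Complex.re_ofReal_mul, mul_assoc]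
    congr 2
    exact inner_self_eq_norm_sq (𝕜 := ℂ) (v i)
  · intro j hj hji
    rw [inner_smul_left, inner_smul_right, hv i hi j hj (Ne.symm hji)]
    simp
  · exact fun h => absurd hi h

/-- Upper half of min-max. On a nonzero sum of eigenvectors below `Λ` the form is strictly less than
`Λ` times the squared norm, whereas on the kernel of `ℓ` it is at least that; so `ℓ` is injective on
such sums and their dimension is at most that of `F`. Compactness of `R` plays no role. -/
theorem sum_finrank_resolventEigenspace_le {R : H →L[ℂ] H} (hR : R.IsSymmetric) {s Λ K : ℝ}
    {F : Type} [NormedAddCommGroup F] [NormedSpace ℂ F] [FiniteDimensional ℂ F] (ℓ : H →ₗ[ℂ] F)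
    (h : ∀ f, (Λ + s) * ‖R f‖ ^ 2 - K * ‖ℓ (R f)‖ ^ 2 ≤ (inner ℂ (R f) f).re)
    (t : Finset (Set.Iio Λ)) :
    (∀ μ ∈ t, FiniteDimensional ℂ (resolventEigenspace R s μ)) ∧
    ∑ μ ∈ t, Module.finrank ℂ (resolventEigenspace R s μ) ≤ Module.finrank ℂ F := by
  classical
  let Ψ : (∀ μ : t, resolventEigenspace R s μ) →ₗ[ℂ] F :=
    ∑ μ : t, ℓ ∘ₗ (resolventEigenspace R s μ).subtype ∘ₗ LinearMap.proj μ
  have hΨ : ∀ u, Ψ u = ℓ (∑ μ : t, (u μ : H)) := fun u => by simp [Ψ, LinearMap.sum_apply]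
  have hinj : Function.Injective Ψ := by
    rw [← LinearMap.ker_eq_bot, LinearMap.ker_eq_bot']
    intro u hu
    have horth : ∀ i ∈ Finset.univ, ∀ j ∈ (Finset.univ : Finset t), i ≠ j →
        inner ℂ (u i : H) (u j : H) = 0 := fun i _ j _ hij =>
      resolventEigenspace_inner_eq_zero hR (fun h' => hij (Subtype.ext (Subtype.ext h')))
        (u i).2 (u j).2
    -- The hypothesis speaks of vectors `R f`; the eigenvector sum is one, with `f = ∑ (μ + s) u_μ`.
    have hRf : R (∑ μ : t, (((μ : ℝ) + s : ℝ) : ℂ) • (u μ : H)) = ∑ μ : t, ((1 : ℝ) : ℂ) • (u μ : H) := by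
      rw [map_sum]
      refine Finset.sum_congr rfl fun μ _ => ?_
      rw [map_smul, mem_resolventEigenspace.1 (u μ).2, Complex.ofReal_one, one_smul]
    have h1 := h (∑ μ : t, (((μ : ℝ) + s : ℝ) : ℂ) • (u μ : H))
    rw [hRf] at h1
    have hz : ℓ (∑ μ : t, ((1 : ℝ) : ℂ) • (u μ : H)) = 0 := by
      simpa [hΨ] using hu
    have hn : ‖∑ μ : t, ((1 : ℝ) : ℂ) • (u μ : H)‖ ^ 2 = ∑ μ : t, ‖(u μ : H)‖ ^ 2 := by
      have := re_inner_finset_sum_of_orthogonal Finset.univ (fun μ : t => (u μ : H)) horth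
        (fun _ => 1) (fun _ => 1)
      refine (inner_self_eq_norm_sq (𝕜 := ℂ) _).symm.trans (this.trans ?_)
      simp
    rw [hz, hn, re_inner_finset_sum_of_orthogonal Finset.univ (fun μ : t => (u μ : H)) horth
        (fun _ => 1) (fun μ => (μ : ℝ) + s), Finset.mul_sum] at h1
    have h2 : ∑ μ : t, (Λ - (μ : ℝ)) * ‖(u μ : H)‖ ^ 2 ≤ 0 := by
      have : ∑ μ : t, (Λ - (μ : ℝ)) * ‖(u μ : H)‖ ^ 2 = ∑ μ : t, (Λ + s) * ‖(u μ : H)‖ ^ 2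
        - ∑ μ : t, 1 * ((μ : ℝ) + s) * ‖(u μ : H)‖ ^ 2 := by
        rw [← Finset.sum_sub_distrib]
        exact Finset.sum_congr rfl fun _ _ => by ring
      rw [this]
      simpa using h1
    have hpos : ∀ μ ∈ (Finset.univ : Finset t), 0 ≤ (Λ - (μ : ℝ)) * ‖(u μ : H)‖ ^ 2 := fun μ _ =>
      mul_nonneg (sub_nonneg.2 (le_of_lt μ.1.2)) (by positivity)
    have h3 := (Finset.sum_eq_zero_iff_of_nonneg hpos).1 (le_antisymm h2 (Finset.sum_nonneg hpos))
    funext μ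
    have h4 := h3 μ (Finset.mem_univ _)
    have h5 : (0 : ℝ) < Λ - (μ : ℝ) := sub_pos.2 μ.1.2
    have h6 : ‖(u μ : H)‖ = 0 := by
      rcases mul_eq_zero.1 h4 with h7 | h7
      · exact absurd h7 h5.ne'
      · exact pow_eq_zero_iff two_ne_zero |>.1 h7
    exact Subtype.ext (norm_eq_zero.1 h6)
  have hfin : FiniteDimensional ℂ (∀ μ : t, resolventEigenspace R s μ) :=
    FiniteDimensional.of_injective Ψ hinj
  have hfin' : ∀ μ ∈ t, FiniteDimensional ℂ (resolventEigenspace R s μ) := fun μ hμ =>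
    FiniteDimensional.of_surjective (LinearMap.proj (R := ℂ) (⟨μ, hμ⟩ : t)
      : (∀ μ : t, resolventEigenspace R s μ) →ₗ[ℂ] _) (LinearMap.proj_surjective _)
  refine ⟨hfin', ?_⟩
  have : ∀ μ : t, FiniteDimensional ℂ (resolventEigenspace R s μ) := fun μ => hfin' μ.1 μ.2
  have h8 := LinearMap.finrank_le_finrank_of_injective hinj
  rw [Module.finrank_pi_fintype] at h8
  rwa [← Finset.sum_coe_sort]

theorem toENat_rank_eq_finrank (M : Type) [AddCommGroup M] [Module ℂ M] [FiniteDimensional ℂ M] :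
    Cardinal.toENat (Module.rank ℂ M) = (Module.finrank ℂ M : ℕ∞) := by
  rw [← Module.finrank_eq_rank]
  simp

theorem tsum_rank_resolventEigenspace_le {R : H →L[ℂ] H} (hR : R.IsSymmetric) {s Λ K : ℝ}
    {F : Type} [NormedAddCommGroup F] [NormedSpace ℂ F] [FiniteDimensional ℂ F] (ℓ : H →ₗ[ℂ] F)
    (h : ∀ f, (Λ + s) * ‖R f‖ ^ 2 - K * ‖ℓ (R f)‖ ^ 2 ≤ (inner ℂ (R f) f).re) :
    ∑' μ : Set.Iio Λ,
      ((Cardinal.toENat (Module.rank ℂ (resolventEigenspace R s μ)) : ℕ∞) : ℝ≥0∞)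
      ≤ (Module.finrank ℂ F : ℝ≥0∞) := by
  rw [ENNReal.tsum_eq_iSup_sum]
  refine iSup_le fun t => ?_
  obtain ⟨hf, hs⟩ := sum_finrank_resolventEigenspace_le hR ℓ h t
  calc ∑ μ ∈ t, ((Cardinal.toENat (Module.rank ℂ (resolventEigenspace R s μ)) : ℕ∞) : ℝ≥0∞)
      = ∑ μ ∈ t, (Module.finrank ℂ (resolventEigenspace R s μ) : ℝ≥0∞) := by
        refine Finset.sum_congr rfl fun μ hμ => ?_
        have := hf μ hμ
        rw [toENat_rank_eq_finrank]
        rfl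
    _ ≤ _ := by
        rw [← Nat.cast_sum]
        exact_mod_cast hs

/-- A form bound at a high level makes `R` small on the kernel of `ℓ ∘ R`, whose orthogonal
complement is finite dimensional. Thus `R` is a norm limit of finite-rank operators. -/
theorem isCompactOperator_of_form_bound [CompleteSpace H] {R : H →L[ℂ] H} {s : ℝ}
    (h : ∀ Λ : ℝ, ∃ (F : Type) (_ : NormedAddCommGroup F) (_ : NormedSpace ℂ F)
      (_ : FiniteDimensional ℂ F) (ℓ : H →L[ℂ] F) (K : ℝ), ∀ f,
      (Λ + s) * ‖R f‖ ^ 2 - K * ‖ℓ (R f)‖ ^ 2 ≤ (inner ℂ (R f) f).re) :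
    IsCompactOperator R := by
  have hcl : IsClosed {T : H →L[ℂ] H | IsCompactOperator T} := isClosed_setOfPred_isCompactOperator
  change R ∈ {T : H →L[ℂ] H | IsCompactOperator T}
  rw [← hcl.closure_eq, Metric.mem_closure_iff]
  intro ε hε
  -- At this level `Λ + s = 2 / ε`, which bounds `R` by `ε / 2` on the kernel and leaves room for
  -- the strict inequality.
  obtain ⟨F, _, _, _, ℓ, K, hF⟩ := h (2 / ε - s)
  let N : Submodule ℂ H := LinearMap.ker (ℓ.comp R).toLinearMap
  have hNcl : IsClosed (N : Set H) := ContinuousLinearMap.isClosed_ker (ℓ.comp R)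
  have : CompleteSpace N := hNcl.completeSpace_coe
  have hfd : FiniteDimensional ℂ (Nᗮ : Submodule ℂ H) := by
    refine FiniteDimensional.of_injective ((ℓ.comp R).toLinearMap.domRestrict Nᗮ) ?_
    rw [← LinearMap.ker_eq_bot, LinearMap.ker_eq_bot']
    intro u hu
    have h1 : (u : H) ∈ N := hu
    have h2 : inner ℂ (u : H) (u : H) = 0 := Submodule.inner_right_of_mem_orthogonal h1 u.2
    exact Subtype.ext (inner_self_eq_zero.1 h2)
  have hcomp : IsCompactOperator (R.comp Nᗮ.starProjection) := by
    have h1 : IsCompactOperator (Nᗮ.orthogonalProjectionOnto) := by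
      have h2 := (isCompactOperator_id (E := (Nᗮ : Submodule ℂ H))).comp_clm
        (Nᗮ.orthogonalProjectionOnto)
      simpa using h2
    exact h1.clm_comp (R.comp Nᗮ.subtypeL)
  refine ⟨R.comp Nᗮ.starProjection, hcomp, ?_⟩
  have hdiff : ∀ f, R f - R (Nᗮ.starProjection f) = R (N.starProjection f) := fun f => by
    rw [← map_sub]
    congr 1
    rw [sub_eq_iff_eq_add]
    rw [Submodule.starProjection_orthogonal']
    simp
  rw [dist_eq_norm]
  refine lt_of_le_of_lt (ContinuousLinearMap.opNorm_le_bound _ (by positivity : (0:ℝ) ≤ ε / 2)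
    fun f => ?_) (by linarith)
  rw [sub_apply, ContinuousLinearMap.comp_apply, hdiff]
  set g := N.starProjection f with hg
  have hgN : ℓ (R g) = 0 := by
    have : g ∈ N := Submodule.starProjection_apply_mem N f
    exact this
  have h3 := hF g
  rw [hgN] at h3
  have h4 : (inner ℂ (R g) g).re ≤ ‖R g‖ * ‖g‖ := (Complex.re_le_norm _).trans (norm_inner_le_norm _ _)
  have h5 : ‖g‖ ≤ ‖f‖ := Submodule.norm_starProjection_apply_le N f
  have h6 : 2 / ε * ‖R g‖ ^ 2 ≤ ‖R g‖ * ‖g‖ := by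
    have : 2 / ε - s + s = 2 / ε := by ring
    rw [this] at h3
    simpa using h3.trans h4
  rcases (norm_nonneg (R g)).eq_or_lt with h7 | h7
  · rw [← h7]; positivity
  · have h8 : 2 / ε * ‖R g‖ ≤ ‖g‖ := by
      by_contra hcon
      push Not at hcon
      nlinarith
    rw [div_mul_eq_mul_div, div_le_iff₀ hε] at h8
    nlinarith

/-- By the spectral theorem for compact symmetric operators, a vector orthogonal to all eigenspaces
below `Λ` lies in the closed span `D` of those at or above `Λ`. There the form is diagonal, and the
inequality passes to the closure by continuity. -/
theorem form_bound_of_orthogonal [CompleteSpace H] {R : H →L[ℂ] H} (hR : R.IsSymmetric)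
    (hc : IsCompactOperator R) (hinj : Function.Injective R)
    (hnn : ∀ f, 0 ≤ (inner ℂ (R f) f).re) {s Λ : ℝ} (hs : 0 < Λ + s) (f : H)
    (hf : ∀ μ < Λ, ∀ w ∈ resolventEigenspace R s μ, inner ℂ w f = 0) :
    (Λ + s) * ‖R f‖ ^ 2 ≤ (inner ℂ (R f) f).re := by
  classical
  let D : Submodule ℂ H := ⨆ μ : Set.Ici Λ, resolventEigenspace R s μ
  have hD : ∀ g ∈ D, (Λ + s) * ‖R g‖ ^ 2 ≤ (inner ℂ (R g) g).re := by
    intro g hg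
    obtain ⟨u, hu⟩ := (Submodule.mem_iSup_iff_exists_dfinsupp' _ g).1 hg
    rw [DFinsupp.sum] at hu
    have hpos : ∀ μ : Set.Ici Λ, 0 < (μ : ℝ) + s := fun μ => by
      have := μ.2
      rw [Set.mem_Ici] at this
      linarith
    have hRu : ∀ μ : Set.Ici Λ, R (u μ : H) = ((((μ : ℝ) + s)⁻¹ : ℝ) : ℂ) • (u μ : H) := fun μ => by
      have h1 := mem_resolventEigenspace.1 (u μ).2
      have h2 : (((μ : ℝ) + s : ℝ) : ℂ) ≠ 0 := Complex.ofReal_ne_zero.2 (hpos μ).ne'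
      rw [Complex.ofReal_inv, eq_inv_smul_iff₀ h2, h1]
    have horth : ∀ i ∈ u.support, ∀ j ∈ u.support, i ≠ j →
        inner ℂ (u i : H) (u j : H) = 0 := fun i _ j _ hij =>
      resolventEigenspace_inner_eq_zero hR (fun h' => hij (Subtype.ext h')) (u i).2 (u j).2
    have hRg : R g = ∑ μ ∈ u.support, ((((μ : ℝ) + s)⁻¹ : ℝ) : ℂ) • (u μ : H) := by
      rw [← hu, map_sum]
      exact Finset.sum_congr rfl fun μ _ => hRu μ
    have hg1 : g = ∑ μ ∈ u.support, ((1 : ℝ) : ℂ) • (u μ : H) := by simp [hu]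
    have e1 : ‖R g‖ ^ 2 = ∑ μ ∈ u.support, ((μ : ℝ) + s)⁻¹ * ((μ : ℝ) + s)⁻¹ * ‖(u μ : H)‖ ^ 2 := by
      refine (inner_self_eq_norm_sq (𝕜 := ℂ) _).symm.trans ?_
      rw [hRg]
      exact re_inner_finset_sum_of_orthogonal u.support (fun μ => (u μ : H)) horth _ _
    have e2 : (inner ℂ (R g) g).re = ∑ μ ∈ u.support, ((μ : ℝ) + s)⁻¹ * 1 * ‖(u μ : H)‖ ^ 2 := by
      rw [hRg]
      conv_lhs => rw [hg1]
      exact re_inner_finset_sum_of_orthogonal u.support (fun μ => (u μ : H)) horth _ _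
    rw [e1, e2, Finset.mul_sum]
    refine Finset.sum_le_sum fun μ _ => ?_
    rw [← mul_assoc]
    refine mul_le_mul_of_nonneg_right ?_ (by positivity)
    have h3 : Λ + s ≤ (μ : ℝ) + s := by
      have := μ.2
      rw [Set.mem_Ici] at this
      linarith
    have h4 : (Λ + s) * ((μ : ℝ) + s)⁻¹ ≤ 1 := by
      rw [← div_eq_mul_inv, div_le_one (hpos μ)]
      exact h3
    have h5 : 0 < ((μ : ℝ) + s)⁻¹ := inv_pos.2 (hpos μ)
    nlinarith
  have hDcl : ∀ g ∈ D.topologicalClosure, (Λ + s) * ‖R g‖ ^ 2 ≤ (inner ℂ (R g) g).re := by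
    have hclosed : IsClosed {g : H | (Λ + s) * ‖R g‖ ^ 2 ≤ (inner ℂ (R g) g).re} := by
      refine isClosed_le (by fun_prop) ?_
      exact Complex.continuous_re.comp (R.continuous.inner continuous_id)
    exact fun g hg => closure_minimal (s := (D : Set H)) hD hclosed hg
  suffices f ∈ D.topologicalClosure from hDcl f this
  set C := D.topologicalClosure
  have : CompleteSpace C := (Submodule.isClosed_topologicalClosure D).completeSpace_coe
  have hmem := Submodule.starProjection_apply_mem C f
  have hdiff := Submodule.sub_starProjection_mem_orthogonal (K := C) f
  set k := C.starProjection f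
  have hk : ∀ μ < Λ, ∀ w ∈ resolventEigenspace R s μ, inner ℂ w k = 0 := by
    intro μ hμ w hw
    have h1 : D ≤ (Submodule.span ℂ {w})ᗮ := by
      refine iSup_le fun ν => ?_
      intro v hv
      rw [Submodule.mem_orthogonal_singleton_iff_inner_right]
      have h2 := ν.2
      rw [Set.mem_Ici] at h2
      exact resolventEigenspace_inner_eq_zero hR (by linarith : μ < ν).ne hw hv
    have h3 := Submodule.topologicalClosure_minimal D h1 (Submodule.isClosed_orthogonal _)
    exact (Submodule.mem_orthogonal_singleton_iff_inner_right.1 (h3 hmem))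
  -- The projection `k` is orthogonal to the low eigenspaces because `D` is, so `f - k` is
  -- orthogonal to the low and to the high eigenspaces alike, hence to every eigenvector of `R`.
  have hzero : f - k = 0 := by
    have hbot := ContinuousLinearMap.orthogonalComplement_iSup_eigenspaces_eq_bot hc hR
    have : f - k ∈ (⨆ ν, Module.End.eigenspace (R : Module.End ℂ H) ν)ᗮ := by
      rw [Submodule.mem_orthogonal]
      intro v hv
      have hle : (⨆ ν, Module.End.eigenspace (R : Module.End ℂ H) ν) ≤
          (Submodule.span ℂ {f - k})ᗮ := by
        refine iSup_le fun ν v hv => ?_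
        rw [Submodule.mem_orthogonal_singleton_iff_inner_left]
        rw [Module.End.mem_eigenspace_iff] at hv
        by_cases hv0 : v = 0
        · simp [hv0]
        have hRv : R v = ν • v := hv
        have hν : (ν.re : ℂ) = ν := by
          have hev : Module.End.HasEigenvalue (R : Module.End ℂ H) ν :=
            Module.End.hasEigenvalue_of_hasEigenvector (x := v)
              ⟨Module.End.mem_eigenspace_iff.2 hv, hv0⟩
          exact Complex.conj_eq_iff_re.1 (LinearMap.IsSymmetric.conj_eigenvalue_eq_self hR hev)
        have hνpos : 0 < ν.re := by
          have h1 := hnn v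
          rw [hRv, ← hν, inner_smul_left, Complex.conj_ofReal, Complex.re_ofReal_mul] at h1
          have h2 : (inner ℂ v v).re = ‖v‖ ^ 2 := inner_self_eq_norm_sq (𝕜 := ℂ) v
          rw [h2] at h1
          have h3 : 0 < ‖v‖ ^ 2 := by positivity
          have h4 : 0 ≤ ν.re := nonneg_of_mul_nonneg_left h1 h3
          refine lt_of_le_of_ne h4 fun h5 => hv0 (hinj ?_)
          rw [hRv, ← hν, ← h5]
          simp
        -- Positivity and injectivity of `R` force `ν > 0`, so `ν` is the inverse of `μ + s` for a
        -- real `μ`.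
        have hve : v ∈ resolventEigenspace R s (ν.re⁻¹ - s) := by
          rw [mem_resolventEigenspace, hRv, smul_smul, sub_add_cancel]
          conv_lhs => rw [← hν]
          rw [Complex.ofReal_re, ← Complex.ofReal_mul, inv_mul_cancel₀ hνpos.ne']
          simp
        rcases lt_or_ge (ν.re⁻¹ - s) Λ with h6 | h6
        · rw [inner_sub_right, hf _ h6 v hve, hk _ h6 v hve, sub_zero]
        · have h7 : v ∈ D := Submodule.mem_iSup_of_mem (⟨ν.re⁻¹ - s, h6⟩ : Set.Ici Λ) hve
          exact Submodule.inner_right_of_mem_orthogonal (D.le_topologicalClosure h7) hdiff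
      exact Submodule.mem_orthogonal_singleton_iff_inner_left.1 (hle hv)
    rw [hbot] at this
    exact (Submodule.mem_bot ℂ).1 this
  rw [sub_eq_zero] at hzero
  rw [hzero]
  exact hmem

/-- Lower half of min-max. If the low eigenspaces had total dimension below `card σ`, some nonzero
`c` would make `Φ c` orthogonal to all of them, against `form_bound_of_orthogonal`. Applied with `Φ
c = (T + s) φ`, the hypothesis is a bound on the form of `T` at `φ = R (Φ c)`. -/
theorem le_tsum_rank_resolventEigenspace [CompleteSpace H] {R : H →L[ℂ] H} (hR : R.IsSymmetric)
    (hc : IsCompactOperator R) (hinj : Function.Injective R)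
    (hnn : ∀ f, 0 ≤ (inner ℂ (R f) f).re) {s Λ : ℝ} (hs : 0 < Λ + s)
    {σ : Type} [Fintype σ] (Φ : (σ → ℂ) →ₗ[ℂ] H)
    (hΦ : ∀ c ≠ 0, (inner ℂ (R (Φ c)) (Φ c)).re < (Λ + s) * ‖R (Φ c)‖ ^ 2) :
    (Fintype.card σ : ℝ≥0∞) ≤ ∑' μ : Set.Iio Λ,
      ((Cardinal.toENat (Module.rank ℂ (resolventEigenspace R s μ)) : ℕ∞) : ℝ≥0∞) := by
  classical
  by_contra! hlt
  have htop := (hlt.trans_le le_top).ne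
  -- The terms are natural numbers, so a finite sum allows only finitely many nonzero eigenspaces.
  have hfinset := ENNReal.finite_const_le_of_tsum_ne_top htop (one_ne_zero)
  have hfd : ∀ μ : Set.Iio Λ, FiniteDimensional ℂ (resolventEigenspace R s μ) := fun μ => by
    have h1 := ENNReal.ne_top_of_tsum_ne_top htop μ
    have h2 : Cardinal.toENat (Module.rank ℂ (resolventEigenspace R s μ)) ≠ ⊤ := by
      intro h3
      rw [h3] at h1
      exact h1 rfl
    rw [Cardinal.toENat_ne_top] at h2
    exact Module.rank_lt_aleph0_iff.1 h2
  set t := hfinset.toFinset with ht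
  have hout : ∀ μ : Set.Iio Λ, μ ∉ t → resolventEigenspace R s μ = ⊥ := by
    intro μ hμ
    rw [ht, Set.Finite.mem_toFinset, Set.mem_ofPred_eq, not_le] at hμ
    have := hfd μ
    rw [toENat_rank_eq_finrank] at hμ
    have h1 : Module.finrank ℂ (resolventEigenspace R s μ) < 1 := by
      exact_mod_cast hμ
    exact Submodule.finrank_eq_zero.1 (by omega)
  have hsum : ∑ μ ∈ t, Module.finrank ℂ (resolventEigenspace R s μ) < Fintype.card σ := by
    have h1 := (ENNReal.sum_le_tsum (f := fun μ : Set.Iio Λ =>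
      ((Cardinal.toENat (Module.rank ℂ (resolventEigenspace R s μ)) : ℕ∞) : ℝ≥0∞)) t).trans_lt hlt
    have h2 : ∑ μ ∈ t, ((Cardinal.toENat (Module.rank ℂ (resolventEigenspace R s μ)) : ℕ∞) : ℝ≥0∞)
        = ((∑ μ ∈ t, Module.finrank ℂ (resolventEigenspace R s μ) : ℕ) : ℝ≥0∞) := by
      rw [Nat.cast_sum]
      refine Finset.sum_congr rfl fun μ _ => ?_
      have := hfd μ
      rw [toENat_rank_eq_finrank]
      rfl
    rw [h2] at h1
    exact_mod_cast h1
  let Ψ : (σ → ℂ) →ₗ[ℂ] (∀ μ : t, resolventEigenspace R s μ) :=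
    LinearMap.pi fun μ : t =>
      haveI := hfd μ.1
      ((resolventEigenspace R s μ).orthogonalProjectionOnto).toLinearMap ∘ₗ Φ
  have : ∀ μ : t, FiniteDimensional ℂ (resolventEigenspace R s μ) := fun μ => hfd μ.1
  have hker : LinearMap.ker Ψ ≠ ⊥ := by
    refine LinearMap.ker_ne_bot_of_finrank_lt ?_
    rw [Module.finrank_pi_fintype, Module.finrank_fintype_fun_eq_card]
    rwa [Finset.sum_coe_sort t (fun μ => Module.finrank ℂ (resolventEigenspace R s μ))]
  obtain ⟨c, hcmem, hc0⟩ := Submodule.exists_mem_ne_zero_of_ne_bot hker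
  refine absurd (hΦ c hc0) (not_lt.2 (form_bound_of_orthogonal hR hc hinj hnn hs (Φ c) ?_))
  intro μ hμ w hw
  by_cases hμt : (⟨μ, hμ⟩ : Set.Iio Λ) ∈ t
  · have h1 : Ψ c ⟨⟨μ, hμ⟩, hμt⟩ = 0 := by
      rw [LinearMap.mem_ker.1 hcmem]
      rfl
    have h2 : Φ c ∈ (resolventEigenspace R s μ)ᗮ := by
      have := hfd ⟨μ, hμ⟩
      exact (Submodule.orthogonalProjectionOnto_eq_zero_iff
        (K := resolventEigenspace R s ((⟨μ, hμ⟩ : Set.Iio Λ) : ℝ))).1 h1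
    exact Submodule.inner_right_of_mem_orthogonal hw h2
  · have h1 := hout _ hμt
    rw [h1] at hw
    rw [(Submodule.mem_bot ℂ).1 hw, inner_zero_left]

end Spectral

/-! ### The inverse of `T + s` and eigenvalues of the closure -/

section Resolvent

variable {ι : Type} [Fintype ι]

theorem denseRange_incl (ι : Type) [Fintype ι] : DenseRange (incl ι) :=
  SchwartzMap.denseRange_toLpCLM (F := ℂ) (p := 2) (by simp)

theorem onL2_graph_mem (T : 𝓢(EuclideanSpace ℝ ι, ℂ) →ₗ[ℂ] 𝓢(EuclideanSpace ℝ ι, ℂ))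
    (u v : L2 ι) : (u, v) ∈ (onL2 T).graph ↔ ∃ φ, u = incl ι φ ∧ v = incl ι (T φ) := by
  have happ : ∀ φ : 𝓢(EuclideanSpace ℝ ι, ℂ), ∀ h, onL2 T ⟨incl ι φ, h⟩ = incl ι (T φ) := by
    intro φ h
    have : (LinearEquiv.ofInjective (incl ι) (incl_injective ι)).symm ⟨incl ι φ, h⟩ = φ := by
      rw [LinearEquiv.symm_apply_eq]; rfl
    exact congrArg (fun χ => incl ι (T χ)) this
  rw [LinearPMap.mem_graph_iff]
  constructor
  · rintro ⟨⟨_, φ, rfl⟩, h1, h2⟩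
    exact ⟨φ, h1.symm, h2.symm.trans (happ φ _)⟩
  · rintro ⟨φ, rfl, rfl⟩
    exact ⟨⟨incl ι φ, φ, rfl⟩, rfl, happ φ _⟩

/-- The inverse of `T + s` as a bounded operator, for a symmetric operator `T` such that `T + s`
is bounded below by `1` and has dense range. -/
theorem exists_resolvent (T : 𝓢(EuclideanSpace ℝ ι, ℂ) →ₗ[ℂ] 𝓢(EuclideanSpace ℝ ι, ℂ))
    (hT : ∀ φ ψ, inner ℂ (incl ι (T φ)) (incl ι ψ) = inner ℂ (incl ι φ) (incl ι (T ψ))) {s : ℝ}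
    (hpos : ∀ φ, (1 - s) * ‖incl ι φ‖ ^ 2 ≤ (inner ℂ (incl ι φ) (incl ι (T φ))).re)
    (hd : DenseRange (fun φ => incl ι (T φ + (s : ℂ) • φ))) :
    ∃ R : L2 ι →L[ℂ] L2 ι, (∀ φ, R (incl ι (T φ + (s : ℂ) • φ)) = incl ι φ) ∧ R.IsSymmetric ∧
      Function.Injective R ∧ (∀ f, 0 ≤ (inner ℂ (R f) f).re) ∧
      ∀ μ, eigenspace (onL2 T).closure μ = resolventEigenspace R s μ := by
  let G : 𝓢(EuclideanSpace ℝ ι, ℂ) →ₗ[ℂ] L2 ι := (incl ι) ∘ₗ (T + (s : ℂ) • LinearMap.id)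
  have hG : ∀ φ, G φ = incl ι (T φ + (s : ℂ) • φ) := fun φ => rfl
  have hGd : DenseRange G := hd
  have hform : ∀ φ, (inner ℂ (incl ι φ) (G φ)).re =
      (inner ℂ (incl ι φ) (incl ι (T φ))).re + s * ‖incl ι φ‖ ^ 2 := fun φ => by
    rw [hG, map_add, map_smul, inner_add_right, inner_smul_right, Complex.add_re,
      Complex.re_ofReal_mul]
    congr 2
    exact inner_self_eq_norm_sq (𝕜 := ℂ) _
  have hlow : ∀ φ, ‖incl ι φ‖ ≤ 1 * ‖G φ‖ := fun φ => by
    have h1 := hpos φ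
    have h2 : ‖incl ι φ‖ ^ 2 ≤ (inner ℂ (incl ι φ) (G φ)).re := by rw [hform]; linarith
    have h3 := h2.trans ((Complex.re_le_norm _).trans (norm_inner_le_norm _ _))
    rcases (norm_nonneg (incl ι φ)).eq_or_lt with h4 | h4
    · rw [← h4]; positivity
    · rw [sq] at h3
      rw [one_mul]
      exact le_of_mul_le_mul_left h3 h4
  let R : L2 ι →L[ℂ] L2 ι := (incl ι).extendOfNorm G
  have hR : ∀ φ, R (G φ) = incl ι φ := fun φ =>
    LinearMap.extendOfNorm_eq hGd ⟨1, hlow⟩ φ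
  have hsymm : R.IsSymmetric := by
    intro f g
    change inner ℂ (R f) g = inner ℂ f (R g)
    refine hGd.induction_on₂ (p := fun f g => inner ℂ (R f) g = inner ℂ f (R g)) ?_ ?_ f g
    · exact isClosed_eq (by fun_prop) (by fun_prop)
    · intro φ ψ
      rw [hR, hR, hG, hG, map_add, map_add, map_smul, map_smul, inner_add_left, inner_add_right,
        inner_smul_left, inner_smul_right, hT, Complex.conj_ofReal]
  -- The range of `R` contains all Schwartz functions, hence is dense, and by symmetry the kernel of
  -- `R` is orthogonal to it.
  have hinj : Function.Injective R := by
    rw [injective_iff_map_eq_zero]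
    intro f hf
    have h1 : ∀ g, inner ℂ f g = 0 := fun g => by
      refine (denseRange_incl ι).induction_on (p := fun g => inner ℂ f g = 0) g
        (isClosed_eq (by fun_prop) (by fun_prop)) fun φ => ?_
      rw [← hR]
      exact (hsymm f (G φ)).symm.trans (by simp [hf])
    exact inner_self_eq_zero.1 (h1 f)
  have hnn : ∀ f, 0 ≤ (inner ℂ (R f) f).re := fun f => by
    refine hGd.induction_on (p := fun f => 0 ≤ (inner ℂ (R f) f).re) f
      (isClosed_le (by fun_prop) (by fun_prop)) fun φ => ?_
    rw [hR, hform]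
    have := hpos φ
    nlinarith [sq_nonneg ‖incl ι φ‖]
  refine ⟨R, hR, hsymm, hinj, hnn, fun μ => ?_⟩
  have hcl := (onL2_isClosable T hT).graph_closure_eq_closure_graph
  -- The closure of `T` is exactly `R⁻¹ - s`. One inclusion holds because the right-hand condition
  -- is closed, the other because `R` is the continuous extension from the dense range of `T + s`.
  have hgraph : ∀ u v : L2 ι, (u, v) ∈ (onL2 T).closure.graph ↔ R (v + (s : ℂ) • u) = u := by
    intro u v
    rw [← hcl]
    constructor
    · intro h
      have h1 : ((onL2 T).graph : Set (L2 ι × L2 ι)) ⊆ {p | R (p.2 + (s : ℂ) • p.1) = p.1} := by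
        rintro ⟨u, v⟩ h
        obtain ⟨φ, rfl, rfl⟩ := (onL2_graph_mem T u v).1 h
        have := hR φ
        rw [hG, map_add, map_smul] at this
        exact this
      exact closure_minimal h1 (isClosed_eq (by fun_prop) (by fun_prop)) h
    · intro h
      have h1 : ∀ f : L2 ι, (R f, f - (s : ℂ) • R f) ∈ (onL2 T).graph.topologicalClosure := by
        intro f
        refine hGd.induction_on
          (p := fun f => (R f, f - (s : ℂ) • R f) ∈ (onL2 T).graph.topologicalClosure) f ?_ ?_
        · exact (Submodule.isClosed_topologicalClosure _).preimage
            (f := fun f => (R f, f - (s : ℂ) • R f)) (by fun_prop)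
        · intro φ
          refine Submodule.le_topologicalClosure _ ((onL2_graph_mem T _ _).2 ⟨φ, hR φ, ?_⟩)
          rw [hR, hG, map_add, map_smul, add_sub_cancel_right]
      have h2 := h1 (v + (s : ℂ) • u)
      rwa [h, add_sub_cancel_right] at h2
  ext u
  rw [mem_resolventEigenspace]
  change (u, (μ : ℂ) • u) ∈ (onL2 T).closure.graph ↔ _
  rw [hgraph, ← add_smul, map_smul, Complex.ofReal_add]

/-- Both sides are continuous in `f`, so no form domain is needed. The penalty `K ‖ℓ ·‖²` matters
here: a bound stated only on the kernel of `ℓ` would not extend directly by this density argument.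
-/
theorem form_bound_of_dense {T : 𝓢(EuclideanSpace ℝ ι, ℂ) →ₗ[ℂ] 𝓢(EuclideanSpace ℝ ι, ℂ)} {s : ℝ}
    (hd : DenseRange (fun φ => incl ι (T φ + (s : ℂ) • φ))) {R : L2 ι →L[ℂ] L2 ι}
    (hR : ∀ φ, R (incl ι (T φ + (s : ℂ) • φ)) = incl ι φ)
    {F : Type} [NormedAddCommGroup F] [NormedSpace ℂ F] {Λ K : ℝ} (ℓ : L2 ι →L[ℂ] F)
    (h : ∀ φ, Λ * ‖incl ι φ‖ ^ 2 - K * ‖ℓ (incl ι φ)‖ ^ 2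
      ≤ (inner ℂ (incl ι φ) (incl ι (T φ))).re) (f : L2 ι) :
    (Λ + s) * ‖R f‖ ^ 2 - K * ‖ℓ (R f)‖ ^ 2 ≤ (inner ℂ (R f) f).re := by
  refine hd.induction_on
    (p := fun f => (Λ + s) * ‖R f‖ ^ 2 - K * ‖ℓ (R f)‖ ^ 2 ≤ (inner ℂ (R f) f).re) f
    (isClosed_le (by fun_prop) (by fun_prop)) fun φ => ?_
  rw [hR, map_add, map_smul, inner_add_right, inner_smul_right, Complex.add_re,
    Complex.re_ofReal_mul]
  have h1 : (inner ℂ (incl ι φ) (incl ι φ)).re = ‖incl ι φ‖ ^ 2 := inner_self_eq_norm_sq (𝕜 := ℂ) _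
  rw [h1]
  linarith [h φ]

/-- An operator is bounded below by `Λ` on the kernel of finitely many bounded functionals,
quantitatively. -/
def FormBound (T : 𝓢(EuclideanSpace ℝ ι, ℂ) →ₗ[ℂ] 𝓢(EuclideanSpace ℝ ι, ℂ)) (Λ : ℝ) (N : ℕ) :
    Prop :=
  ∃ (F : Type) (_ : NormedAddCommGroup F) (_ : NormedSpace ℂ F)
    (_ : FiniteDimensional ℂ F) (ℓ : L2 ι →L[ℂ] F) (K : ℝ), Module.finrank ℂ F ≤ N ∧
    ∀ φ, Λ * ‖incl ι φ‖ ^ 2 - K * ‖ℓ (incl ι φ)‖ ^ 2 ≤ (inner ℂ (incl ι φ) (incl ι (T φ))).re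

theorem eigenvalueCount_eq {A : L2 ι →ₗ.[ℂ] L2 ι} {R : L2 ι →L[ℂ] L2 ι} {s : ℝ}
    (h : ∀ μ, eigenspace A μ = resolventEigenspace R s μ) (Λ : ℝ) :
    eigenvalueCount A Λ = ∑' μ : Set.Iio Λ,
      ((Cardinal.toENat (Module.rank ℂ (resolventEigenspace R s μ)) : ℕ∞) : ℝ≥0∞) :=
  tsum_congr fun μ => congrArg
    (fun S : Submodule ℂ (L2 ι) => ((Cardinal.toENat (Module.rank ℂ S) : ℕ∞) : ℝ≥0∞)) (h μ)

theorem eigenvalueCount_le {T : 𝓢(EuclideanSpace ℝ ι, ℂ) →ₗ[ℂ] 𝓢(EuclideanSpace ℝ ι, ℂ)}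
    (hT : ∀ φ ψ, inner ℂ (incl ι (T φ)) (incl ι ψ) = inner ℂ (incl ι φ) (incl ι (T ψ))) {s : ℝ}
    (hpos : ∀ φ, (1 - s) * ‖incl ι φ‖ ^ 2 ≤ (inner ℂ (incl ι φ) (incl ι (T φ))).re)
    (hd : DenseRange (fun φ => incl ι (T φ + (s : ℂ) • φ))) {Λ : ℝ} {N : ℕ}
    (h : FormBound T Λ N) : eigenvalueCount (onL2 T).closure Λ ≤ N := by
  obtain ⟨R, hR, hsymm, -, -, heig⟩ := exists_resolvent T hT hpos hd
  obtain ⟨F, _, _, _, ℓ, K, hN, hF⟩ := h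
  have h1 := tsum_rank_resolventEigenspace_le hsymm ℓ.toLinearMap (form_bound_of_dense hd hR ℓ hF)
  rw [eigenvalueCount_eq heig]
  exact h1.trans (by exact_mod_cast hN)

/-- Form bounds at every level supply compactness of `R`; the test space for `R` is the image of `Φ`
under `T + s`, on which `R` returns the original functions. -/
theorem le_eigenvalueCount {T : 𝓢(EuclideanSpace ℝ ι, ℂ) →ₗ[ℂ] 𝓢(EuclideanSpace ℝ ι, ℂ)}
    (hT : ∀ φ ψ, inner ℂ (incl ι (T φ)) (incl ι ψ) = inner ℂ (incl ι φ) (incl ι (T ψ))) {s : ℝ}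
    (hpos : ∀ φ, (1 - s) * ‖incl ι φ‖ ^ 2 ≤ (inner ℂ (incl ι φ) (incl ι (T φ))).re)
    (hd : DenseRange (fun φ => incl ι (T φ + (s : ℂ) • φ)))
    (h : ∀ Λ : ℝ, ∃ N, FormBound T Λ N) {Λ : ℝ} (hΛ : 0 < Λ + s) {σ : Type} [Fintype σ]
    (Φ : (σ → ℂ) →ₗ[ℂ] 𝓢(EuclideanSpace ℝ ι, ℂ))
    (hΦ : ∀ c ≠ 0, (inner ℂ (incl ι (Φ c)) (incl ι (T (Φ c)))).re < Λ * ‖incl ι (Φ c)‖ ^ 2) :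
    (Fintype.card σ : ℝ≥0∞) ≤ eigenvalueCount (onL2 T).closure Λ := by
  obtain ⟨R, hR, hsymm, hinj, hnn, heig⟩ := exists_resolvent T hT hpos hd
  have hc : IsCompactOperator R := by
    refine isCompactOperator_of_form_bound (s := s) fun Λ' => ?_
    obtain ⟨N, F, i1, i2, i3, ℓ, K, -, hF⟩ := h Λ'
    exact ⟨F, i1, i2, i3, ℓ, K, form_bound_of_dense hd hR ℓ hF⟩
  rw [eigenvalueCount_eq heig]
  refine le_tsum_rank_resolventEigenspace hsymm hc hinj hnn hΛ
    ((incl ι) ∘ₗ (T + (s : ℂ) • LinearMap.id) ∘ₗ Φ) fun c hc0 => ?_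
  have h1 := hR (Φ c)
  change (inner ℂ (R (incl ι (T (Φ c) + (s : ℂ) • Φ c))) (incl ι (T (Φ c) + (s : ℂ) • Φ c))).re
    < (Λ + s) * ‖R (incl ι (T (Φ c) + (s : ℂ) • Φ c))‖ ^ 2
  rw [h1, map_add, map_smul, inner_add_right, inner_smul_right, Complex.add_re,
    Complex.re_ofReal_mul]
  have h2 : (inner ℂ (incl ι (Φ c)) (incl ι (Φ c))).re = ‖incl ι (Φ c)‖ ^ 2 :=
    inner_self_eq_norm_sq (𝕜 := ℂ) _
  rw [h2]
  linarith [hΦ c hc0]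

end Resolvent

/-! ### Mollifying weak solutions -/

section Mollification

variable {ι : Type} [Fintype ι]

/-- Convolution of complex valued functions. -/
def conv (v g : EuclideanSpace ℝ ι → ℂ) (x : EuclideanSpace ℝ ι) : ℂ := ∫ t, v t * g (x - t)

theorem conv_eq (v g : EuclideanSpace ℝ ι → ℂ) :
    conv v g = convolution v g (ContinuousLinearMap.mul ℝ ℂ) volume := rfl

theorem contDiff_conv {v g : EuclideanSpace ℝ ι → ℂ} (hv : LocallyIntegrable v)
    (hg : HasCompactSupport g) (hg' : ContDiff ℝ (⊤ : ℕ∞) g) : ContDiff ℝ (⊤ : ℕ∞) (conv v g) := by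
  rw [conv_eq]
  exact hg.contDiff_convolution_right _ hv hg'

theorem integrable_conv {v g : EuclideanSpace ℝ ι → ℂ} (hv : LocallyIntegrable v)
    (hg : HasCompactSupport g) (hg' : Continuous g) (x : EuclideanSpace ℝ ι) :
    Integrable (fun t => v t * g (x - t)) :=
  hg.convolutionExists_right (ContinuousLinearMap.mul ℝ ℂ) hv hg' x

variable [DecidableEq ι]

/-- The second order operator `A(iD)` applied to a function. -/
def diffOp (A : Matrix ι ι ℝ) (f : EuclideanSpace ℝ ι → ℂ) (x : EuclideanSpace ℝ ι) : ℂ :=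
  -∑ i, ∑ j, (A i j : ℂ) * grad (fun y => grad f y j) x i

theorem schrodinger_eq_diffOp (A : Matrix ι ι ℝ) {W : EuclideanSpace ℝ ι → ℝ}
    (hW : (fun x => ((W x : ℝ) : ℂ)).HasTemperateGrowth) (φ : 𝓢(EuclideanSpace ℝ ι, ℂ))
    (x : EuclideanSpace ℝ ι) : schrodinger A W φ x = diffOp A φ x + W x * φ x := by
  simp only [schrodinger, quadD, diffOp]
  simp [SchwartzMap.smulLeftCLM_apply_apply hW, LinearMap.sum_apply]
  rfl

theorem contDiff_grad {f : EuclideanSpace ℝ ι → ℂ} (hf : ContDiff ℝ (⊤ : ℕ∞) f) (i : ι) :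
    ContDiff ℝ (⊤ : ℕ∞) (fun x => grad f x i) :=
  (hf.fderiv_right (m := (⊤ : ℕ∞)) (by exact_mod_cast le_refl _)).clm_apply contDiff_const

theorem hasCompactSupport_grad {ι : Type} [DecidableEq ι] {f : EuclideanSpace ℝ ι → ℂ} (hf : HasCompactSupport f) (i : ι) :
    HasCompactSupport (fun x => grad f x i) :=
  hf.fderiv_apply ℝ (EuclideanSpace.single i 1)

theorem grad_conv {v g : EuclideanSpace ℝ ι → ℂ} (hv : LocallyIntegrable v)
    (hg : HasCompactSupport g) (hg' : ContDiff ℝ (⊤ : ℕ∞) g) (x : EuclideanSpace ℝ ι) (i : ι) :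
    grad (conv v g) x i = conv v (fun y => grad g y i) x := by
  have h1 : ContDiff ℝ 1 g := hg'.of_le (by exact_mod_cast le_top)
  have h := hg.hasFDerivAt_convolution_right (ContinuousLinearMap.mul ℝ ℂ) hv h1 x
  rw [grad, conv_eq, h.fderiv, convolution_precompR_apply _ hv (hg.fderiv ℝ)
    (h1.continuous_fderiv one_ne_zero)]
  rfl

/-- Both derivatives fall on `g`, since `v` is only locally integrable. -/
theorem diffOp_conv (A : Matrix ι ι ℝ) {v g : EuclideanSpace ℝ ι → ℂ} (hv : LocallyIntegrable v)
    (hg : HasCompactSupport g) (hg' : ContDiff ℝ (⊤ : ℕ∞) g) (x : EuclideanSpace ℝ ι) :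
    diffOp A (conv v g) x = ∫ t, v t * diffOp A g (x - t) := by
  have h1 : ∀ j, (fun y => grad (conv v g) y j) = conv v (fun y => grad g y j) := fun j =>
    funext fun y => grad_conv hv hg hg' y j
  have hint : ∀ i j, Integrable (fun t => v t * grad (fun y => grad g y j) (x - t) i) :=
    fun i j => integrable_conv hv (hasCompactSupport_grad (hasCompactSupport_grad hg j) i)
      (contDiff_grad (contDiff_grad hg' j) i).continuous x
  have hint' : ∀ i j, Integrable
      (fun t => v t * ((A i j : ℂ) * grad (fun y => grad g y j) (x - t) i)) := fun i j =>
    ((hint i j).const_mul (A i j : ℂ)).congr (Filter.Eventually.of_forall fun t => by ring)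
  simp only [diffOp, h1]
  simp_rw [fun j i => grad_conv hv (hasCompactSupport_grad hg j) (contDiff_grad hg' j) x i]
  simp_rw [mul_neg, Finset.mul_sum]
  rw [integral_neg, integral_finsetSum _ fun i _ => integrable_finsetSum _ fun j _ => hint' i j]
  · congr 1
    refine Finset.sum_congr rfl fun i _ => ?_
    rw [integral_finsetSum _ fun j _ => hint' i j]
    refine Finset.sum_congr rfl fun j _ => ?_
    rw [conv, ← integral_const_mul]
    exact integral_congr_ae (Filter.Eventually.of_forall fun t => by ring)

theorem grad_comp_const_sub {g : EuclideanSpace ℝ ι → ℂ} (hg : Differentiable ℝ g)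
    (x t : EuclideanSpace ℝ ι) (i : ι) : grad (fun t => g (x - t)) t i = -grad g (x - t) i := by
  have h1 : HasFDerivAt (fun t => x - t) (-(ContinuousLinearMap.id ℝ (EuclideanSpace ℝ ι))) t :=
    (hasFDerivAt_id t).const_sub x
  have h2 := (hg (x - t)).hasFDerivAt.comp t h1
  rw [grad]
  have h3 : fderiv ℝ (fun t => g (x - t)) t = _ := h2.fderiv
  rw [h3]
  simp [grad]

/-- The reflection contributes two minus signs because the operator has even order. -/
theorem diffOp_comp_const_sub (A : Matrix ι ι ℝ) {g : EuclideanSpace ℝ ι → ℂ}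
    (hg : ContDiff ℝ (⊤ : ℕ∞) g) (x t : EuclideanSpace ℝ ι) :
    diffOp A (fun t => g (x - t)) t = diffOp A g (x - t) := by
  have h1 : ∀ j, (fun t => grad (fun t => g (x - t)) t j) =
      fun t => (fun y => - grad g y j) (x - t) := fun j =>
    funext fun t => grad_comp_const_sub (hg.differentiable (by simp)) x t j
  simp only [diffOp, h1]
  congr 1
  refine Finset.sum_congr rfl fun i _ => Finset.sum_congr rfl fun j _ => ?_
  have h2 := grad_comp_const_sub (g := fun y => -grad g y j)
    (((contDiff_grad hg j).differentiable (by simp)).neg) x t i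
  rw [h2]
  congr 1
  simp only [grad]
  rw [fderiv_fun_neg]
  simp

/-- If `v` solves the weak equation, its mollifications solve the equation up to a commutator. -/
theorem diffOp_conv_add (A : Matrix ι ι ℝ) {W : EuclideanSpace ℝ ι → ℝ}
    (hW : (fun x => ((W x : ℝ) : ℂ)).HasTemperateGrowth) {s : ℝ} {v : EuclideanSpace ℝ ι → ℂ}
    (hv : LocallyIntegrable v)
    (hweak : ∀ φ : 𝓢(EuclideanSpace ℝ ι, ℂ), ∫ t, v t * (schrodinger A W φ + (s : ℂ) • φ) t = 0)
    {g : EuclideanSpace ℝ ι → ℂ} (hg : HasCompactSupport g) (hg' : ContDiff ℝ (⊤ : ℕ∞) g)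
    (x : EuclideanSpace ℝ ι) :
    diffOp A (conv v g) x + (W x + s) * conv v g x =
      ∫ t, v t * (((W x : ℂ) - W t) * g (x - t)) := by
  -- The weak equation is tested against the reflected mollifier centred at `x`. The mismatch
  -- between `W t` in the equation and `W x` outside the integral is the commutator.
  let φ : 𝓢(EuclideanSpace ℝ ι, ℂ) := HasCompactSupport.toSchwartzMap
    (f := fun t => g (x - t)) (hg.comp_homeomorph (Homeomorph.subLeft x))
    (hg'.comp (contDiff_const.sub contDiff_id))
  have hφ : ∀ t, (schrodinger A W φ + (s : ℂ) • φ) t =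
      diffOp A g (x - t) + (W t + s) * g (x - t) := fun t => by
    rw [add_apply, schrodinger_eq_diffOp A hW]
    have : diffOp A φ t = diffOp A g (x - t) := diffOp_comp_const_sub A hg' x t
    rw [this]
    change _ + (W t : ℂ) * g (x - t) + (s : ℂ) * g (x - t) = _
    ring
  have h0 := hweak φ
  simp_rw [hφ] at h0
  have hdc : HasCompactSupport (diffOp A g) ∧ Continuous (diffOp A g) := by
    have e : diffOp A g = fun x => -∑ i, ∑ j, (A i j : ℂ) * grad (fun y => grad g y j) x i := rfl
    constructor
    · refine HasCompactSupport.intro hg.isCompact fun y hy => ?_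
      have hij : ∀ i j, grad (fun y => grad g y j) y i = 0 := fun i j =>
        image_eq_zero_of_notMem_tsupport (f := fun y => grad (fun y => grad g y j) y i)
          fun h => hy (tsupport_fderiv_apply_subset ℝ (EuclideanSpace.single j 1)
            (tsupport_fderiv_apply_subset ℝ (EuclideanSpace.single i 1) h))
      simp [diffOp, hij]
    · rw [e]
      exact (continuous_finsetSum _ fun i _ => continuous_finsetSum _ fun j _ =>
        continuous_const.mul (contDiff_grad (contDiff_grad hg' j) i).continuous).neg
  have hi1 := integrable_conv hv hdc.1 hdc.2 x
  have hi2 : Integrable (fun t => v t * ((W t + s) * g (x - t))) := by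
    have hl : LocallyIntegrable (fun t => ((W t : ℂ) + s) * v t) :=
      hv.continuous_mul (hW.1.continuous.add continuous_const)
    exact (integrable_conv hl hg hg'.continuous x).congr
      (Filter.Eventually.of_forall fun t => by ring)
  have hi3 := integrable_conv hv hg hg'.continuous x
  rw [diffOp_conv A hv hg hg', conv, ← integral_const_mul]
  have h1 : ∫ t, v t * diffOp A g (x - t) = -∫ t, v t * ((W t + s) * g (x - t)) := by
    rw [eq_neg_iff_add_eq_zero, ← integral_add hi1 hi2, ← h0]
    exact integral_congr_ae (Filter.Eventually.of_forall fun t => by simp only []; ring)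
  rw [h1, neg_add_eq_sub, ← integral_sub (hi3.const_mul _) hi2]
  exact integral_congr_ae (Filter.Eventually.of_forall fun t => by simp only []; ring)

end Mollification

/-! ### Energy of a function times a cutoff -/

section Cutoff

variable {ι : Type} [Fintype ι]

theorem hermForm_smul (A : Matrix ι ι ℝ) (c : ι → ℝ) (z : ℂ) :
    hermForm A (fun i => (c i : ℂ) * z) = ‖z‖ ^ 2 * hermForm A (fun i => (c i : ℂ)) := by
  simp only [hermForm, Finset.mul_sum]
  refine Finset.sum_congr rfl fun i _ => Finset.sum_congr rfl fun j _ => ?_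
  rw [← Complex.normSq_eq_norm_sq, Complex.normSq_apply]
  simp
  ring

/-- With `p = ∇f`, `c = ∇χ` and `z = f`, the last sum pairs `∇(χ² f)` with `∇f`, which is ready for
integration by parts. The remaining cross terms are antisymmetric in `i, j` and cancel because `A`
is symmetric. -/
theorem hermForm_cutoff {A : Matrix ι ι ℝ} (hA : A.IsSymm) (χ : ℝ) (c : ι → ℝ) (z : ℂ)
    (p : ι → ℂ) : hermForm A (fun i => (χ : ℂ) * p i + c i * z) =
      hermForm A (fun i => (c i : ℂ) * z) +
      ∑ i, ∑ j, A i j * ((starRingEnd ℂ) ((χ : ℂ) ^ 2 * p i + 2 * χ * c i * z) * p j).re := by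
  have h1 : ∀ i j, A i j * ((starRingEnd ℂ) ((χ : ℂ) * p i + c i * z) * ((χ : ℂ) * p j + c j * z)).re
      = A i j * ((starRingEnd ℂ) ((c i : ℂ) * z) * (c j * z)).re
        + A i j * ((starRingEnd ℂ) ((χ : ℂ) ^ 2 * p i + 2 * χ * c i * z) * p j).re
        + (A i j * (χ * c j * ((starRingEnd ℂ) (p i) * z).re)
        - A j i * (χ * c i * ((starRingEnd ℂ) (p j) * z).re)) := fun i j => by
    rw [hA.apply i j]
    simp [sq]
    ring
  simp only [hermForm, h1, Finset.sum_add_distrib, Finset.sum_sub_distrib]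
  rw [Finset.sum_comm (f := fun i j => A j i * (χ * c i * ((starRingEnd ℂ) (p j) * z).re))]
  ring

theorem fderiv_ofReal_apply {χ : EuclideanSpace ℝ ι → ℝ} (hχ : Differentiable ℝ χ)
    (x v : EuclideanSpace ℝ ι) : fderiv ℝ (fun x => (χ x : ℂ)) x v = (fderiv ℝ χ x v : ℂ) := by
  have h := (Complex.ofRealCLM.hasFDerivAt (x := χ x)).comp x (hχ x).hasFDerivAt
  have h2 : fderiv ℝ (fun x => (χ x : ℂ)) x = _ := h.fderiv
  rw [h2]
  simp

variable [DecidableEq ι]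

theorem grad_ofReal_mul {χ : EuclideanSpace ℝ ι → ℝ} (hχ : Differentiable ℝ χ)
    {f : EuclideanSpace ℝ ι → ℂ} (hf : Differentiable ℝ f) (x : EuclideanSpace ℝ ι) (i : ι) :
    grad (fun x => (χ x : ℂ) * f x) x i =
      χ x * grad f x i + (fderiv ℝ χ x (EuclideanSpace.single i 1) : ℝ) * f x := by
  have hχ' : Differentiable ℝ (fun x => (χ x : ℂ)) := Complex.ofRealCLM.differentiable.comp hχ
  rw [grad, fderiv_fun_mul (hχ' x) (hf x)]
  simp [fderiv_ofReal_apply hχ, grad]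
  ring

theorem integral_grad_cutoff {f p : EuclideanSpace ℝ ι → ℂ} (hf : ContDiff ℝ (⊤ : ℕ∞) f)
    (hp : ContDiff ℝ (⊤ : ℕ∞) p) (hc : HasCompactSupport p) (i : ι) :
    ∫ x, (starRingEnd ℂ) (grad p x i) * f x = -∫ x, (starRingEnd ℂ) (p x) * grad f x i := by
  have hpd := (contDiff_grad hp i).continuous
  have hfd := (contDiff_grad hf i).continuous
  have hp0 := hp.continuous
  have hf0 := hf.continuous
  have hpc := hasCompactSupport_grad hc i
  have h := integral_bilinear_fderiv_right_eq_neg_left_of_integrable (μ := volume)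
    (f := p) (g := f) (v := EuclideanSpace.single i (1 : ℝ))
    (B := (ContinuousLinearMap.mul ℝ ℂ).comp (Complex.conjCLE : ℂ →L[ℝ] ℂ))
    ?_ ?_ ?_ (fun x _ => hp.differentiable (by simp) x) (fun x _ => hf.differentiable (by simp) x)
  · rw [eq_neg_iff_add_eq_zero, add_comm, ← eq_neg_iff_add_eq_zero]
    exact h
  · refine Continuous.integrable_of_hasCompactSupport (f := fun x => (starRingEnd ℂ) (grad p x i) * f x)
      (by fun_prop) ?_
    exact (hpc.comp_left (g := starRingEnd ℂ) (by simp)).mul_right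
  · refine Continuous.integrable_of_hasCompactSupport (f := fun x => (starRingEnd ℂ) (p x) * grad f x i)
      (by fun_prop) ?_
    exact (hc.comp_left (g := starRingEnd ℂ) (by simp)).mul_right
  · refine Continuous.integrable_of_hasCompactSupport (f := fun x => (starRingEnd ℂ) (p x) * f x)
      (by fun_prop) ?_
    exact (hc.comp_left (g := starRingEnd ℂ) (by simp)).mul_right

/-- The energy of a function with a cutoff. -/
theorem energy_cutoff {A : Matrix ι ι ℝ} (hA : A.IsSymm) {W : EuclideanSpace ℝ ι → ℝ}
    (hW : Continuous W) {f : EuclideanSpace ℝ ι → ℂ} (hf : ContDiff ℝ (⊤ : ℕ∞) f)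
    {χ : EuclideanSpace ℝ ι → ℝ} (hχ : ContDiff ℝ (⊤ : ℕ∞) χ) (hc : HasCompactSupport χ) :
    energy A W (fun x => (χ x : ℂ) * f x) =
      ∫ x, (‖f x‖ ^ 2 * hermForm A (fun i => ((fderiv ℝ χ x (EuclideanSpace.single i 1) : ℝ) : ℂ))
        + χ x ^ 2 * ((starRingEnd ℂ) (f x) * (diffOp A f x + W x * f x)).re) := by
  have hχ0 := hχ.continuous
  have hf0 := hf.continuous
  have hχd := hχ.differentiable (by simp)
  have hfd := hf.differentiable (by simp)
  have hχC : ContDiff ℝ (⊤ : ℕ∞) (fun x => (χ x : ℂ)) := Complex.ofRealCLM.contDiff.comp hχ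
  have hcC : HasCompactSupport (fun x => (χ x : ℂ)) := hc.comp_left (g := fun t : ℝ => (t : ℂ)) (by simp)
  have hdχ : ∀ i, Continuous (fun x => fderiv ℝ χ x (EuclideanSpace.single i 1)) := fun i =>
    ((hχ.fderiv_right (m := (⊤ : ℕ∞)) (by exact_mod_cast le_refl _)).clm_apply
      contDiff_const).continuous
  have hdc : ∀ i, HasCompactSupport (fun x => fderiv ℝ χ x (EuclideanSpace.single i 1)) := fun i =>
    hc.fderiv_apply ℝ _
  have hgf : ∀ i, Continuous (fun x => grad f x i) := fun i => (contDiff_grad hf i).continuous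
  have hggf : ∀ i j, Continuous (fun x => grad (fun y => grad f y j) x i) := fun i j =>
    (contDiff_grad (contDiff_grad hf j) i).continuous
  -- This is `χ² f`, the compactly supported function against which the operator applied to `f` is
  -- integrated.
  let p : EuclideanSpace ℝ ι → ℂ := fun x => (χ x : ℂ) * ((χ x : ℂ) * f x)
  have hp : ContDiff ℝ (⊤ : ℕ∞) p := hχC.mul (hχC.mul hf)
  have hpc : HasCompactSupport p := hcC.mul_right
  have hgp : ∀ x i, grad p x i = (χ x : ℂ) ^ 2 * grad f x i
      + 2 * χ x * (fderiv ℝ χ x (EuclideanSpace.single i 1) : ℝ) * f x := fun x i => by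
    rw [grad_ofReal_mul hχd ((hχC.mul hf).differentiable (by simp)), grad_ofReal_mul hχd hfd]
    ring
  have hgpc : ∀ i, Continuous (fun x => grad p x i) := fun i => (contDiff_grad hp i).continuous
  have hI : ∀ i j, Integrable (fun x => A i j * ((starRingEnd ℂ) (grad p x i) * grad f x j).re) := by
    intro i j
    have hgf := hgf j
    have hgpc := hgpc i
    have h2 : Integrable (fun x => (starRingEnd ℂ) (grad p x i) * grad f x j) :=
      Continuous.integrable_of_hasCompactSupport (by fun_prop)
        (((hasCompactSupport_grad hpc i).comp_left (g := starRingEnd ℂ) (by simp)).mul_right)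
    exact h2.re.const_mul _
  have hI' : ∀ i j, Integrable
      (fun x => A i j * ((starRingEnd ℂ) (p x) * grad (fun y => grad f y j) x i).re) := by
    intro i j
    have hgf := hggf i j
    have hgpc := hp.continuous
    have h2 : Integrable (fun x => (starRingEnd ℂ) (p x) * grad (fun y => grad f y j) x i) :=
      Continuous.integrable_of_hasCompactSupport (by fun_prop)
        ((hpc.comp_left (g := starRingEnd ℂ) (by simp)).mul_right)
    exact h2.re.const_mul _
  have hibp : ∀ i j, ∫ x, A i j * ((starRingEnd ℂ) (grad p x i) * grad f x j).re =
      -∫ x, A i j * ((starRingEnd ℂ) (p x) * grad (fun y => grad f y j) x i).re := by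
    intro i j
    rw [integral_const_mul, integral_const_mul, ← mul_neg]
    congr 1
    have h3 := congrArg Complex.re (integral_grad_cutoff (contDiff_grad hf j) hp hpc i)
    have hgf := hgf j
    have hgpc := hgpc i
    have h2 : Integrable (fun x => (starRingEnd ℂ) (grad p x i) * grad f x j) :=
      Continuous.integrable_of_hasCompactSupport (by fun_prop)
        (((hasCompactSupport_grad hpc i).comp_left (g := starRingEnd ℂ) (by simp)).mul_right)
    have hgf' := hggf i j
    have hgpc := hp.continuous
    have h4 : Integrable (fun x => (starRingEnd ℂ) (p x) * grad (fun y => grad f y j) x i) :=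
      Continuous.integrable_of_hasCompactSupport (by fun_prop)
        ((hpc.comp_left (g := starRingEnd ℂ) (by simp)).mul_right)
    have h5 := integral_re (𝕜 := ℂ) h2
    have h6 := integral_re (𝕜 := ℂ) h4
    rw [Complex.neg_re] at h3
    refine h5.trans (h3.trans ?_)
    exact congrArg Neg.neg h6.symm
  have hD : ∀ x, χ x ^ 2 * ((starRingEnd ℂ) (f x) * diffOp A f x).re =
      -∑ i, ∑ j, A i j * ((starRingEnd ℂ) (p x) * grad (fun y => grad f y j) x i).re := fun x => by
    rw [diffOp, mul_neg, Complex.neg_re, mul_neg, Finset.mul_sum, Complex.re_sum, Finset.mul_sum]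
    congr 1
    refine Finset.sum_congr rfl fun i _ => ?_
    rw [Finset.mul_sum, Complex.re_sum, Finset.mul_sum]
    refine Finset.sum_congr rfl fun j _ => ?_
    simp [p]
    ring
  have hmid : ∫ x, ∑ i, ∑ j, A i j * ((starRingEnd ℂ) (grad p x i) * grad f x j).re =
      ∫ x, χ x ^ 2 * ((starRingEnd ℂ) (f x) * diffOp A f x).re := by
    simp_rw [hD]
    rw [integral_neg, integral_finsetSum _ fun i _ => integrable_finsetSum _ fun j _ => hI i j,
      integral_finsetSum _ fun i _ => integrable_finsetSum _ fun j _ => hI' i j,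
      ← Finset.sum_neg_distrib]
    refine Finset.sum_congr rfl fun i _ => ?_
    rw [integral_finsetSum _ fun j _ => hI i j, integral_finsetSum _ fun j _ => hI' i j,
      ← Finset.sum_neg_distrib]
    exact Finset.sum_congr rfl fun j _ => hibp i j
  have hIm : Integrable (fun x => ∑ i, ∑ j, A i j * ((starRingEnd ℂ) (grad p x i) * grad f x j).re) :=
    integrable_finsetSum _ fun i _ => integrable_finsetSum _ fun j _ => hI i j
  have hID : Integrable (fun x => χ x ^ 2 * ((starRingEnd ℂ) (f x) * diffOp A f x).re) := by
    simp_rw [hD]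
    exact (integrable_finsetSum _ fun i _ => integrable_finsetSum _ fun j _ => hI' i j).neg
  have hI0 : Integrable (fun x => ‖f x‖ ^ 2 *
      hermForm A (fun i => ((fderiv ℝ χ x (EuclideanSpace.single i 1) : ℝ) : ℂ))) := by
    simp only [hermForm, Finset.mul_sum]
    refine integrable_finsetSum _ fun i _ => integrable_finsetSum _ fun j _ => ?_
    have h1 := hdχ i
    have h2 := hdχ j
    refine Continuous.integrable_of_hasCompactSupport (by fun_prop) ?_
    refine HasCompactSupport.mul_left (HasCompactSupport.mul_left ?_)
    exact (hdc i).mono (fun x hx h => hx (by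
      have h' : fderiv ℝ χ x (EuclideanSpace.single i 1) = 0 := h
      simp [h']))
  have hIW : Integrable (fun x => χ x ^ 2 * (W x * ‖f x‖ ^ 2)) := by
    refine Continuous.integrable_of_hasCompactSupport (by fun_prop) ?_
    exact HasCompactSupport.mul_right (hc.comp_left (g := fun t : ℝ => t ^ 2) (by simp))
  have hlhs : ∀ x, hermForm A (grad (fun x => (χ x : ℂ) * f x) x) + W x * ‖(χ x : ℂ) * f x‖ ^ 2 =
      ‖f x‖ ^ 2 * hermForm A (fun i => ((fderiv ℝ χ x (EuclideanSpace.single i 1) : ℝ) : ℂ))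
      + (∑ i, ∑ j, A i j * ((starRingEnd ℂ) (grad p x i) * grad f x j).re
        + χ x ^ 2 * (W x * ‖f x‖ ^ 2)) := fun x => by
    have h1 : grad (fun x => (χ x : ℂ) * f x) x = fun i => (χ x : ℂ) * grad f x i +
        ((fderiv ℝ χ x (EuclideanSpace.single i 1) : ℝ) : ℂ) * f x :=
      funext fun i => grad_ofReal_mul hχd hfd x i
    rw [h1, hermForm_cutoff hA, hermForm_smul]
    simp_rw [hgp]
    rw [norm_mul, mul_pow, Complex.norm_real, Real.norm_eq_abs, sq_abs]
    ring
  have hrhs : ∀ x, χ x ^ 2 * ((starRingEnd ℂ) (f x) * (diffOp A f x + W x * f x)).re =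
      χ x ^ 2 * ((starRingEnd ℂ) (f x) * diffOp A f x).re + χ x ^ 2 * (W x * ‖f x‖ ^ 2) := fun x => by
    rw [mul_add, Complex.add_re, mul_add]
    congr 2
    rw [← Complex.normSq_eq_norm_sq, Complex.normSq_apply]
    simp
    ring
  rw [energy]
  simp_rw [hlhs, hrhs]
  refine (integral_add hI0 (hIm.add hIW)).trans (Eq.trans ?_ (integral_add hI0 (hID.add hIW)).symm)
  refine congrArg _ ((integral_add hIm hIW).trans (Eq.trans ?_ (integral_add hID hIW).symm))
  rw [hmid]

end Cutoff

/-! ### Essential self-adjointness -/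

section SelfAdjoint

variable {ι : Type} [Fintype ι]

/-- Cauchy–Schwarz against a probability density, in `ℝ≥0∞` so that no integrability has to be known
beforehand. -/
theorem lintegral_mul_sq_le {α : Type} [MeasurableSpace α] (μ : Measure α) {a γ : α → ℝ≥0∞}
    (ha : AEMeasurable a μ) (hγ : AEMeasurable γ μ) (h1 : ∫⁻ t, γ t ∂μ = 1) :
    (∫⁻ t, a t * γ t ∂μ) ^ 2 ≤ ∫⁻ t, a t ^ 2 * γ t ∂μ := by
  have hrp : ∀ x : ℝ≥0∞, (x ^ (1 / 2 : ℝ)) ^ (2 : ℝ) = x := fun x => by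
    rw [← ENNReal.rpow_mul]; norm_num
  have hrp' : ∀ x : ℝ≥0∞, x ^ (1 / 2 : ℝ) * x ^ (1 / 2 : ℝ) = x := fun x => by
    rw [← sq, ← ENNReal.rpow_natCast]; exact_mod_cast hrp x
  have h := ENNReal.lintegral_mul_le_Lp_mul_Lq μ Real.HolderConjugate.two_two
    (f := fun t => a t * γ t ^ (1 / 2 : ℝ)) (g := fun t => γ t ^ (1 / 2 : ℝ))
    (ha.mul (hγ.pow_const _)) (hγ.pow_const _)
  have e1 : ∀ t, ((fun t => a t * γ t ^ (1 / 2 : ℝ)) * fun t => γ t ^ (1 / 2 : ℝ)) t = a t * γ t :=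
    fun t => by
      change a t * γ t ^ (1 / 2 : ℝ) * γ t ^ (1 / 2 : ℝ) = _
      rw [mul_assoc, hrp']
  have e2 : ∀ t, (a t * γ t ^ (1 / 2 : ℝ)) ^ (2 : ℝ) = a t ^ 2 * γ t := fun t => by
    rw [ENNReal.mul_rpow_of_nonneg _ _ (by norm_num), hrp, ENNReal.rpow_two]
  simp_rw [e1, e2, hrp, h1, ENNReal.one_rpow, mul_one] at h
  calc (∫⁻ t, a t * γ t ∂μ) ^ 2 ≤ ((∫⁻ t, a t ^ 2 * γ t ∂μ) ^ (1 / 2 : ℝ)) ^ 2 :=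
        pow_le_pow_left' h 2
    _ = _ := by rw [sq, hrp']

/-- The case of Young's inequality that says mollification does not increase the `L²` norm. -/
theorem lintegral_conv_sq_le {a γ : EuclideanSpace ℝ ι → ℝ≥0∞} (ha : AEMeasurable a)
    (hγ : Measurable γ) (h1 : ∫⁻ t, γ t = 1) :
    ∫⁻ x, (∫⁻ t, a t * γ (x - t)) ^ 2 ≤ ∫⁻ t, a t ^ 2 := by
  calc ∫⁻ x, (∫⁻ t, a t * γ (x - t)) ^ 2 ≤ ∫⁻ x, ∫⁻ t, a t ^ 2 * γ (x - t) := by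
        refine lintegral_mono fun x => lintegral_mul_sq_le _ ha
          (hγ.comp (measurable_const.sub measurable_id)).aemeasurable ?_
        rw [← h1]
        exact lintegral_sub_left_eq_self γ x
    _ = ∫⁻ t, ∫⁻ x, a t ^ 2 * γ (x - t) := by
        refine lintegral_lintegral_swap ?_
        have h2 : AEMeasurable (fun p : EuclideanSpace ℝ ι × EuclideanSpace ℝ ι => a p.2)
            (volume.prod volume) := ha.comp_snd
        exact (h2.pow_const 2).mul (hγ.comp (measurable_fst.sub measurable_snd)).aemeasurable
    _ = ∫⁻ t, a t ^ 2 := by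
        refine lintegral_congr fun t => ?_
        have hm : Measurable (fun x => γ (x - t)) := hγ.comp (measurable_id.sub measurable_const)
        rw [lintegral_const_mul _ hm, lintegral_sub_right_eq_self γ t, h1, mul_one]

theorem integrable_conv_norm_sq {v : EuclideanSpace ℝ ι → ℂ} (hv : LocallyIntegrable v)
    (hv2 : Integrable (fun t => ‖v t‖ ^ 2)) {γ : EuclideanSpace ℝ ι → ℝ} (hγ : Continuous γ)
    (hc : HasCompactSupport γ) (h0 : ∀ x, 0 ≤ γ x) (h1 : ∫ x, γ x = 1) :
    (∀ x, Integrable (fun t => ‖v t‖ * γ (x - t))) ∧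
    Integrable (fun x => (∫ t, ‖v t‖ * γ (x - t)) ^ 2) ∧
    ∫ x, (∫ t, ‖v t‖ * γ (x - t)) ^ 2 ≤ ∫ t, ‖v t‖ ^ 2 := by
  have hvn : LocallyIntegrable (fun t => ‖v t‖) := fun x => by
    obtain ⟨u, hu, h⟩ := hv x
    exact ⟨u, hu, h.norm⟩
  have hint : ∀ x, Integrable (fun t => ‖v t‖ * γ (x - t)) := fun x =>
    hc.convolutionExists_right (ContinuousLinearMap.mul ℝ ℝ) hvn hγ x
  have hcont : Continuous (fun x => ∫ t, ‖v t‖ * γ (x - t)) :=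
    hc.continuous_convolution_right (ContinuousLinearMap.mul ℝ ℝ) hvn hγ
  have hγi : Integrable γ := hγ.integrable_of_hasCompactSupport hc
  have hγ1 : ∫⁻ x, ENNReal.ofReal (γ x) = 1 := by
    rw [← ofReal_integral_eq_lintegral_ofReal hγi (Filter.Eventually.of_forall h0), h1,
      ENNReal.ofReal_one]
  have hm : AEMeasurable (fun t => ENNReal.ofReal ‖v t‖) :=
    hvn.aestronglyMeasurable.aemeasurable.ennreal_ofReal
  have hy := lintegral_conv_sq_le hm (hγ.measurable.ennreal_ofReal) hγ1
  have e1 : ∀ x, (∫⁻ t, ENNReal.ofReal ‖v t‖ * ENNReal.ofReal (γ (x - t))) ^ 2 =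
      ENNReal.ofReal ((∫ t, ‖v t‖ * γ (x - t)) ^ 2) := fun x => by
    rw [ENNReal.ofReal_pow (integral_nonneg fun t => mul_nonneg (norm_nonneg _) (h0 _)),
      ofReal_integral_eq_lintegral_ofReal (hint x)
        (Filter.Eventually.of_forall fun t => mul_nonneg (norm_nonneg _) (h0 _))]
    simp_rw [ENNReal.ofReal_mul (norm_nonneg _)]
  have e2 : ∫⁻ t, ENNReal.ofReal ‖v t‖ ^ 2 = ENNReal.ofReal (∫ t, ‖v t‖ ^ 2) := by
    rw [ofReal_integral_eq_lintegral_ofReal hv2 (Filter.Eventually.of_forall fun t => by positivity)]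
    simp_rw [ENNReal.ofReal_pow (norm_nonneg _)]
  simp_rw [e1] at hy
  rw [e2] at hy
  have hI : Integrable (fun x => (∫ t, ‖v t‖ * γ (x - t)) ^ 2) := by
    refine ⟨(hcont.pow 2).aestronglyMeasurable, ?_⟩
    rw [hasFiniteIntegral_iff_ofReal (Filter.Eventually.of_forall fun t => by positivity)]
    exact hy.trans_lt ENNReal.ofReal_lt_top
  refine ⟨hint, hI, ?_⟩
  rw [← ofReal_integral_eq_lintegral_ofReal hI (Filter.Eventually.of_forall fun t => by positivity)] at hy
  exact (ENNReal.ofReal_le_ofReal_iff (integral_nonneg fun t => by positivity)).1 hy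

theorem abs_hermForm_le (A : Matrix ι ι ℝ) (ξ : ι → ℂ) (M : ℝ) (hM : ∀ i, ‖ξ i‖ ≤ M) :
    |hermForm A ξ| ≤ (∑ i, ∑ j, |A i j|) * M ^ 2 := by
  rw [hermForm, Finset.sum_mul]
  refine (Finset.abs_sum_le_sum_abs _ _).trans (Finset.sum_le_sum fun i _ => ?_)
  rw [Finset.sum_mul]
  refine (Finset.abs_sum_le_sum_abs _ _).trans (Finset.sum_le_sum fun j _ => ?_)
  rw [abs_mul]
  refine mul_le_mul_of_nonneg_left ?_ (abs_nonneg _)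
  refine (Complex.abs_re_le_norm _).trans ?_
  rw [norm_mul, RCLike.norm_conj, sq]
  exact mul_le_mul (hM i) (hM j) (norm_nonneg _) ((norm_nonneg _).trans (hM i))

/-- Cutoff functions on balls of radius `2 R` equal to one on the ball of radius `R`. -/
theorem exists_cutoff (ι : Type) [Fintype ι] : ∃ B : ℝ, 0 ≤ B ∧ ∀ R : ℝ, 0 < R →
    ∃ χ : EuclideanSpace ℝ ι → ℝ, ContDiff ℝ (⊤ : ℕ∞) χ ∧ HasCompactSupport χ ∧
      (∀ x, ‖x‖ ≤ R → χ x = 1) ∧ (∀ x, 2 * R ≤ ‖x‖ → χ x = 0) ∧ (∀ x, 0 ≤ χ x) ∧ (∀ x, χ x ≤ 1) ∧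
      ∀ x v, ‖fderiv ℝ χ x v‖ ≤ B / R * ‖v‖ := by
  let b : ContDiffBump (0 : EuclideanSpace ℝ ι) := ⟨1, 2, one_pos, one_lt_two⟩
  have hb : ContDiff ℝ (⊤ : ℕ∞) b := b.contDiff
  obtain ⟨B, hB⟩ := ((hb.continuous_fderiv (by simp)).norm).bounded_above_of_compact_support
    (b.hasCompactSupport.fderiv ℝ).norm
  simp only [norm_norm] at hB
  have hB0 : 0 ≤ B := (norm_nonneg _).trans (hB 0)
  refine ⟨B, hB0, fun R hR => ⟨fun x => b (R⁻¹ • x), ?_, ?_, ?_, ?_, ?_, ?_, ?_⟩⟩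
  · exact hb.comp (contDiff_const_smul _)
  · exact b.hasCompactSupport.comp_smul (inv_ne_zero hR.ne')
  · intro x hx
    refine b.one_of_mem_closedBall ?_
    rw [mem_closedBall_zero_iff, norm_smul, norm_inv, Real.norm_eq_abs, abs_of_pos hR]
    change R⁻¹ * ‖x‖ ≤ 1
    rw [inv_mul_le_iff₀ hR]
    linarith
  · intro x hx
    refine b.zero_of_le_dist ?_
    rw [dist_zero_right, norm_smul, norm_inv, Real.norm_eq_abs, abs_of_pos hR]
    change 2 ≤ R⁻¹ * ‖x‖
    rw [le_inv_mul_iff₀ hR]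
    linarith
  · exact fun x => b.nonneg
  · exact fun x => b.le_one
  · intro x v
    have h1 : HasFDerivAt (fun x : EuclideanSpace ℝ ι => b (R⁻¹ • x)) _ x :=
      (hb.differentiable (by simp) (R⁻¹ • x)).hasFDerivAt.comp x
        ((hasFDerivAt_id x).const_smul R⁻¹)
    rw [h1.fderiv]
    simp only [ContinuousLinearMap.comp_apply, smul_apply,
      ContinuousLinearMap.id_apply, map_smul]
    rw [norm_smul, norm_inv, Real.norm_eq_abs, abs_of_pos hR]
    calc R⁻¹ * ‖fderiv ℝ b (R⁻¹ • x) v‖ ≤ R⁻¹ * (B * ‖v‖) :=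
          mul_le_mul_of_nonneg_left (((fderiv ℝ b (R⁻¹ • x)).le_opNorm v).trans
            (mul_le_mul_of_nonneg_right (hB _) (norm_nonneg _))) (by positivity)
      _ = B / R * ‖v‖ := by ring

/-- Fatou's lemma applied to `‖F n‖²`. -/
theorem ae_eq_zero_of_integral_sq_le {F : ℕ → EuclideanSpace ℝ ι → ℂ}
    {v : EuclideanSpace ℝ ι → ℂ} {c : ℕ → ℝ} (hF : ∀ n, Continuous (F n))
    (hi : ∀ n, Integrable (fun x => ‖F n x‖ ^ 2)) (hb : ∀ n, ∫ x, ‖F n x‖ ^ 2 ≤ c n)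
    (hc : Filter.Tendsto c Filter.atTop (nhds 0))
    (hlim : ∀ᵐ x, Filter.Tendsto (fun n => F n x) Filter.atTop (nhds (v x))) :
    ∀ᵐ x, v x = 0 := by
  have hm : ∀ n, Measurable (fun x => ENNReal.ofReal (‖F n x‖ ^ 2)) := fun n =>
    ((hF n).norm.pow 2).measurable.ennreal_ofReal
  have h1 : ∀ n, ∫⁻ x, ENNReal.ofReal (‖F n x‖ ^ 2) ≤ ENNReal.ofReal (c n) := fun n => by
    rw [← ofReal_integral_eq_lintegral_ofReal (hi n)
      (Filter.Eventually.of_forall fun t => by positivity)]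
    exact ENNReal.ofReal_le_ofReal (hb n)
  have h2 : Filter.Tendsto (fun n => ENNReal.ofReal (c n)) Filter.atTop (nhds 0) := by
    simpa using ENNReal.tendsto_ofReal hc
  have h3 : ∫⁻ x, Filter.liminf (fun n => ENNReal.ofReal (‖F n x‖ ^ 2)) Filter.atTop = 0 := by
    refine le_antisymm ((lintegral_liminf_le hm).trans ?_) zero_le
    rw [← h2.liminf_eq]
    exact Filter.liminf_le_liminf (Filter.Eventually.of_forall h1)
  rw [lintegral_eq_zero_iff (Measurable.liminf hm)] at h3
  filter_upwards [h3, hlim] with x hx hx'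
  have h4 : Filter.liminf (fun n => ENNReal.ofReal (‖F n x‖ ^ 2)) Filter.atTop = 0 := hx
  rw [(ENNReal.tendsto_ofReal (hx'.norm.pow 2)).liminf_eq, ENNReal.ofReal_eq_zero] at h4
  have h5 : ‖v x‖ ^ 2 = 0 := le_antisymm h4 (sq_nonneg _)
  exact norm_eq_zero.1 (pow_eq_zero_iff two_ne_zero |>.1 h5)

theorem integrable_normSq_of_hasCompactSupport {f : EuclideanSpace ℝ ι → ℂ} (hf : Continuous f)
    (hc : HasCompactSupport f) : Integrable (fun x => ‖f x‖ ^ 2) := by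
  have h1 : Continuous (fun x => ‖f x‖ ^ 2) := by fun_prop
  have h2 : HasCompactSupport (fun x => ‖f x‖ ^ 2) :=
    hc.mono fun x hx h => hx (by simp [h])
  exact h1.integrable_of_hasCompactSupport h2

variable [DecidableEq ι]

theorem energy_add_const (A : Matrix ι ι ℝ) {W : EuclideanSpace ℝ ι → ℝ} (hW : PolyBounded W)
    (s : ℝ) (φ : 𝓢(EuclideanSpace ℝ ι, ℂ)) :
    energy A (fun x => W x + s) φ = energy A W φ + s * ‖incl ι φ‖ ^ 2 := by
  rw [norm_incl_sq, ← integral_const_mul]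
  refine Eq.trans ?_ (integral_add (integrable_energy A hW φ) ((integrable_normSq φ).const_mul s))
  refine integral_congr_ae (Filter.Eventually.of_forall fun x => ?_)
  simp only []
  ring

/-- For a mollified weak solution `f`, the energy of `χ f` for `W + s` dominates `‖χ f‖²`, yet by
`energy_cutoff` it consists of a term in `|∇χ|²` and a commutator term. Both are small multiples of
`‖v‖²` when the cutoff is flat and `W` oscillates little on the scale of the mollifier. -/
theorem integral_cutoff_conv_le {A : Matrix ι ι ℝ} (hA : A.IsSymm) {W : EuclideanSpace ℝ ι → ℝ}
    (hW : (fun x => ((W x : ℝ) : ℂ)).HasTemperateGrowth) (hWr : PolyBounded W) {s : ℝ}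
    (hpos : ∀ φ : 𝓢(EuclideanSpace ℝ ι, ℂ), (1 - s) * ‖incl ι φ‖ ^ 2 ≤ energy A W φ)
    {v : EuclideanSpace ℝ ι → ℂ} (hv : LocallyIntegrable v) (hv2 : Integrable (fun t => ‖v t‖ ^ 2))
    (hweak : ∀ φ : 𝓢(EuclideanSpace ℝ ι, ℂ), ∫ t, v t * (schrodinger A W φ + (s : ℂ) • φ) t = 0)
    (η : ContDiffBump (0 : EuclideanSpace ℝ ι)) {χ : EuclideanSpace ℝ ι → ℝ}
    (hχ : ContDiff ℝ (⊤ : ℕ∞) χ) (hχc : HasCompactSupport χ) (hχ0 : ∀ x, 0 ≤ χ x)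
    (hχ1 : ∀ x, χ x ≤ 1) {b δ r : ℝ} (hb : ∀ x v, ‖fderiv ℝ χ x v‖ ≤ b * ‖v‖)
    (hχr : ∀ x, r ≤ ‖x‖ → χ x = 0) (hδ0 : 0 ≤ δ)
    (hδ : ∀ x t, ‖x‖ ≤ r → ‖x - t‖ ≤ η.rOut → |W x - W t| ≤ δ) :
    ∫ x, ‖(χ x : ℂ) * conv v (fun x => (η.normed volume x : ℂ)) x‖ ^ 2 ≤
      ((∑ i, ∑ j, |A i j|) * b ^ 2 + δ) * ∫ t, ‖v t‖ ^ 2 := by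
  set γ := η.normed volume with hγ
  have hγc : ContDiff ℝ (⊤ : ℕ∞) γ := η.contDiff_normed
  have hγs : HasCompactSupport γ := η.hasCompactSupport_normed
  have hγ0 : ∀ x, 0 ≤ γ x := fun x => η.nonneg_normed x
  have hgc : ContDiff ℝ (⊤ : ℕ∞) (fun x => (γ x : ℂ)) := Complex.ofRealCLM.contDiff.comp hγc
  have hgs : HasCompactSupport (fun x => (γ x : ℂ)) :=
    hγs.comp_left (g := fun t : ℝ => (t : ℂ)) (by simp)
  set f := conv v (fun x => (γ x : ℂ)) with hf
  have hfc : ContDiff ℝ (⊤ : ℕ∞) f := contDiff_conv hv hgs hgc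
  obtain ⟨hmi, hm2, hm3⟩ := integrable_conv_norm_sq hv hv2 hγc.continuous hγs hγ0 η.integral_normed
  set m : EuclideanSpace ℝ ι → ℝ := fun x => ∫ t, ‖v t‖ * γ (x - t) with hm
  have hm0 : ∀ x, 0 ≤ m x := fun x => integral_nonneg fun t => mul_nonneg (norm_nonneg _) (hγ0 _)
  have hfm : ∀ x, ‖f x‖ ≤ m x := fun x => by
    refine (norm_integral_le_integral_norm _).trans (le_of_eq ?_)
    refine integral_congr_ae (Filter.Eventually.of_forall fun t => ?_)
    simp only [norm_mul, Complex.norm_real, Real.norm_eq_abs, abs_of_nonneg (hγ0 _)]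
  have heq := diffOp_conv_add A hW hv hweak hgs hgc
  have hcomm : ∀ x, ‖x‖ ≤ r → ‖diffOp A f x + (W x + s) * f x‖ ≤ δ * m x := fun x hx => by
    rw [heq]
    have h1 : ∫ t, δ * (‖v t‖ * γ (x - t)) = δ * m x := integral_const_mul _ _
    rw [← h1]
    refine norm_integral_le_of_norm_le ((hmi x).const_mul δ) (Filter.Eventually.of_forall fun t => ?_)
    rw [norm_mul, norm_mul, Complex.norm_real, Real.norm_eq_abs, abs_of_nonneg (hγ0 _),
      ← Complex.ofReal_sub, Complex.norm_real, Real.norm_eq_abs]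
    by_cases ht : ‖x - t‖ ≤ η.rOut
    · calc ‖v t‖ * (|W x - W t| * γ (x - t)) ≤ ‖v t‖ * (δ * γ (x - t)) :=
            mul_le_mul_of_nonneg_left (mul_le_mul_of_nonneg_right (hδ x t hx ht) (hγ0 _))
              (norm_nonneg _)
        _ = _ := by ring
    · have h2 : γ (x - t) = 0 := by
        by_contra h3
        have h4 : x - t ∈ Function.support γ := h3
        rw [hγ, η.support_normed_eq, mem_ball_zero_iff] at h4
        exact ht h4.le
      rw [h2]
      simp
  let ψ : 𝓢(EuclideanSpace ℝ ι, ℂ) := HasCompactSupport.toSchwartzMap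
    (f := fun x => (χ x : ℂ) * f x)
    ((hχc.comp_left (g := fun t : ℝ => (t : ℂ)) (by simp)).mul_right)
    ((Complex.ofRealCLM.contDiff.comp hχ).mul hfc)
  have h1 := hpos ψ
  have h2 := energy_add_const A hWr s ψ
  have h3 : ‖incl ι ψ‖ ^ 2 ≤ energy A (fun x => W x + s) ψ := by linarith
  rw [norm_incl_sq] at h3
  have h4 : energy A (fun x => W x + s) ψ = _ :=
    energy_cutoff (W := fun x => W x + s) hA (by have := hWr.cont; fun_prop) hfc hχ hχc
  rw [h4] at h3
  refine h3.trans ?_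
  have h5 : ((∑ i, ∑ j, |A i j|) * b ^ 2 + δ) * ∫ t, m t ^ 2 ≤
      ((∑ i, ∑ j, |A i j|) * b ^ 2 + δ) * ∫ t, ‖v t‖ ^ 2 :=
    mul_le_mul_of_nonneg_left hm3 (by positivity)
  refine le_trans ?_ h5
  rw [← integral_const_mul]
  set F : EuclideanSpace ℝ ι → ℝ := fun x =>
    ‖f x‖ ^ 2 * hermForm A (fun i => ((fderiv ℝ χ x (EuclideanSpace.single i 1) : ℝ) : ℂ))
        + χ x ^ 2 * ((starRingEnd ℂ) (f x) * (diffOp A f x + ((W x + s : ℝ) : ℂ) * f x)).re with hF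
  -- If `F` were not integrable its integral would be `0` by convention, and the bound would still
  -- hold.
  by_cases hFi : Integrable F
  swap
  · rw [integral_undef hFi]
    exact integral_nonneg fun x => by positivity
  refine integral_mono hFi (hm2.const_mul _) fun x => ?_
  have hfm2 : ‖f x‖ ^ 2 ≤ m x ^ 2 := pow_le_pow_left₀ (norm_nonneg _) (hfm x) 2
  have hA1 : hermForm A (fun i => ((fderiv ℝ χ x (EuclideanSpace.single i 1) : ℝ) : ℂ)) ≤
      (∑ i, ∑ j, |A i j|) * b ^ 2 := by
    refine (le_abs_self _).trans (abs_hermForm_le A _ b fun i => ?_)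
    rw [Complex.norm_real]
    simpa using hb x (EuclideanSpace.single i 1)
  have t1 : ‖f x‖ ^ 2 * hermForm A (fun i => ((fderiv ℝ χ x (EuclideanSpace.single i 1) : ℝ) : ℂ)) ≤
      m x ^ 2 * ((∑ i, ∑ j, |A i j|) * b ^ 2) :=
    (mul_le_mul_of_nonneg_left hA1 (by positivity)).trans
      (mul_le_mul_of_nonneg_right hfm2 (by positivity))
  have t2 : χ x ^ 2 * ((starRingEnd ℂ) (f x) * (diffOp A f x + ((W x + s : ℝ) : ℂ) * f x)).re ≤
      δ * m x ^ 2 := by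
    rcases le_or_gt r ‖x‖ with hx | hx
    · rw [hχr x hx]
      have := hm0 x
      simp only [ne_eq, OfNat.ofNat_ne_zero, not_false_eq_true, zero_pow, zero_mul]
      positivity
    · have h6 : ((starRingEnd ℂ) (f x) * (diffOp A f x + ((W x + s : ℝ) : ℂ) * f x)).re ≤
          m x * (δ * m x) := by
        refine (Complex.re_le_norm _).trans ?_
        rw [norm_mul, RCLike.norm_conj]
        refine mul_le_mul (hfm x) ?_ (norm_nonneg _) (hm0 x)
        rw [Complex.ofReal_add]
        exact hcomm x hx.le
      have h7 : χ x ^ 2 ≤ 1 := pow_le_one₀ (hχ0 x) (hχ1 x)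
      have h8 : 0 ≤ m x * (δ * m x) := mul_nonneg (hm0 x) (mul_nonneg hδ0 (hm0 x))
      calc _ ≤ χ x ^ 2 * (m x * (δ * m x)) := mul_le_mul_of_nonneg_left h6 (by positivity)
        _ ≤ 1 * (m x * (δ * m x)) := mul_le_mul_of_nonneg_right h7 h8
        _ = _ := by ring
  calc F x ≤ m x ^ 2 * ((∑ i, ∑ j, |A i j|) * b ^ 2) + δ * m x ^ 2 := add_le_add t1 t2
    _ = _ := by ring

set_option maxHeartbeats 1000000 in
/-- A Schrödinger operator that is bounded below on the Schwartz space is essentially self-adjoint: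
`A(iD) + W + s` has dense range. -/
theorem denseRange_schrodinger {A : Matrix ι ι ℝ} (hA : A.IsSymm) {W : EuclideanSpace ℝ ι → ℝ}
    (hW : (fun x => ((W x : ℝ) : ℂ)).HasTemperateGrowth) (hWr : PolyBounded W) {s : ℝ}
    (hpos : ∀ φ : 𝓢(EuclideanSpace ℝ ι, ℂ), (1 - s) * ‖incl ι φ‖ ^ 2 ≤ energy A W φ) :
    DenseRange (fun φ => incl ι (schrodinger A W φ + (s : ℂ) • φ)) := by
  let G : 𝓢(EuclideanSpace ℝ ι, ℂ) →ₗ[ℂ] L2 ι :=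
    (incl ι) ∘ₗ (schrodinger A W + (s : ℂ) • LinearMap.id)
  change DenseRange G
  rw [DenseRange, ← LinearMap.coe_range, Submodule.dense_iff_topologicalClosure_eq_top,
    Submodule.topologicalClosure_eq_top_iff, Submodule.eq_bot_iff]
  intro u hu
  -- A vector `u` orthogonal to the range has to vanish. Conjugating it turns orthogonality into a
  -- weak equation without conjugates.
  set v : EuclideanSpace ℝ ι → ℂ := fun x => (starRingEnd ℂ) (u x) with hvdef
  have hum : MemLp u 2 volume := Lp.memLp u
  have hvm : MemLp v 2 volume := hum.star
  have hv : LocallyIntegrable v := hvm.locallyIntegrable (by norm_num)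
  have hv2 : Integrable (fun t => ‖v t‖ ^ 2) := hvm.integrable_norm_pow (by norm_num)
  have hweak : ∀ φ : 𝓢(EuclideanSpace ℝ ι, ℂ),
      ∫ t, v t * (schrodinger A W φ + (s : ℂ) • φ) t = 0 := by
    intro φ
    have h1 : inner ℂ u (G φ) = 0 := Submodule.inner_left_of_mem_orthogonal (LinearMap.mem_range_self G φ) hu
    rw [L2.inner_def] at h1
    rw [← h1]
    have h2 : G φ =ᵐ[volume] (schrodinger A W φ + (s : ℂ) • φ) :=
      SchwartzMap.coeFn_toLp (schrodinger A W φ + (s : ℂ) • φ) 2 volume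
    refine integral_congr_ae (h2.mono fun x hx => ?_)
    simp only [hx, hvdef]
    rw [RCLike.inner_apply, mul_comm]
    rfl
  obtain ⟨B, hB0, hcut⟩ := exists_cutoff ι
  have hcutn : ∀ n : ℕ, (0 : ℝ) < n + 1 := fun n => by positivity
  choose χ hχs hχc hχ1 hχout hχ0 hχle hχb using fun n : ℕ => hcut _ (hcutn n)
  -- The mollification radius is chosen after the cutoff radius, by uniform continuity of `W` on a
  -- slightly larger ball. This is why no growth condition relating `W` to the cutoff is needed.
  have hε : ∀ n : ℕ, ∃ ε : ℝ, 0 < ε ∧ ε ≤ 1 / (n + 1) ∧ ∀ x t : EuclideanSpace ℝ ι,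
      ‖x‖ ≤ 2 * ((n : ℝ) + 1) → ‖x - t‖ ≤ ε → |W x - W t| ≤ 1 / (n + 1) := by
    intro n
    have hK : IsCompact (Metric.closedBall (0 : EuclideanSpace ℝ ι) (2 * ((n : ℝ) + 1) + 1)) :=
      isCompact_closedBall _ _
    have huc := hK.uniformContinuousOn_of_continuous hWr.cont.continuousOn
    rw [Metric.uniformContinuousOn_iff_le] at huc
    obtain ⟨ε, hε, h⟩ := huc (1 / (n + 1)) (by positivity)
    refine ⟨min ε (1 / (n + 1)), by positivity, min_le_right _ _, fun x t hx hxt => ?_⟩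
    have h1 : (1 : ℝ) / (n + 1) ≤ 1 := by
      rw [div_le_one (by positivity)]
      linarith [(Nat.cast_nonneg n : (0 : ℝ) ≤ n)]
    refine h x (by rw [mem_closedBall_zero_iff]; linarith) t ?_
      (by rw [dist_eq_norm]; exact hxt.trans (min_le_left _ _))
    rw [mem_closedBall_zero_iff]
    have h2 : ‖t‖ ≤ ‖x‖ + ‖x - t‖ := by
      have := norm_sub_le x (x - t)
      simpa using this
    linarith [hxt.trans (min_le_right _ _)]
  choose ε hε0 hε1 hεW using hε
  let η : ℕ → ContDiffBump (0 : EuclideanSpace ℝ ι) := fun n =>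
    ⟨ε n / 2, ε n, half_pos (hε0 n), half_lt_self (hε0 n)⟩
  set V := ∫ t, ‖v t‖ ^ 2 with hV
  set F : ℕ → EuclideanSpace ℝ ι → ℂ := fun n x =>
    (χ n x : ℂ) * conv v (fun x => ((η n).normed volume x : ℂ)) x with hF
  have hbound : ∀ n, ∫ x, ‖F n x‖ ^ 2 ≤
      ((∑ i, ∑ j, |A i j|) * (B / (n + 1)) ^ 2 + 1 / (n + 1)) * V := fun n =>
    integral_cutoff_conv_le hA hW hWr hpos hv hv2 hweak (η n) (hχs n) (hχc n) (hχ0 n) (hχle n)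
      (hχb n) (hχout n) (by positivity) (hεW n)
  have hFc : ∀ n, Continuous (F n) ∧ HasCompactSupport (F n) := fun n => by
    have hgc : ContDiff ℝ (⊤ : ℕ∞) (fun x => ((η n).normed volume x : ℂ)) :=
      Complex.ofRealCLM.contDiff.comp (η n).contDiff_normed
    have hgs : HasCompactSupport (fun x => ((η n).normed volume x : ℂ)) :=
      (η n).hasCompactSupport_normed.comp_left (g := fun t : ℝ => (t : ℂ)) (by simp)
    refine ⟨(Complex.continuous_ofReal.comp (hχs n).continuous).mul
      (contDiff_conv hv hgs hgc).continuous, ?_⟩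
    exact ((hχc n).comp_left (g := fun t : ℝ => (t : ℂ)) (by simp)).mul_right
  have hlim : ∀ᵐ x, Filter.Tendsto (fun n => F n x) Filter.atTop (nhds (v x)) := by
    have hr : Filter.Tendsto (fun n => (η n).rOut) Filter.atTop (nhds 0) :=
      squeeze_zero (fun n => (hε0 n).le) hε1 tendsto_one_div_add_atTop_nhds_zero_nat
    have h := ContDiffBump.ae_convolution_tendsto_right_of_locallyIntegrable (φ := η) (K := 2) hr
      (Filter.Eventually.of_forall fun n => by
        change ε n ≤ 2 * (ε n / 2)
        linarith) hv
    refine h.mono fun x hx => hx.congr' ?_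
    obtain ⟨N, hN⟩ := exists_nat_ge ‖x‖
    filter_upwards [Filter.eventually_ge_atTop N] with n hn
    have hn' : (N : ℝ) ≤ n := Nat.cast_le.2 hn
    simp only [hF]
    rw [hχ1 n x (by linarith), Complex.ofReal_one, one_mul, convolution_lsmul_swap]
    refine integral_congr_ae (Filter.Eventually.of_forall fun t => ?_)
    simp only [Complex.real_smul]
    ring
  have hcz : Filter.Tendsto (fun n : ℕ =>
      ((∑ i, ∑ j, |A i j|) * (B / ((n : ℝ) + 1)) ^ 2 + 1 / (n + 1)) * V) Filter.atTop (nhds 0) := by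
    have h3 : Filter.Tendsto (fun n : ℕ => (1 : ℝ) / (n + 1)) Filter.atTop (nhds 0) :=
      tendsto_one_div_add_atTop_nhds_zero_nat
    have h4 : Filter.Tendsto (fun n : ℕ =>
        ((∑ i, ∑ j, |A i j|) * (B * (1 / ((n : ℝ) + 1))) ^ 2 + 1 / (n + 1)) * V)
        Filter.atTop (nhds (((∑ i, ∑ j, |A i j|) * (B * 0) ^ 2 + 0) * V)) :=
      ((((h3.const_mul B).pow 2).const_mul _).add h3).mul_const V
    simp only [mul_zero, ne_eq, OfNat.ofNat_ne_zero, not_false_eq_true, zero_pow, add_zero,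
      zero_mul] at h4
    refine h4.congr fun n => ?_
    rw [mul_one_div]
  have hV0 : ∀ᵐ x, v x = 0 := by
    exact ae_eq_zero_of_integral_sq_le (fun n => (hFc n).1)
      (fun n => integrable_normSq_of_hasCompactSupport (hFc n).1 (hFc n).2) hbound hcz hlim
  refine (Lp.eq_zero_iff_ae_eq_zero).2 (hV0.mono fun x hx => ?_)
  simpa [hvdef] using hx

end SelfAdjoint

/-! ### Algebra and two-sided bounds for the quartic form -/

section Quartic

variable {r₁ r₂ : ℕ} {α : Fin r₁ → Fin r₁ → Fin r₂ → Fin r₂ → ℝ}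

/-- Lets every statement about one group of variables be reused for the other. -/
theorem quartic_swap (α : Fin r₁ → Fin r₁ → Fin r₂ → Fin r₂ → ℝ) (x : Fin r₁ → ℝ)
    (y : Fin r₂ → ℝ) : quartic (fun k l i j => α i j k l) y x = quartic α x y := by
  simp only [quartic]
  have h1 : ∀ (f : Fin r₂ → Fin r₂ → Fin r₁ → Fin r₁ → ℝ),
      ∑ k, ∑ l, ∑ i, ∑ j, f k l i j = ∑ i, ∑ j, ∑ k, ∑ l, f k l i j := fun f => by
    calc ∑ k, ∑ l, ∑ i, ∑ j, f k l i j = ∑ k, ∑ i, ∑ l, ∑ j, f k l i j :=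
          Finset.sum_congr rfl fun k _ => Finset.sum_comm
      _ = ∑ i, ∑ k, ∑ l, ∑ j, f k l i j := Finset.sum_comm
      _ = ∑ i, ∑ k, ∑ j, ∑ l, f k l i j :=
          Finset.sum_congr rfl fun i _ => Finset.sum_congr rfl fun k _ => Finset.sum_comm
      _ = _ := Finset.sum_congr rfl fun i _ => Finset.sum_comm
  rw [h1]
  refine Finset.sum_congr rfl fun i _ => Finset.sum_congr rfl fun j _ =>
    Finset.sum_congr rfl fun k _ => Finset.sum_congr rfl fun l _ => ?_
  ring

theorem quartic_smul_smul (a b : ℝ) (x : EuclideanSpace ℝ (Fin r₁))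
    (y : EuclideanSpace ℝ (Fin r₂)) :
    quartic α (a • x : EuclideanSpace ℝ (Fin r₁)) (b • y : EuclideanSpace ℝ (Fin r₂)) =
      a ^ 2 * b ^ 2 * quartic α x y := by
  simp only [quartic, Finset.mul_sum, PiLp.smul_apply, smul_eq_mul]
  refine Finset.sum_congr rfl fun i _ => Finset.sum_congr rfl fun j _ =>
    Finset.sum_congr rfl fun k _ => Finset.sum_congr rfl fun l _ => ?_
  ring

theorem quartic_smul_add (s : ℝ) (u v : EuclideanSpace ℝ (Fin r₁)) (y : Fin r₂ → ℝ) :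
    quartic α (s • u + v : EuclideanSpace ℝ (Fin r₁)) y = s ^ 2 * quartic α u y +
      s * (quartic α (u + v : EuclideanSpace ℝ (Fin r₁)) y - quartic α u y - quartic α v y)
      + quartic α v y := by
  simp only [quartic, Finset.mul_sum, PiLp.smul_apply, PiLp.add_apply, smul_eq_mul,
    ← Finset.sum_sub_distrib, ← Finset.sum_add_distrib]
  refine Finset.sum_congr rfl fun i _ => Finset.sum_congr rfl fun j _ =>
    Finset.sum_congr rfl fun k _ => Finset.sum_congr rfl fun l _ => ?_
  ring

theorem continuous_quartic (α : Fin r₁ → Fin r₁ → Fin r₂ → Fin r₂ → ℝ) :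
    Continuous fun p : EuclideanSpace ℝ (Fin r₁) × EuclideanSpace ℝ (Fin r₂) =>
      quartic α p.1 p.2 := by
  unfold quartic
  fun_prop

/-- A nonnegative quartic of this form is, up to a factor close to one, insensitive to a
perturbation of the first variable. -/
theorem quartic_add_ge (h0 : ∀ x y, 0 ≤ quartic α x y) {τ : ℝ} (hτ : 0 < τ)
    (u v : EuclideanSpace ℝ (Fin r₁)) (y : Fin r₂ → ℝ) :
    (1 - τ) * quartic α u y - τ⁻¹ * quartic α v y ≤
      quartic α (u + v : EuclideanSpace ℝ (Fin r₁)) y := by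
  -- Nonnegativity at `τ u + v`, divided by `τ`, bounds the polar cross term from below.
  have h1 := h0 (τ • u + v : EuclideanSpace ℝ (Fin r₁)) y
  rw [quartic_smul_add] at h1
  have h2 := h0 v y
  have h3 : 0 ≤ τ⁻¹ * (τ ^ 2 * quartic α u y +
      τ * (quartic α (u + v : EuclideanSpace ℝ (Fin r₁)) y - quartic α u y - quartic α v y)
      + quartic α v y) := by positivity
  have h4 : τ⁻¹ * (τ ^ 2 * quartic α u y +
      τ * (quartic α (u + v : EuclideanSpace ℝ (Fin r₁)) y - quartic α u y - quartic α v y)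
      + quartic α v y) = τ * quartic α u y + (quartic α (u + v : EuclideanSpace ℝ (Fin r₁)) y
        - quartic α u y - quartic α v y) + τ⁻¹ * quartic α v y := by
    field_simp
  linarith

theorem quartic_pos (hpos : ∀ (x : Fin r₁ → ℝ) (y : Fin r₂ → ℝ), x ≠ 0 → y ≠ 0 →
    MatrixPositive (partial₁ α x)) (x : Fin r₁ → ℝ) (y : Fin r₂ → ℝ) (hx : x ≠ 0) (hy : y ≠ 0) :
    0 < quartic α x y := by
  have h := hpos x y hx hy y hy
  have h2 : quartic α x y = y ⬝ᵥ (partial₁ α x *ᵥ y) := by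
    simp only [dotProduct, Matrix.mulVec, partial₁, Matrix.of_apply, Finset.mul_sum, Finset.sum_mul]
    rw [← quartic_swap]
    simp only [quartic]
    refine Finset.sum_congr rfl fun k _ => Finset.sum_congr rfl fun l _ =>
      Finset.sum_congr rfl fun i _ => Finset.sum_congr rfl fun j _ => ?_
    ring
  rw [h2]
  exact h

/-- A function homogeneous of degree two in each variable is controlled by its values on the
product of the unit spheres. -/
theorem quartic_bounds (hpos : ∀ (x : Fin r₁ → ℝ) (y : Fin r₂ → ℝ), x ≠ 0 → y ≠ 0 →
      0 < quartic α x y) :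
    ∃ c M : ℝ, 0 < c ∧ 0 < M ∧ ∀ (x : EuclideanSpace ℝ (Fin r₁)) (y : EuclideanSpace ℝ (Fin r₂)),
      c * (‖x‖ ^ 2 * ‖y‖ ^ 2) ≤ quartic α x y ∧ quartic α x y ≤ M * (‖x‖ ^ 2 * ‖y‖ ^ 2) := by
  set K : Set (EuclideanSpace ℝ (Fin r₁) × EuclideanSpace ℝ (Fin r₂)) :=
    Metric.sphere 0 1 ×ˢ Metric.sphere 0 1 with hKdef
  have hK : IsCompact K := (isCompact_sphere _ _).prod (isCompact_sphere _ _)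
  have hc := (continuous_quartic α).continuousOn (s := K)
  have hred : ∀ c M : ℝ, (∀ p ∈ K, c ≤ quartic α p.1 p.2 ∧ quartic α p.1 p.2 ≤ M) →
      ∀ (x : EuclideanSpace ℝ (Fin r₁)) (y : EuclideanSpace ℝ (Fin r₂)),
      c * (‖x‖ ^ 2 * ‖y‖ ^ 2) ≤ quartic α x y ∧ quartic α x y ≤ M * (‖x‖ ^ 2 * ‖y‖ ^ 2) := by
    intro c M h x y
    by_cases hxy : x = 0 ∨ y = 0
    · have hz : quartic α x y = 0 := by
        rcases hxy with rfl | rfl <;> simp [quartic]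
      rw [hz]
      rcases hxy with rfl | rfl <;> simp
    · push Not at hxy
      have hx : ‖x‖ ≠ 0 := norm_ne_zero_iff.2 hxy.1
      have hy : ‖y‖ ≠ 0 := norm_ne_zero_iff.2 hxy.2
      have h1 := h (‖x‖⁻¹ • x, ‖y‖⁻¹ • y) (by
        simp [hKdef, norm_smul, hx, hy])
      have h2 : quartic α x y = ‖x‖ ^ 2 * ‖y‖ ^ 2 *
          quartic α (‖x‖⁻¹ • x : EuclideanSpace ℝ (Fin r₁))
            (‖y‖⁻¹ • y : EuclideanSpace ℝ (Fin r₂)) := by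
        rw [quartic_smul_smul]
        field_simp
      have h3 : 0 ≤ ‖x‖ ^ 2 * ‖y‖ ^ 2 := by positivity
      rw [h2]
      constructor
      · rw [mul_comm c]
        exact mul_le_mul_of_nonneg_left h1.1 h3
      · rw [mul_comm M]
        exact mul_le_mul_of_nonneg_left h1.2 h3
  -- A unit sphere is empty in dimension zero; any constants then work.
  rcases K.eq_empty_or_nonempty with he | hne
  · exact ⟨1, 1, one_pos, one_pos, hred 1 1 (by simp [he])⟩
  · obtain ⟨p, hp, hmin⟩ := hK.exists_isMinOn hne hc
    obtain ⟨p', hp', hmax⟩ := hK.exists_isMaxOn hne hc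
    have hne0 : ∀ q ∈ K, 0 < quartic α q.1 q.2 := fun q hq => by
      have h1 : ‖q.1‖ = 1 := by simpa using hq.1
      have h2 : ‖q.2‖ = 1 := by simpa using hq.2
      refine hpos _ _ (fun h => ?_) (fun h => ?_)
      · have : q.1 = 0 := by ext i; exact congrFun h i
        simp [this] at h1
      · have : q.2 = 0 := by ext i; exact congrFun h i
        simp [this] at h2
    exact ⟨_, _, hne0 p hp, hne0 p' hp', hred _ _ fun q hq => ⟨hmin hq, hmax hq⟩⟩

end Quartic

/-! ### Positivity, affine substitutions and monotonicity -/

section Basic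

variable {ι : Type} [Fintype ι]

/-- Reduces positivity of the Hermitian extension to that of the real matrix. -/
theorem hermForm_eq_re_add_im (A : Matrix ι ι ℝ) (ξ : ι → ℂ) :
    hermForm A ξ = (fun i => (ξ i).re) ⬝ᵥ (A *ᵥ fun i => (ξ i).re) +
      (fun i => (ξ i).im) ⬝ᵥ (A *ᵥ fun i => (ξ i).im) := by
  simp only [hermForm, dotProduct, Matrix.mulVec, Finset.mul_sum, ← Finset.sum_add_distrib]
  refine Finset.sum_congr rfl fun i _ => Finset.sum_congr rfl fun j _ => ?_
  simp
  ring

theorem hermForm_nonneg {A : Matrix ι ι ℝ} (hA : A.PosSemidef) (ξ : ι → ℂ) : 0 ≤ hermForm A ξ := by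
  rw [hermForm_eq_re_add_im]
  have h : ∀ x : ι → ℝ, 0 ≤ x ⬝ᵥ (A *ᵥ x) := fun x => by simpa using hA.dotProduct_mulVec_nonneg x
  exact add_nonneg (h _) (h _)

theorem hermForm_smul_left (A : Matrix ι ι ℝ) (c : ℝ) (ξ : ι → ℂ) :
    hermForm A (fun i => (c : ℂ) * ξ i) = c ^ 2 * hermForm A ξ := by
  simp only [hermForm, Finset.mul_sum]
  refine Finset.sum_congr rfl fun i _ => Finset.sum_congr rfl fun j _ => ?_
  simp
  ring

/-- An injective linear map in finite dimension is bounded below, so decay survives the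
substitution. It provides dilations, translations and restrictions to fibres. -/
theorem exists_comp_affine {E F : Type} [NormedAddCommGroup E] [NormedSpace ℝ E]
    [FiniteDimensional ℝ E] [NormedAddCommGroup F] [NormedSpace ℝ F] (T : E →L[ℝ] F)
    (hT : Function.Injective T) (c : F) (φ : 𝓢(F, ℂ)) :
    ∃ ψ : 𝓢(E, ℂ), ∀ y, ψ y = φ (T y + c) := by
  obtain ⟨K, -, hK⟩ := (T : E →ₗ[ℝ] F).exists_antilipschitzWith (LinearMap.ker_eq_bot.2 hT)
  have hg : (fun y => T y + c).HasTemperateGrowth := by fun_prop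
  have hg' : AntilipschitzWith K (fun y => T y + c) := fun x y => by
    simpa using hK x y
  exact ⟨SchwartzMap.compCLMOfAntilipschitz ℂ hg hg' φ, fun y => rfl⟩

variable [DecidableEq ι]

theorem grad_comp_affine {F : Type} [NormedAddCommGroup F] [NormedSpace ℝ F]
    (T : EuclideanSpace ℝ ι →L[ℝ] F) (c : F) (φ : 𝓢(F, ℂ)) (y : EuclideanSpace ℝ ι) (i : ι) :
    grad (fun y => φ (T y + c)) y i = fderiv ℝ φ (T y + c) (T (EuclideanSpace.single i 1)) := by
  have h := (φ.hasFDerivAt (x := T y + c)).comp y ((T.hasFDerivAt (x := y)).add_const c)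
  have h2 : fderiv ℝ (fun y => φ (T y + c)) y = _ := h.fderiv
  rw [grad, h2]
  rfl

/-- The kinetic term is nonnegative, so shrinking it by `ρ ≤ 1` is free. -/
theorem energy_mono {A : Matrix ι ι ℝ} (hA : A.PosSemidef) {W W' : EuclideanSpace ℝ ι → ℝ}
    (hW : PolyBounded W) (hW' : PolyBounded W') {ρ : ℝ} (hρ1 : ρ ≤ 1)
    (h : ∀ x, ρ * W x ≤ W' x) (φ : 𝓢(EuclideanSpace ℝ ι, ℂ)) :
    ρ * energy A W φ ≤ energy A W' φ := by
  rw [energy, ← integral_const_mul]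
  refine integral_mono ((integrable_energy A hW φ).const_mul ρ) (integrable_energy A hW' φ)
    fun x => ?_
  have h1 := hermForm_nonneg hA (grad φ x)
  have h2 := mul_le_mul_of_nonneg_right (h x) (sq_nonneg ‖φ x‖)
  have h3 := mul_le_mul_of_nonneg_right hρ1 h1
  simp only [mul_add]
  linarith

theorem energy_nonneg {A : Matrix ι ι ℝ} (hA : A.PosSemidef) {W : EuclideanSpace ℝ ι → ℝ}
    (hW : ∀ x, 0 ≤ W x) (φ : EuclideanSpace ℝ ι → ℂ) : 0 ≤ energy A W φ :=
  integral_nonneg fun x =>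
    add_nonneg (hermForm_nonneg hA _) (mul_nonneg (hW x) (sq_nonneg _))

end Basic

/-! ### Uniform gap of the transverse operators -/

section Transverse

variable {r₁ r₂ : ℕ} {α : Fin r₁ → Fin r₁ → Fin r₂ → Fin r₂ → ℝ}

theorem polyBounded_of_temperate {E : Type} [NormedAddCommGroup E] [NormedSpace ℝ E] {W : E → ℝ}
    (hW : (fun x => ((W x : ℝ) : ℂ)).HasTemperateGrowth) : PolyBounded W := by
  have h2 : (fun x => Complex.reCLM ((W x : ℝ) : ℂ)).HasTemperateGrowth :=
    (Complex.reCLM.hasTemperateGrowth).comp hW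
  exact .of_hasTemperateGrowth (by simpa using h2)

/-- The scaling behaviour of the transverse energy. -/
theorem energy_quartic_smul (A : Matrix (Fin r₂) (Fin r₂) ℝ) {μ m : ℝ} (hμ : 0 < μ)
    (x : EuclideanSpace ℝ (Fin r₁))
    (h : ∀ ψ : 𝓢(EuclideanSpace ℝ (Fin r₂), ℂ),
      m * (∫ y, ‖ψ y‖ ^ 2) ≤ energy A (fun y => quartic α x y) ψ)
    (ψ : 𝓢(EuclideanSpace ℝ (Fin r₂), ℂ)) :
    μ ^ 2 * m * (∫ y, ‖ψ y‖ ^ 2) ≤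
      energy A (fun y => quartic α (μ ^ 2 • x : EuclideanSpace ℝ (Fin r₁)) y) ψ := by
  -- Dilating `y` by `μ` multiplies the kinetic term by `μ²`; since `V(μ² x, y) = μ² V(x, μ y)`, the
  -- potential term scales alike. Transverse energies are thus homogeneous of degree one in `x`,
  -- like the linear term.
  set T : EuclideanSpace ℝ (Fin r₂) →L[ℝ] EuclideanSpace ℝ (Fin r₂) :=
    μ⁻¹ • ContinuousLinearMap.id ℝ _ with hT
  obtain ⟨χ, hχ⟩ := exists_comp_affine T
    (fun a b hab => by simpa [hT, hμ.ne'] using hab) 0 ψ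
  have hψ : ∀ y, ψ y = χ (μ • y) := fun y => by
    rw [hχ]; simp [hT, smul_smul, hμ.ne']
  have hg : ∀ y, grad ψ y = fun i => (μ : ℂ) * grad χ (μ • y) i := fun y => by
    ext i
    have h1 := grad_comp_affine (μ • ContinuousLinearMap.id ℝ (EuclideanSpace ℝ (Fin r₂))) 0 χ y i
    have h2 : (fun y => χ ((μ • ContinuousLinearMap.id ℝ (EuclideanSpace ℝ (Fin r₂))) y + 0)) = ψ := by
      ext y; simp [hψ]
    rw [h2] at h1
    rw [h1]
    simp [grad]
  have e1 : ∫ y, ‖ψ y‖ ^ 2 = |(μ ^ Module.finrank ℝ (EuclideanSpace ℝ (Fin r₂)))⁻¹| *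
      ∫ y, ‖χ y‖ ^ 2 := by
    simp_rw [hψ]
    exact Measure.integral_comp_smul volume (fun y => ‖χ y‖ ^ 2) μ
  have e2 : energy A (fun y => quartic α (μ ^ 2 • x : EuclideanSpace ℝ (Fin r₁)) y) ψ =
      μ ^ 2 * (|(μ ^ Module.finrank ℝ (EuclideanSpace ℝ (Fin r₂)))⁻¹| *
        energy A (fun y => quartic α x y) χ) := by
    have h1 := Measure.integral_comp_smul volume
      (fun y => hermForm A (grad χ y) + quartic α x y * ‖χ y‖ ^ 2) μ
    rw [energy, energy, ← smul_eq_mul (a := |_|), ← h1, ← integral_const_mul]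
    refine integral_congr_ae (Filter.Eventually.of_forall fun y => ?_)
    simp only
    rw [hg, hermForm_smul_left, hψ]
    have h2 := quartic_smul_smul (α := α) (μ ^ 2) μ⁻¹ x (μ • y)
    rw [smul_smul, inv_mul_cancel₀ hμ.ne', one_smul] at h2
    rw [h2]
    field_simp
  rw [e1, e2]
  have h3 := mul_le_mul_of_nonneg_left (h χ)
    (show 0 ≤ μ ^ 2 * |(μ ^ Module.finrank ℝ (EuclideanSpace ℝ (Fin r₂)))⁻¹| by positivity)
  linarith

/-- `V(x - x₀, y)` is at most a small multiple of `V(x₀, y)`, as both are comparable to `‖y‖²`;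
hence one neighbourhood serves all `y`. -/
theorem quartic_ge_near {c M : ℝ} (hc : 0 < c) (hM : 0 < M) (h0 : ∀ x y, 0 ≤ quartic α x y)
    (hb : ∀ (x : EuclideanSpace ℝ (Fin r₁)) (y : EuclideanSpace ℝ (Fin r₂)),
      c * (‖x‖ ^ 2 * ‖y‖ ^ 2) ≤ quartic α x y ∧ quartic α x y ≤ M * (‖x‖ ^ 2 * ‖y‖ ^ 2))
    {x₀ : EuclideanSpace ℝ (Fin r₁)} (hx₀ : ‖x₀‖ = 1) {ρ : ℝ} (hρ : ρ < 1) :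
    ∀ᶠ x : EuclideanSpace ℝ (Fin r₁) in nhds x₀, ∀ y : EuclideanSpace ℝ (Fin r₂), ρ * quartic α x₀ y ≤ quartic α x y := by
  set τ := (1 - ρ) / 2 with hτ
  have hτ0 : 0 < τ := by linarith
  have h1 : Filter.Tendsto (fun x : EuclideanSpace ℝ (Fin r₁) => τ⁻¹ * (M * ‖x - x₀‖ ^ 2 / c))
      (nhds x₀) (nhds (τ⁻¹ * (M * ‖x₀ - x₀‖ ^ 2 / c))) := by
    refine Continuous.tendsto ?_ x₀
    fun_prop
  simp only [sub_self, norm_zero, ne_eq, OfNat.ofNat_ne_zero, not_false_eq_true, zero_pow, mul_zero,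
    zero_div] at h1
  filter_upwards [h1.eventually (gt_mem_nhds hτ0)] with x hx y
  have h2 := quartic_add_ge h0 hτ0 x₀ (x - x₀) y
  rw [add_sub_cancel] at h2
  refine le_trans ?_ h2
  have h3 := (hb (x - x₀) y).2
  have h4 := (hb x₀ y).1
  rw [hx₀] at h4
  have h5 : quartic α (x - x₀ : EuclideanSpace ℝ (Fin r₁)) y ≤ M * ‖x - x₀‖ ^ 2 / c * quartic α x₀ y := by
    refine h3.trans ?_
    have : M * ‖x - x₀‖ ^ 2 / c * (c * (1 ^ 2 * ‖y‖ ^ 2)) ≤ M * ‖x - x₀‖ ^ 2 / c * quartic α x₀ y :=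
      mul_le_mul_of_nonneg_left h4 (by positivity)
    refine le_trans (le_of_eq ?_) this
    field_simp
  have h6 : τ⁻¹ * quartic α (x - x₀ : EuclideanSpace ℝ (Fin r₁)) y ≤ τ * quartic α x₀ y :=
    calc τ⁻¹ * quartic α (x - x₀ : EuclideanSpace ℝ (Fin r₁)) y
        ≤ τ⁻¹ * (M * ‖x - x₀‖ ^ 2 / c * quartic α x₀ y) := mul_le_mul_of_nonneg_left h5 (by positivity)
      _ = τ⁻¹ * (M * ‖x - x₀‖ ^ 2 / c) * quartic α x₀ y := by ring
      _ ≤ τ * quartic α x₀ y := mul_le_mul_of_nonneg_right hx.le (h0 _ _)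
  have h7 : ρ = 1 - τ - τ := by rw [hτ]; ring
  rw [h7]
  linarith

/-- The quartic is even in `x`, so the hypotheses at `x` and `-x` concern the same operator and
together control the absolute value. -/
theorem energy_quartic_ge_abs {A : Matrix (Fin r₂) (Fin r₂) ℝ} {L : Fin r₁ → ℝ}
    (h : ∀ x : Fin r₁ → ℝ, x ≠ 0 →
      OperatorGT (schrodinger A (fun y => quartic α x y)) (∑ i, L i * x i))
    {x : EuclideanSpace ℝ (Fin r₁)} (hx : x ≠ 0) :
    ∃ ε > 0, ∀ ψ : 𝓢(EuclideanSpace ℝ (Fin r₂), ℂ),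
      (|∑ i, L i * x i| + ε) * (∫ y, ‖ψ y‖ ^ 2) ≤ energy A (fun y => quartic α x y) ψ := by
  have hx' : (x : Fin r₁ → ℝ) ≠ 0 := fun h => hx (by ext i; exact congrFun h i)
  obtain ⟨ε, hε, h1⟩ := h x hx'
  obtain ⟨ε', hε', h2⟩ := h (-x : EuclideanSpace ℝ (Fin r₁)) (by
    intro h; exact hx' (by simpa using h))
  refine ⟨min ε ε', lt_min hε hε', fun ψ => ?_⟩
  have h3 := h1 ψ
  have h4 := h2 ψ
  rw [re_inner_schrodinger _ (quartic_hasTemperateGrowth₂ α _), norm_incl_sq] at h3 h4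
  have h5 : ∀ y : EuclideanSpace ℝ (Fin r₂), quartic α (-x : EuclideanSpace ℝ (Fin r₁)) y =
      quartic α x y := fun y => by simp [quartic]
  simp_rw [h5] at h4
  have h6 : ∑ i, L i * (-x : EuclideanSpace ℝ (Fin r₁)) i = -∑ i, L i * x i := by simp
  rw [h6] at h4
  have h7 : 0 ≤ ∫ y, ‖ψ y‖ ^ 2 := integral_nonneg fun y => by positivity
  rcases abs_cases (∑ i, L i * x i) with ⟨h8, -⟩ | ⟨h8, -⟩ <;> rw [h8]
  · exact (mul_le_mul_of_nonneg_right (by linarith [min_le_left ε ε']) h7).trans h3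
  · exact (mul_le_mul_of_nonneg_right (by linarith [min_le_right ε ε']) h7).trans h4

/-- The transverse operators dominate the linear term uniformly. -/
theorem exists_uniform_transverse {A : Matrix (Fin r₂) (Fin r₂) ℝ} (hA : A.PosSemidef)
    {L : Fin r₁ → ℝ}
    (hpos : ∀ (x : Fin r₁ → ℝ) (y : Fin r₂ → ℝ), x ≠ 0 → y ≠ 0 → 0 < quartic α x y)
    (h0 : ∀ x y, 0 ≤ quartic α x y)
    (h : ∀ x : Fin r₁ → ℝ, x ≠ 0 →
      OperatorGT (schrodinger A (fun y => quartic α x y)) (∑ i, L i * x i)) :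
    ∃ ε > 0, ∀ (x : EuclideanSpace ℝ (Fin r₁)) (ψ : 𝓢(EuclideanSpace ℝ (Fin r₂), ℂ)),
      (|∑ i, L i * x i| + ε * ‖x‖) * (∫ y, ‖ψ y‖ ^ 2) ≤ energy A (fun y => quartic α x y) ψ := by
  obtain ⟨c, M, hc, hM, hb⟩ := quartic_bounds hpos
  have hW : ∀ x : EuclideanSpace ℝ (Fin r₁),
      PolyBounded (fun y : EuclideanSpace ℝ (Fin r₂) => quartic α x y) := fun x =>
    polyBounded_of_temperate (quartic_hasTemperateGrowth₂ α x)
  have hsphere : ∃ ε > 0, ∀ x ∈ Metric.sphere (0 : EuclideanSpace ℝ (Fin r₁)) 1,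
      ∀ ψ : 𝓢(EuclideanSpace ℝ (Fin r₂), ℂ),
      (|∑ i, L i * x i| + ε) * (∫ y, ‖ψ y‖ ^ 2) ≤ energy A (fun y => quartic α x y) ψ := by
    -- The gap is only pointwise in the hypothesis; compactness of the sphere makes it uniform.
    refine (isCompact_sphere (0 : EuclideanSpace ℝ (Fin r₁)) 1).induction_on
      (p := fun s => ∃ ε > 0, ∀ x ∈ s, ∀ ψ : 𝓢(EuclideanSpace ℝ (Fin r₂), ℂ),
      (|∑ i, L i * x i| + ε) * (∫ y, ‖ψ y‖ ^ 2) ≤ energy A (fun y => quartic α x y) ψ)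
      ⟨1, one_pos, by simp⟩ ?_ ?_ ?_
    · rintro s t hst ⟨ε, hε, ht⟩
      exact ⟨ε, hε, fun x hx => ht x (hst hx)⟩
    · rintro s t ⟨ε, hε, hs⟩ ⟨ε', hε', ht⟩
      refine ⟨min ε ε', lt_min hε hε', fun x hx ψ => ?_⟩
      have h7 : 0 ≤ ∫ y, ‖ψ y‖ ^ 2 := integral_nonneg fun y => by positivity
      rcases hx with hx | hx
      · exact (mul_le_mul_of_nonneg_right (by linarith [min_le_left ε ε']) h7).trans (hs x hx ψ)
      · exact (mul_le_mul_of_nonneg_right (by linarith [min_le_right ε ε']) h7).trans (ht x hx ψ)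
    · intro x₀ hx₀
      have hn : ‖x₀‖ = 1 := by simpa using hx₀
      obtain ⟨ε, hε, hx⟩ := energy_quartic_ge_abs h (x := x₀) (by
        rintro rfl; simp at hn)
      set a := |∑ i, L i * x₀ i| with ha
      have ha0 : 0 ≤ a := abs_nonneg _
      -- Passing from `x₀` to a nearby `x` costs the factor `ρ`, turning the bound `a + ε` into `a +
      -- ε / 2`; the linear term moves by less than `ε / 4`, so a gap `ε / 4` remains.
      set ρ := (a + ε / 2) / (a + ε) with hρ
      have hρ0 : 0 ≤ ρ := by positivity
      have hρ1 : ρ < 1 := by rw [hρ, div_lt_one (by positivity)]; linarith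
      have hcont : ∀ᶠ x : EuclideanSpace ℝ (Fin r₁) in nhds x₀,
          |∑ i, L i * x i| < a + ε / 4 := by
        have : Continuous fun x : EuclideanSpace ℝ (Fin r₁) => |∑ i, L i * x i| := by fun_prop
        exact this.tendsto x₀ (gt_mem_nhds (by linarith))
      refine ⟨_, mem_nhdsWithin_of_mem_nhds
        (Filter.inter_mem hcont (quartic_ge_near hc hM h0 hb hn hρ1)), ε / 4, by positivity, ?_⟩
      rintro x ⟨hx1, hx2⟩ ψ
      have hx1' : |∑ i, L i * x i| < a + ε / 4 := hx1
      have h7 : 0 ≤ ∫ y, ‖ψ y‖ ^ 2 := integral_nonneg fun y => by positivity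
      have h8 := energy_mono hA (hW x₀) (hW x) hρ1.le hx2 ψ
      have h9 := mul_le_mul_of_nonneg_left (hx ψ) hρ0
      have h10 : ρ * ((a + ε) * ∫ y, ‖ψ y‖ ^ 2) = (a + ε / 2) * ∫ y, ‖ψ y‖ ^ 2 := by
        rw [hρ]; field_simp
      refine le_trans (mul_le_mul_of_nonneg_right ?_ h7) (h10.symm.le.trans (h9.trans h8))
      linarith
  obtain ⟨ε, hε, hs⟩ := hsphere
  refine ⟨ε, hε, fun x ψ => ?_⟩
  by_cases hx : x = 0
  · subst hx
    simpa using energy_nonneg hA (fun y => h0 _ _) ψ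
  · have hx' : 0 < ‖x‖ := norm_pos_iff.2 hx
    -- The dilation with `μ² = ‖x‖` transports the estimate from the unit sphere to `x`.
    have h1 := energy_quartic_smul A (Real.sqrt_pos.2 hx') (‖x‖⁻¹ • x)
      (hs _ (by simp [norm_smul, hx'.ne'])) ψ
    rw [Real.sq_sqrt hx'.le, smul_smul, mul_inv_cancel₀ hx'.ne', one_smul] at h1
    refine le_trans (le_of_eq ?_) h1
    congr 1
    have : ∑ i, L i * (‖x‖⁻¹ • x : EuclideanSpace ℝ (Fin r₁)) i = ‖x‖⁻¹ * ∑ i, L i * x i := by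
      rw [Finset.mul_sum]
      refine Finset.sum_congr rfl fun i _ => ?_
      simp only [PiLp.smul_apply, smul_eq_mul]
      ring
    rw [this, abs_mul, abs_inv, abs_norm]
    field_simp

end Transverse

/-! ### Integration over fibres and the shear adapted to `Q` -/

/-- A linear change of variables into a product and Fubini preserve nonnegativity. -/
theorem integral_nonneg_of_fibers {X Y E : Type} [NormedAddCommGroup X] [InnerProductSpace ℝ X]
    [FiniteDimensional ℝ X] [MeasurableSpace X] [BorelSpace X] [NormedAddCommGroup Y]
    [InnerProductSpace ℝ Y] [FiniteDimensional ℝ Y] [MeasurableSpace Y] [BorelSpace Y]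
    [NormedAddCommGroup E] [InnerProductSpace ℝ E] [FiniteDimensional ℝ E] [MeasurableSpace E]
    [BorelSpace E] (J : (X × Y) ≃L[ℝ] E) {f : E → ℝ} (hf : Integrable f)
    (h : ∀ x, 0 ≤ ∫ y, f (J (x, y))) : 0 ≤ ∫ q, f q := by
  set μ : Measure E := (volume.prod volume : Measure (X × Y)).map J with hμ
  -- By uniqueness of Haar measure the pushforward is a positive multiple of Lebesgue measure, so no
  -- determinant has to be computed.
  have hH : μ.IsAddHaarMeasure := J.isAddHaarMeasure_map _
  have he : MeasurableEmbedding J := J.toHomeomorph.measurableEmbedding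
  have hsm : μ = μ.addHaarScalarFactor volume • volume := Measure.isAddLeftInvariant_eq_smul μ volume
  have hc : 0 < μ.addHaarScalarFactor volume := Measure.addHaarScalarFactor_pos_of_isAddHaarMeasure _ _
  have hfμ : Integrable f μ := by
    rw [hsm]
    exact hf.smul_measure_nnreal
  have h1 : ∫ q, f q ∂μ = ∫ x, ∫ y, f (J (x, y)) := by
    rw [hμ, he.integral_map]
    exact integral_prod _ (he.integrable_map_iff.1 hfμ)
  have h2 : 0 ≤ ∫ q, f q ∂μ := h1 ▸ integral_nonneg h
  rw [hsm, integral_smul_nnreal_measure] at h2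
  exact nonneg_of_mul_nonneg_right (a := (μ.addHaarScalarFactor volume : ℝ)) h2 (by exact_mod_cast hc)

section Fiber

variable {r₁ r₂ : ℕ} {α : Fin r₁ → Fin r₁ → Fin r₂ → Fin r₂ → ℝ}

/-- The first component of a point of the total space. -/
def fstPart (q : EuclideanSpace ℝ (Fin r₁ ⊕ Fin r₂)) : EuclideanSpace ℝ (Fin r₁) :=
  WithLp.toLp 2 fun i => q (Sum.inl i)

/-- The second component of a point of the total space. -/
def sndPart (q : EuclideanSpace ℝ (Fin r₁ ⊕ Fin r₂)) : EuclideanSpace ℝ (Fin r₂) :=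
  WithLp.toLp 2 fun k => q (Sum.inr k)

theorem norm_sq_parts (q : EuclideanSpace ℝ (Fin r₁ ⊕ Fin r₂)) :
    ‖q‖ ^ 2 = ‖fstPart q‖ ^ 2 + ‖sndPart q‖ ^ 2 := by
  simp [EuclideanSpace.norm_sq_eq, fstPart, sndPart]

theorem norm_le_parts (q : EuclideanSpace ℝ (Fin r₁ ⊕ Fin r₂)) :
    ‖q‖ ≤ ‖fstPart q‖ + ‖sndPart q‖ := by
  have h := norm_sq_parts q
  have h1 := norm_nonneg (fstPart q)
  have h2 := norm_nonneg (sndPart q)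
  refine abs_le_of_sq_le_sq' ?_ (by positivity) |>.2
  nlinarith

/-- The linear map `y ↦ Bᵀ y`. -/
def fiberShift (B : Matrix (Fin r₂) (Fin r₁) ℝ) :
    EuclideanSpace ℝ (Fin r₂) →ₗ[ℝ] EuclideanSpace ℝ (Fin r₁) where
  toFun y := WithLp.toLp 2 fun i => ∑ k, y k * B k i
  map_add' y z := by ext i; simp [add_mul, Finset.sum_add_distrib]
  map_smul' c y := by ext i; simp [Finset.mul_sum, mul_assoc]

/-- The linear coordinates `(x, y) ↦ (x + Bᵀ y, y)`. -/
def shear (B : Matrix (Fin r₂) (Fin r₁) ℝ) :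
    (EuclideanSpace ℝ (Fin r₁) × EuclideanSpace ℝ (Fin r₂)) ≃ₗ[ℝ]
      EuclideanSpace ℝ (Fin r₁ ⊕ Fin r₂) where
  toFun p := WithLp.toLp 2 (Sum.elim (fun i => (p.1 + fiberShift B p.2) i) (fun k => p.2 k))
  map_add' p p' := by
    ext (i | k)
    · simp; ring
    · simp
  map_smul' c p := by
    ext (i | k)
    · simp; ring
    · simp
  invFun q := (fstPart q - fiberShift B (sndPart q), sndPart q)
  left_inv p := by
    refine Prod.ext ?_ rfl
    ext i
    change (p.1 + fiberShift B p.2) i - fiberShift B p.2 i = p.1 i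
    simp
  right_inv q := by
    ext (i | k)
    · change (fstPart q - fiberShift B (sndPart q) + fiberShift B (sndPart q)) i = _
      simp [fstPart]
    · rfl

theorem fstPart_shear (B : Matrix (Fin r₂) (Fin r₁) ℝ) (x : EuclideanSpace ℝ (Fin r₁))
    (y : EuclideanSpace ℝ (Fin r₂)) : fstPart (shear B (x, y)) = x + fiberShift B y := rfl

theorem sndPart_shear (B : Matrix (Fin r₂) (Fin r₁) ℝ) (x : EuclideanSpace ℝ (Fin r₁))
    (y : EuclideanSpace ℝ (Fin r₂)) : sndPart (shear B (x, y)) = y := rfl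

/-- The derivative along a sheared fibre is `∂_{y_k} + ∑ B k i ∂_{x_i}`. For `B = Q₂₂⁻¹ Q₂₁` this is
the combination in `hermForm_ge_block`, so the restriction to a fibre carries the kinetic form
`Q₂₂`. -/
theorem shear_zero_single (B : Matrix (Fin r₂) (Fin r₁) ℝ) (k : Fin r₂) :
    shear B (0, EuclideanSpace.single k 1) =
      EuclideanSpace.single (Sum.inr k) 1 + ∑ i, B k i • EuclideanSpace.single (Sum.inl i) (1 : ℝ) := by
  ext (i | l)
  · simp [shear, fiberShift, Finset.sum_apply, Pi.single_apply]
  · simp [shear, Finset.sum_apply]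

/-- Minimizing a positive definite form over the gradient transverse to the fibre. -/
theorem hermForm_ge_block {Q : Matrix (Fin r₁ ⊕ Fin r₂) (Fin r₁ ⊕ Fin r₂) ℝ} (hQ : Q.PosDef)
    (ξ : Fin r₁ ⊕ Fin r₂ → ℂ) :
    hermForm Q.toBlocks₂₂ (fun k => ξ (Sum.inr k) +
      ∑ i, ((Q.toBlocks₂₂⁻¹ * Q.toBlocks₂₁) k i : ℂ) * ξ (Sum.inl i)) ≤ hermForm Q ξ := by
  have hD : Q.toBlocks₂₂.PosDef := hQ.submatrix Sum.inr_injective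
  have hDi : Invertible Q.toBlocks₂₂ := hD.isUnit.invertible
  have hsymm : Q.toBlocks₂₁ = Q.toBlocks₁₂ᴴ := by
    ext k i
    simpa [Matrix.toBlocks₂₁, Matrix.toBlocks₁₂] using (hQ.isHermitian.apply (Sum.inr k) (Sum.inl i)).symm
  have hblocks : Q = Matrix.fromBlocks Q.toBlocks₁₁ Q.toBlocks₁₂ Q.toBlocks₁₂ᴴ Q.toBlocks₂₂ := by
    rw [← hsymm, Matrix.fromBlocks_toBlocks]
  -- The excess of `Q` over the completed square in the fibre direction is its Schur complement.
  have hS : (Q.toBlocks₁₁ - Q.toBlocks₁₂ * Q.toBlocks₂₂⁻¹ * Q.toBlocks₁₂ᴴ).PosSemidef := by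
    rw [← Matrix.PosDef.fromBlocks₂₂ _ _ hD, ← hblocks]
    exact hQ.posSemidef
  have hreal : ∀ x : Fin r₁ ⊕ Fin r₂ → ℝ,
      (fun k => x (Sum.inr k) + ∑ i, (Q.toBlocks₂₂⁻¹ * Q.toBlocks₂₁) k i * x (Sum.inl i)) ⬝ᵥ
        (Q.toBlocks₂₂ *ᵥ fun k => x (Sum.inr k) +
          ∑ i, (Q.toBlocks₂₂⁻¹ * Q.toBlocks₂₁) k i * x (Sum.inl i)) ≤ x ⬝ᵥ (Q *ᵥ x) := by
    intro x
    have h1 := Matrix.schur_complement_eq₂₂ Q.toBlocks₁₁ Q.toBlocks₁₂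
      (x ∘ Sum.inl) (x ∘ Sum.inr) hD.isHermitian
    rw [← hblocks, Sum.elim_comp_inl_inr, ← hsymm] at h1
    have h2 := hS.dotProduct_mulVec_nonneg (x ∘ Sum.inl)
    have h3 : (fun k => x (Sum.inr k) + ∑ i, (Q.toBlocks₂₂⁻¹ * Q.toBlocks₂₁) k i * x (Sum.inl i)) =
        (Q.toBlocks₂₂⁻¹ * Q.toBlocks₂₁) *ᵥ (x ∘ Sum.inl) + x ∘ Sum.inr := by
      ext k
      simp [Matrix.mulVec, dotProduct, add_comm]
    rw [h3]
    rw [← hsymm] at h2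
    simp only [star_trivial] at h1 h2
    simp only [Matrix.dotProduct_mulVec] at h2 ⊢
    rw [h1]
    exact le_add_of_nonneg_right h2
  rw [hermForm_eq_re_add_im, hermForm_eq_re_add_im Q]
  have e1 := hreal fun a => (ξ a).re
  have e2 := hreal fun a => (ξ a).im
  simpa using add_le_add e1 e2

end Fiber

/-! ### Coercivity inside a horn -/

section Pieces

variable {r₁ r₂ : ℕ} {α : Fin r₁ → Fin r₁ → Fin r₂ → Fin r₂ → ℝ}

/-- The quartic form together with a linear weight. -/
def weight (α : Fin r₁ → Fin r₁ → Fin r₂ → Fin r₂ → ℝ)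
    (q : EuclideanSpace ℝ (Fin r₁ ⊕ Fin r₂)) : ℝ :=
  quartic α (fstPart q) (sndPart q) + ‖q‖

theorem polyBounded_potential (α : Fin r₁ → Fin r₁ → Fin r₂ → Fin r₂ → ℝ) (L₁ : Fin r₁ → ℝ)
    (L₂ : Fin r₂ → ℝ) : PolyBounded (potential α L₁ L₂) :=
  polyBounded_of_temperate (potential_hasTemperateGrowth α L₁ L₂)

theorem polyBounded_weight (α : Fin r₁ → Fin r₁ → Fin r₂ → Fin r₂ → ℝ) :
    PolyBounded (weight α) := by
  have h : PolyBounded (potential α 0 0) := polyBounded_potential α 0 0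
  have h2 := h.add (PolyBounded.norm (E := EuclideanSpace ℝ (Fin r₁ ⊕ Fin r₂)))
  have h3 : weight α = fun q => potential α 0 0 q + ‖q‖ := by
    ext q
    simp [potential, weight, fstPart, sndPart]
  rw [h3]
  exact h2

theorem potential_eq (α : Fin r₁ → Fin r₁ → Fin r₂ → Fin r₂ → ℝ) (L₁ : Fin r₁ → ℝ)
    (L₂ : Fin r₂ → ℝ) (q : EuclideanSpace ℝ (Fin r₁ ⊕ Fin r₂)) :
    potential α L₁ L₂ q = quartic α (fstPart q) (sndPart q) + ∑ i, L₁ i * fstPart q i +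
      ∑ k, L₂ k * sndPart q k := rfl

theorem abs_sum_mul_le {n : ℕ} (L : Fin n → ℝ) (x : EuclideanSpace ℝ (Fin n)) :
    |∑ i, L i * x i| ≤ (∑ i, |L i|) * ‖x‖ := by
  refine (Finset.abs_sum_le_sum_abs _ _).trans ?_
  rw [Finset.sum_mul]
  refine Finset.sum_le_sum fun i _ => ?_
  rw [abs_mul]
  exact mul_le_mul_of_nonneg_left (by simpa using PiLp.norm_apply_le x i) (abs_nonneg _)

/-- Collects every error caused by the shear and by the second linear term; these stay bounded where
`y` does. -/
theorem exists_shift_bound (α : Fin r₁ → Fin r₁ → Fin r₂ → Fin r₂ → ℝ)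
    (B : Matrix (Fin r₂) (Fin r₁) ℝ) (L₁ : Fin r₁ → ℝ) (L₂ : Fin r₂ → ℝ) (σ : ℝ) :
    ∃ C : ℝ, ∀ y : EuclideanSpace ℝ (Fin r₂), ‖y‖ ≤ 2 →
      σ⁻¹ * quartic α (fiberShift B y) y + |∑ i, L₁ i * fiberShift B y i| + |∑ k, L₂ k * y k|
        + (‖fiberShift B y‖ + ‖y‖) ≤ C := by
  set S := LinearMap.toContinuousLinearMap (fiberShift B)
  have hq : Continuous fun y : EuclideanSpace ℝ (Fin r₂) => quartic α (S y) y :=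
    (continuous_quartic α).comp (f := fun y => (S y, y)) (by fun_prop)
  have hL : ∀ {n : ℕ} (L : Fin n → ℝ), Continuous fun x : EuclideanSpace ℝ (Fin n) =>
      |∑ i, L i * x i| := fun L => by fun_prop
  have hS : Continuous fun y => S y := S.continuous
  have hc : Continuous fun y : EuclideanSpace ℝ (Fin r₂) =>
      σ⁻¹ * quartic α (S y) y + |∑ i, L₁ i * S y i| + |∑ k, L₂ k * y k| + (‖S y‖ + ‖y‖) :=
    (((hq.const_mul _).add ((hL L₁).comp hS)).add (hL L₂)).add (hS.norm.add continuous_norm)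
  obtain ⟨C, hC⟩ := (isCompact_closedBall (0 : EuclideanSpace ℝ (Fin r₂)) 2).bddAbove_image
    hc.continuousOn
  exact ⟨C, fun y hy => hC ⟨y, by simpa using hy, rfl⟩⟩

set_option maxHeartbeats 1000000 in
/-- Coercivity in the region where the second variable is bounded. -/
theorem coercive_of_sndPart_le {Q : Matrix (Fin r₁ ⊕ Fin r₂) (Fin r₁ ⊕ Fin r₂) ℝ} (hQ : Q.PosDef)
    {L₁ : Fin r₁ → ℝ} (L₂ : Fin r₂ → ℝ)
    (hpos : ∀ (x : Fin r₁ → ℝ) (y : Fin r₂ → ℝ), x ≠ 0 → y ≠ 0 → 0 < quartic α x y)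
    (h0 : ∀ x y, 0 ≤ quartic α x y)
    (h : ∀ x : Fin r₁ → ℝ, x ≠ 0 →
      OperatorGT (schrodinger Q.toBlocks₂₂ (fun y => quartic α x y)) (∑ i, L₁ i * x i)) :
    ∃ δ C : ℝ, 0 < δ ∧ δ ≤ 1 ∧ ∀ φ : 𝓢(EuclideanSpace ℝ (Fin r₁ ⊕ Fin r₂), ℂ),
      (∀ q, 2 < ‖sndPart q‖ → φ q = 0) →
      δ * energy Q (weight α) φ ≤ energy Q (potential α L₁ L₂) φ + C * ∫ q, ‖φ q‖ ^ 2 := by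
  have hD : Q.toBlocks₂₂.PosDef := hQ.submatrix Sum.inr_injective
  obtain ⟨ε, hε, ht⟩ := exists_uniform_transverse hD.posSemidef hpos h0 h
  set K := ∑ i, |L₁ i| with hK
  have hK0 : 0 ≤ K := Finset.sum_nonneg fun i _ => abs_nonneg _
  -- Only the fraction `ρ` of the transverse energy is spent on the linear term: since `|L₁·x| ≤ K
  -- ‖x‖`, it still leaves a surplus `ε / 2 * ‖x‖`.
  set ρ := (K + ε / 2) / (K + ε) with hρ
  have hρ0 : 0 ≤ ρ := by positivity
  have hρ1 : ρ < 1 := by rw [hρ, div_lt_one (by positivity)]; linarith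
  have hρK : ρ * (K + ε) = K + ε / 2 := by rw [hρ]; field_simp
  -- The remaining fraction is halved: one half pays for the shear in `quartic_add_ge`, the other
  -- for the coercivity constant, because `(1 - δ) * (1 - σ) ≥ ρ` when `δ ≤ σ`.
  set σ := (1 - ρ) / 2 with hσ
  have hσ0 : 0 < σ := by linarith
  have hσ1 : σ ≤ 1 / 2 := by linarith
  set δ := min σ (ε / 2) with hδ
  have hδ0 : 0 < δ := lt_min hσ0 (by positivity)
  have hδσ : δ ≤ σ := min_le_left _ _
  have hδε : δ ≤ ε / 2 := min_le_right _ _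
  -- The mixed terms of `Q` rule out restricting to straight fibres; along the fibres sheared by `B`
  -- the kinetic energy is at least the transverse one.
  set B := Q.toBlocks₂₂⁻¹ * Q.toBlocks₂₁ with hB
  obtain ⟨C, hC⟩ : ∃ C : ℝ, ∀ y : EuclideanSpace ℝ (Fin r₂), ‖y‖ ≤ 2 →
      σ⁻¹ * quartic α (fiberShift B y) y + |∑ i, L₁ i * fiberShift B y i| + |∑ k, L₂ k * y k|
        + (‖fiberShift B y‖ + ‖y‖) ≤ C := by
    exact exists_shift_bound α B L₁ L₂ σ
  refine ⟨δ, C, hδ0, by linarith, fun φ hφ => ?_⟩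
  have hIw := integrable_energy Q (polyBounded_weight α) φ
  have hIp := integrable_energy Q (polyBounded_potential α L₁ L₂) φ
  have hIn := integrable_normSq φ
  have hI := (hIp.add (hIn.const_mul C)).sub (hIw.const_mul δ)
  have key := integral_nonneg_of_fibers (shear B).toContinuousLinearEquiv hI ?_
  · have e1 := integral_sub (hIp.add (hIn.const_mul C)) (hIw.const_mul δ)
    have e2 := integral_add hIp (hIn.const_mul C)
    have e3 := integral_const_mul (μ := volume) C (fun q => ‖φ q‖ ^ 2)
    have e4 := integral_const_mul (μ := volume) δ
      (fun q => hermForm Q (grad φ q) + weight α q * ‖φ q‖ ^ 2)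
    simp only [Pi.sub_apply, Pi.add_apply] at key e1 e2
    rw [e1, e2, e3, e4] at key
    unfold energy
    linarith
  intro x
  set T : EuclideanSpace ℝ (Fin r₂) →L[ℝ] EuclideanSpace ℝ (Fin r₁ ⊕ Fin r₂) :=
    ((shear B).toContinuousLinearEquiv : _ →L[ℝ] _).comp
      (ContinuousLinearMap.inr ℝ (EuclideanSpace ℝ (Fin r₁)) (EuclideanSpace ℝ (Fin r₂))) with hT
  have hTadd : ∀ y, T y + shear B (x, 0) = shear B (x, y) := fun y => by
    change shear B (0, y) + shear B (x, 0) = _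
    rw [← map_add]
    simp
  obtain ⟨ψ, hψ⟩ := exists_comp_affine T (fun a b hab => by
    have := (shear B).injective hab
    simpa using this) (shear B (x, 0)) φ
  have hψ' : ∀ y, ψ y = φ (shear B (x, y)) := fun y => by rw [hψ, hTadd]
  have hg : ∀ y, grad ψ y = fun k => grad φ (shear B (x, y)) (Sum.inr k) +
      ∑ i, (B k i : ℂ) * grad φ (shear B (x, y)) (Sum.inl i) := fun y => by
    ext k
    have h1 := grad_comp_affine T (shear B (x, 0)) φ y k
    have h2 : (fun y => φ (T y + shear B (x, 0))) = ψ := funext fun y => (hψ y).symm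
    rw [h2, hTadd] at h1
    rw [h1]
    have h3 : T (EuclideanSpace.single k 1) = shear B (0, EuclideanSpace.single k 1) := rfl
    rw [h3, shear_zero_single]
    simp [grad]
  set m := |∑ i, L₁ i * x i| with hm
  have hIψ := (integrable_energy Q.toBlocks₂₂ (polyBounded_of_temperate
    (quartic_hasTemperateGrowth₂ α x)) ψ).const_mul ρ
  have hIψn := (integrable_normSq ψ).const_mul (m + ε / 2 * ‖x‖)
  have hlow : 0 ≤ ∫ y, (ρ * (hermForm Q.toBlocks₂₂ (grad ψ y) + quartic α x y * ‖ψ y‖ ^ 2)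
      - (m + ε / 2 * ‖x‖) * ‖ψ y‖ ^ 2) := by
    rw [integral_sub hIψ hIψn, integral_const_mul, integral_const_mul]
    have h1 := mul_le_mul_of_nonneg_left (ht x ψ) hρ0
    have h2 : 0 ≤ ∫ y, ‖ψ y‖ ^ 2 := integral_nonneg fun y => by positivity
    have h3 : m ≤ K * ‖x‖ := abs_sum_mul_le L₁ x
    have h4 : m + ε / 2 * ‖x‖ ≤ ρ * (m + ε * ‖x‖) := by
      have h5 : ρ * (K * ‖x‖ + ε * ‖x‖) = K * ‖x‖ + ε / 2 * ‖x‖ := by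
        rw [← add_mul, ← mul_assoc, hρK]; ring
      have h6 : (1 - ρ) * m ≤ (1 - ρ) * (K * ‖x‖) := mul_le_mul_of_nonneg_left h3 (by linarith)
      linarith
    have h5 := mul_le_mul_of_nonneg_right h4 h2
    unfold energy at h1
    linarith
  -- On a fibre where the integrand is not integrable its integral is `0` by convention.
  by_cases hint : Integrable (fun y => (((fun q => hermForm Q (grad φ q) + potential α L₁ L₂ q * ‖φ q‖ ^ 2) +
      fun q => C * ‖φ q‖ ^ 2) - fun q => δ * (hermForm Q (grad φ q) + weight α q * ‖φ q‖ ^ 2))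
      ((shear B).toContinuousLinearEquiv (x, y)))
  swap
  · rw [integral_undef hint]
  refine hlow.trans (integral_mono (hIψ.sub hIψn) hint fun y => ?_)
  have e0 : (shear B).toContinuousLinearEquiv (x, y) = shear B (x, y) := rfl
  simp only [Pi.sub_apply, Pi.add_apply, e0]
  rw [hg, hψ']
  have hH := hermForm_ge_block hQ (grad φ (shear B (x, y)))
  have hH0 := hermForm_nonneg hD.posSemidef (fun k => grad φ (shear B (x, y)) (Sum.inr k) +
      ∑ i, (B k i : ℂ) * grad φ (shear B (x, y)) (Sum.inl i))
  rw [← hB] at hH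
  have hH1 : ρ * hermForm Q.toBlocks₂₂ (fun k => grad φ (shear B (x, y)) (Sum.inr k) +
      ∑ i, (B k i : ℂ) * grad φ (shear B (x, y)) (Sum.inl i)) ≤
      (1 - δ) * hermForm Q (grad φ (shear B (x, y))) :=
    mul_le_mul (by linarith) hH hH0 (by linarith)
  have hpot : ρ * quartic α x y * ‖φ (shear B (x, y))‖ ^ 2 ≤
      (potential α L₁ L₂ (shear B (x, y)) + C - δ * weight α (shear B (x, y))
        + (m + ε / 2 * ‖x‖)) * ‖φ (shear B (x, y))‖ ^ 2 := by
    by_cases hy : 2 < ‖y‖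
    · rw [hφ _ (by rwa [sndPart_shear])]
      simp
    · have hCy := hC y (not_lt.1 hy)
      refine mul_le_mul_of_nonneg_right ?_ (sq_nonneg _)
      rw [potential_eq, weight, fstPart_shear, sndPart_shear]
      have a1 := quartic_add_ge h0 hσ0 x (fiberShift B y) y
      have a2 : ∑ i, L₁ i * (x + fiberShift B y) i =
          ∑ i, L₁ i * x i + ∑ i, L₁ i * fiberShift B y i := by
        rw [← Finset.sum_add_distrib]
        exact Finset.sum_congr rfl fun i _ => by rw [PiLp.add_apply, mul_add]
      have a3 := neg_abs_le (∑ i, L₁ i * x i)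
      have a4 := neg_abs_le (∑ i, L₁ i * fiberShift B y i)
      have a5 := neg_abs_le (∑ k, L₂ k * y k)
      have a6 := norm_le_parts (shear B (x, y))
      rw [fstPart_shear, sndPart_shear] at a6
      have a7 := norm_add_le x (fiberShift B y)
      have a8 : δ * ‖shear B (x, y)‖ ≤ ε / 2 * ‖x‖ + (‖fiberShift B y‖ + ‖y‖) := by
        have b1 := mul_le_mul_of_nonneg_left (a6.trans (add_le_add_left a7 _)) hδ0.le
        have b2 := mul_le_mul_of_nonneg_right hδε (norm_nonneg x)
        have b3 : δ * (‖fiberShift B y‖ + ‖y‖) ≤ 1 * (‖fiberShift B y‖ + ‖y‖) :=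
          mul_le_mul_of_nonneg_right (by linarith) (by positivity)
        linarith
      have a9 := mul_le_mul_of_nonneg_left a1 (show 0 ≤ 1 - δ by linarith)
      have c1 : ρ * quartic α x y ≤ (1 - δ) * ((1 - σ) * quartic α x y) := by
        rw [← mul_assoc]
        refine mul_le_mul_of_nonneg_right ?_ (h0 _ _)
        have d1 : (1 - δ) * (1 - σ) = 1 - δ - σ + δ * σ := by ring
        have d2 : 0 ≤ δ * σ := by positivity
        linarith
      have c2 : (1 - δ) * (σ⁻¹ * quartic α (fiberShift B y) y) ≤
          1 * (σ⁻¹ * quartic α (fiberShift B y) y) :=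
        mul_le_mul_of_nonneg_right (by linarith) (mul_nonneg (by positivity) (h0 _ _))
      rw [a2]
      linarith
  linarith

end Pieces

/-! ### Quadratic partitions of unity and swapping coordinates -/

section Partition

variable {ι : Type} [Fintype ι]

/-- The cross terms carry the factor `c ∇c + s ∇s`, half the gradient of `c² + s² = 1`, and vanish.
-/
theorem hermForm_partition (A : Matrix ι ι ℝ) {c s : ℝ} (hcs : c ^ 2 + s ^ 2 = 1)
    {c' s' : ι → ℝ} (h : ∀ i, c * c' i + s * s' i = 0) (z : ℂ) (p : ι → ℂ) :
    hermForm A (fun i => (c : ℂ) * p i + c' i * z) + hermForm A (fun i => (s : ℂ) * p i + s' i * z) =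
      hermForm A p + (hermForm A (fun i => (c' i : ℂ)) + hermForm A (fun i => (s' i : ℂ))) * ‖z‖ ^ 2 := by
  rw [add_mul, mul_comm (hermForm A (fun i => (c' i : ℂ))), mul_comm (hermForm A (fun i => (s' i : ℂ))),
    ← hermForm_smul, ← hermForm_smul]
  simp only [hermForm, ← Finset.sum_add_distrib]
  refine Finset.sum_congr rfl fun i _ => Finset.sum_congr rfl fun j _ => ?_
  simp only [← mul_add, ← Complex.add_re]
  congr 2
  have h1 : (c : ℂ) ^ 2 + (s : ℂ) ^ 2 = 1 := by exact_mod_cast hcs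
  have h2 : ∀ i, (c : ℂ) * c' i + (s : ℂ) * s' i = 0 := fun i => by exact_mod_cast h i
  simp only [map_add, map_mul, Complex.conj_ofReal]
  linear_combination ((starRingEnd ℂ) (p i) * p j) * h1 + ((starRingEnd ℂ) (p i) * z) * h2 j
    + ((starRingEnd ℂ) z * p j) * h2 i

theorem exists_smul_schwartz {c : EuclideanSpace ℝ ι → ℝ} (hc : c.HasTemperateGrowth)
    (φ : 𝓢(EuclideanSpace ℝ ι, ℂ)) : ∃ ψ : 𝓢(EuclideanSpace ℝ ι, ℂ), ∀ x, ψ x = (c x : ℂ) * φ x := by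
  have hc' : (fun x => (c x : ℂ)).HasTemperateGrowth := by fun_prop
  exact ⟨SchwartzMap.smulLeftCLM ℂ (fun x => (c x : ℂ)) φ, fun x => by
    rw [SchwartzMap.smulLeftCLM_apply_apply hc', smul_eq_mul]⟩

variable [DecidableEq ι]

/-- The localization formula for a quadratic partition of unity. -/
theorem abs_energy_partition_le (A : Matrix ι ι ℝ) {W : EuclideanSpace ℝ ι → ℝ} (hW : PolyBounded W)
    {c s : EuclideanSpace ℝ ι → ℝ} (hc : Differentiable ℝ c) (hs : Differentiable ℝ s)
    (hcs : ∀ x, c x ^ 2 + s x ^ 2 = 1) {b : ℝ} (hcb : ∀ x v, ‖fderiv ℝ c x v‖ ≤ b * ‖v‖)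
    (hsb : ∀ x v, ‖fderiv ℝ s x v‖ ≤ b * ‖v‖) {φ φc φs : 𝓢(EuclideanSpace ℝ ι, ℂ)}
    (hφc : ∀ x, φc x = (c x : ℂ) * φ x) (hφs : ∀ x, φs x = (s x : ℂ) * φ x) :
    |energy A W φc + energy A W φs - energy A W φ| ≤
      2 * ((∑ i, ∑ j, |A i j|) * b ^ 2) * ∫ x, ‖φ x‖ ^ 2 := by
  have hIc := integrable_energy A hW φc
  have hIs := integrable_energy A hW φs
  have hI := integrable_energy A hW φ
  have hd : ∀ x v, c x * fderiv ℝ c x v + s x * fderiv ℝ s x v = 0 := fun x v => by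
    have h1 := ((hc x).hasFDerivAt.mul (hc x).hasFDerivAt).add ((hs x).hasFDerivAt.mul (hs x).hasFDerivAt)
    have h2 : (c * c + s * s) = fun _ => (1 : ℝ) := by
      ext y
      simpa [sq] using hcs y
    rw [h2] at h1
    have h3 := congrArg (fun T => T v) (h1.unique (hasFDerivAt_const (1 : ℝ) x))
    simp at h3
    linarith
  have hgc : ∀ x, grad φc x = fun i => (c x : ℂ) * grad φ x i +
      (fderiv ℝ c x (EuclideanSpace.single i 1) : ℝ) * φ x := fun x => funext fun i => by
    rw [← grad_ofReal_mul hc φ.differentiable]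
    exact congrArg (fun f => grad f x i) (funext hφc)
  have hgs : ∀ x, grad φs x = fun i => (s x : ℂ) * grad φ x i +
      (fderiv ℝ s x (EuclideanSpace.single i 1) : ℝ) * φ x := fun x => funext fun i => by
    rw [← grad_ofReal_mul hs φ.differentiable]
    exact congrArg (fun f => grad f x i) (funext hφs)
  have e : energy A W φc + energy A W φs - energy A W φ =
      ∫ x, ((hermForm A (grad φc x) + W x * ‖φc x‖ ^ 2) + (hermForm A (grad φs x) + W x * ‖φs x‖ ^ 2)
        - (hermForm A (grad φ x) + W x * ‖φ x‖ ^ 2)) := by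
    refine Eq.symm ((integral_sub (hIc.add hIs) hI).trans ?_)
    exact congrArg (· - _) (integral_add hIc hIs)
  rw [e, ← integral_const_mul]
  rw [← Real.norm_eq_abs]
  refine norm_integral_le_of_norm_le ((integrable_normSq φ).const_mul _)
    (Filter.Eventually.of_forall fun x => ?_)
  have h1 := hermForm_partition A (hcs x) (fun i => hd x (EuclideanSpace.single i 1)) (φ x) (grad φ x)
  have h2 : ‖φc x‖ ^ 2 + ‖φs x‖ ^ 2 = ‖φ x‖ ^ 2 := by
    rw [hφc, hφs, norm_mul, norm_mul, Complex.norm_real, Complex.norm_real, mul_pow, mul_pow,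
      Real.norm_eq_abs, Real.norm_eq_abs, sq_abs, sq_abs, ← add_mul, hcs, one_mul]
  have h3 : (hermForm A (grad φc x) + W x * ‖φc x‖ ^ 2) + (hermForm A (grad φs x) + W x * ‖φs x‖ ^ 2)
        - (hermForm A (grad φ x) + W x * ‖φ x‖ ^ 2) =
      (hermForm A (fun i => ((fderiv ℝ c x (EuclideanSpace.single i 1) : ℝ) : ℂ)) +
        hermForm A (fun i => ((fderiv ℝ s x (EuclideanSpace.single i 1) : ℝ) : ℂ))) * ‖φ x‖ ^ 2 := by
    rw [hgc, hgs]
    linear_combination h1 + W x * h2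
  rw [h3, norm_mul, Real.norm_eq_abs, norm_pow, norm_norm]
  refine mul_le_mul_of_nonneg_right ((abs_add_le _ _).trans ?_) (by positivity)
  rw [two_mul]
  refine add_le_add (abs_hermForm_le A _ b fun i => ?_) (abs_hermForm_le A _ b fun i => ?_)
  · rw [Complex.norm_real]; simpa using hcb x (EuclideanSpace.single i 1)
  · rw [Complex.norm_real]; simpa using hsb x (EuclideanSpace.single i 1)

/-- A smooth quadratic partition of unity subordinate to a ball and the complement of a smaller
one. -/
theorem exists_partition (ι : Type) [Fintype ι] : ∃ (c s : EuclideanSpace ℝ ι → ℝ) (b : ℝ),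
    c.HasTemperateGrowth ∧ s.HasTemperateGrowth ∧ (∀ x, c x ^ 2 + s x ^ 2 = 1) ∧
    (∀ x v, ‖fderiv ℝ c x v‖ ≤ b * ‖v‖) ∧ (∀ x v, ‖fderiv ℝ s x v‖ ≤ b * ‖v‖) ∧ 0 ≤ b ∧
    (∀ x, ‖x‖ ≤ 1 → c x = 0) ∧ (∀ x, 2 < ‖x‖ → s x = 0) := by
  obtain ⟨B, hB, hcut⟩ := exists_cutoff ι
  obtain ⟨χ, hχ, hχc, hχ1, hχ0, -, -, hχb⟩ := hcut 1 one_pos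
  -- Cosine and sine of `π / 2 * χ` have squares summing to one without a smooth square root.
  have hm : ContDiff ℝ (⊤ : ℕ∞) (fun x => Real.pi / 2 * χ x) := contDiff_const.mul hχ
  have hC : ContDiff ℝ (⊤ : ℕ∞) (fun x => Real.cos (Real.pi / 2 * χ x)) := Real.contDiff_cos.comp hm
  have hS : ContDiff ℝ (⊤ : ℕ∞) (fun x => Real.sin (Real.pi / 2 * χ x)) := Real.contDiff_sin.comp hm
  have hSs : HasCompactSupport (fun x => Real.sin (Real.pi / 2 * χ x)) :=
    hχc.mono fun x hx h => hx (by simp [h])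
  have hCs : HasCompactSupport (fun x => Real.cos (Real.pi / 2 * χ x) - 1) :=
    hχc.mono fun x hx h => hx (by simp [h])
  have hd : ∀ x, HasFDerivAt (fun x => Real.pi / 2 * χ x) ((Real.pi / 2) • fderiv ℝ χ x) x := fun x =>
    ((hχ.differentiable (by simp) x).hasFDerivAt).const_mul _
  have hb : ∀ (x v : EuclideanSpace ℝ ι) (t : ℝ), |t| ≤ 1 →
      ‖t * (Real.pi / 2 * fderiv ℝ χ x v)‖ ≤ Real.pi / 2 * B * ‖v‖ := fun x v t ht => by
    have h1 := hχb x v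
    rw [div_one] at h1
    rw [norm_mul, norm_mul, Real.norm_eq_abs, Real.norm_of_nonneg (by positivity : 0 ≤ Real.pi / 2)]
    calc |t| * (Real.pi / 2 * ‖fderiv ℝ χ x v‖) ≤ 1 * (Real.pi / 2 * (B * ‖v‖)) :=
          mul_le_mul ht (mul_le_mul_of_nonneg_left h1 (by positivity)) (by positivity) zero_le_one
      _ = _ := by ring
  refine ⟨fun x => Real.cos (Real.pi / 2 * χ x), fun x => Real.sin (Real.pi / 2 * χ x),
    Real.pi / 2 * B, ?_, hSs.hasTemperateGrowth hS, fun x => Real.cos_sq_add_sin_sq _, ?_, ?_,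
    by positivity, ?_, ?_⟩
  · have h1 := (hCs.hasTemperateGrowth (hC.sub contDiff_const)).add
      (Function.HasTemperateGrowth.const (1 : ℝ))
    refine cast (congrArg Function.HasTemperateGrowth (funext fun x => ?_)) h1
    simp
  · intro x v
    rw [(hd x).cos.fderiv]
    have := hb x v (-Real.sin (Real.pi / 2 * χ x)) (by rw [abs_neg]; exact Real.abs_sin_le_one _)
    simpa using this
  · intro x v
    rw [(hd x).sin.fderiv]
    have := hb x v (Real.cos (Real.pi / 2 * χ x)) (Real.abs_cos_le_one _)
    simpa using this
  · intro x hx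
    simp [hχ1 x hx]
  · intro x hx
    simp [hχ0 x (by linarith)]

/-- A permutation of coordinates is a measure-preserving isometry. It is used to exchange the two
blocks. -/
theorem energy_reindex {κ : Type} [Fintype κ] [DecidableEq κ] (e : ι ≃ κ) (A : Matrix κ κ ℝ)
    (φ : 𝓢(EuclideanSpace ℝ κ, ℂ)) :
    ∃ ψ : 𝓢(EuclideanSpace ℝ ι, ℂ),
      (∀ y, ψ y = φ (LinearIsometryEquiv.piLpCongrLeft 2 ℝ ℝ e y)) ∧
      ∫ y, ‖ψ y‖ ^ 2 = ∫ x, ‖φ x‖ ^ 2 ∧ ∀ W : EuclideanSpace ℝ κ → ℝ,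
      energy (A.submatrix e e) (fun y => W (LinearIsometryEquiv.piLpCongrLeft 2 ℝ ℝ e y)) ψ =
        energy A W φ := by
  set S := LinearIsometryEquiv.piLpCongrLeft 2 ℝ ℝ e with hS
  set T : EuclideanSpace ℝ ι →L[ℝ] EuclideanSpace ℝ κ := S.toContinuousLinearEquiv.toContinuousLinearMap
  have hT : ∀ y, T y + 0 = S y := fun y => add_zero _
  obtain ⟨ψ, hψ⟩ := exists_comp_affine T S.injective 0 φ
  have hψ' : ∀ y, ψ y = φ (S y) := fun y => by rw [hψ, hT]
  have hmp := S.measurePreserving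
  have hme : MeasurableEmbedding S := S.toHomeomorph.measurableEmbedding
  refine ⟨ψ, hψ', ?_, fun W => ?_⟩
  · simp_rw [hψ']
    exact hmp.integral_comp hme (fun x => ‖φ x‖ ^ 2)
  · rw [energy, energy, ← hmp.integral_comp hme]
    refine integral_congr_ae (Filter.Eventually.of_forall fun y => ?_)
    simp only [hψ']
    congr 1
    have hg : grad ψ y = fun i => grad φ (S y) (e i) := funext fun i => by
      have h1 := grad_comp_affine T 0 φ y i
      have h2 : (fun y => φ (T y + 0)) = ψ := funext fun y => (hψ y).symm
      rw [h2, hT] at h1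
      rw [h1]
      have h3 : T (EuclideanSpace.single i 1) = EuclideanSpace.single (e i) 1 :=
        LinearIsometryEquiv.piLpCongrLeft_single (𝕜 := ℝ) e i (1 : ℝ)
      rw [h3]
      rfl
    rw [hg]
    simp only [hermForm, Matrix.submatrix_apply]
    rw [← e.sum_comp]
    refine Finset.sum_congr rfl fun i _ => ?_
    rw [← e.sum_comp (fun j => A (e i) j * _)]

end Partition

/-! ### Gluing the regions: global coercivity -/

section Coercive

variable {r₁ r₂ : ℕ} {α : Fin r₁ → Fin r₁ → Fin r₂ → Fin r₂ → ℝ}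

/-- Coercivity of the energy of the model operator on functions that vanish outside a set. -/
def CoerciveOn (Q : Matrix (Fin r₁ ⊕ Fin r₂) (Fin r₁ ⊕ Fin r₂) ℝ)
    (α : Fin r₁ → Fin r₁ → Fin r₂ → Fin r₂ → ℝ) (L₁ : Fin r₁ → ℝ) (L₂ : Fin r₂ → ℝ)
    (S : Set (EuclideanSpace ℝ (Fin r₁ ⊕ Fin r₂))) : Prop :=
  ∃ δ C : ℝ, 0 < δ ∧ δ ≤ 1 ∧ ∀ φ : 𝓢(EuclideanSpace ℝ (Fin r₁ ⊕ Fin r₂), ℂ),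
    (∀ q, q ∉ S → φ q = 0) →
    δ * energy Q (weight α) φ ≤ energy Q (potential α L₁ L₂) φ + C * ∫ q, ‖φ q‖ ^ 2

theorem weight_nonneg (h0 : ∀ x y, 0 ≤ quartic α x y) (q : EuclideanSpace ℝ (Fin r₁ ⊕ Fin r₂)) :
    0 ≤ weight α q := add_nonneg (h0 _ _) (norm_nonneg _)

/-- Localization with a partition of unity in the variable `P q`. Its gradients are bounded, so the
error is a multiple of the `L²` norm and goes into the constant `C`. -/
theorem CoerciveOn.union {Q : Matrix (Fin r₁ ⊕ Fin r₂) (Fin r₁ ⊕ Fin r₂) ℝ} (hQ : Q.PosDef)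
    {L₁ : Fin r₁ → ℝ} {L₂ : Fin r₂ → ℝ} (h0 : ∀ x y, 0 ≤ quartic α x y)
    {S S₁ S₂ : Set (EuclideanSpace ℝ (Fin r₁ ⊕ Fin r₂))} (h₁ : CoerciveOn Q α L₁ L₂ S₁)
    (h₂ : CoerciveOn Q α L₁ L₂ S₂) {κ : Type} [Fintype κ]
    (P : EuclideanSpace ℝ (Fin r₁ ⊕ Fin r₂) →L[ℝ] EuclideanSpace ℝ κ)
    (hS₁ : ∀ q ∈ S, ‖P q‖ ≤ 2 → q ∈ S₁) (hS₂ : ∀ q ∈ S, 1 ≤ ‖P q‖ → q ∈ S₂) :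
    CoerciveOn Q α L₁ L₂ S := by
  obtain ⟨δ₁, C₁, hδ₁, hδ₁', h₁⟩ := h₁
  obtain ⟨δ₂, C₂, hδ₂, hδ₂', h₂⟩ := h₂
  obtain ⟨c, s, b, hc, hs, hcs, hcb, hsb, hb, hc0, hs0⟩ := exists_partition κ
  have hc' : (fun q => c (P q)).HasTemperateGrowth := hc.comp P.hasTemperateGrowth
  have hs' : (fun q => s (P q)).HasTemperateGrowth := hs.comp P.hasTemperateGrowth
  have hcd : Differentiable ℝ c := hc.1.differentiable (by simp)
  have hsd : Differentiable ℝ s := hs.1.differentiable (by simp)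
  have hbound : ∀ {f : EuclideanSpace ℝ κ → ℝ}, Differentiable ℝ f →
      (∀ x v, ‖fderiv ℝ f x v‖ ≤ b * ‖v‖) → ∀ x v,
      ‖fderiv ℝ (fun q => f (P q)) x v‖ ≤ b * ‖P‖ * ‖v‖ := fun {f} hf hfb x v => by
    have h := ((hf (P x)).hasFDerivAt.comp x P.hasFDerivAt)
    have h2 : fderiv ℝ (fun q => f (P q)) x = _ := h.fderiv
    rw [h2]
    refine (hfb _ _).trans ?_
    rw [mul_assoc]
    exact mul_le_mul_of_nonneg_left (P.le_opNorm v) hb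
  set D := 2 * ((∑ i, ∑ j, |Q i j|) * (b * ‖P‖) ^ 2) with hD
  have hD0 : 0 ≤ D := by positivity
  -- The localization error `D` is paid twice: for the energy with `potential`, and for the one with
  -- `weight`, where the factor `δ ≤ 1` is dropped.
  refine ⟨min δ₁ δ₂, max C₁ C₂ + 2 * D, lt_min hδ₁ hδ₂, (min_le_left _ _).trans hδ₁', fun φ hφ => ?_⟩
  obtain ⟨φc, hφc⟩ := exists_smul_schwartz hc' φ
  obtain ⟨φs, hφs⟩ := exists_smul_schwartz hs' φ
  have hpart : ∀ {W : EuclideanSpace ℝ (Fin r₁ ⊕ Fin r₂) → ℝ}, PolyBounded W →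
      |energy Q W φc + energy Q W φs - energy Q W φ| ≤ D * ∫ x, ‖φ x‖ ^ 2 := fun {W} hW =>
    abs_energy_partition_le Q hW (hcd.comp P.differentiable) (hsd.comp P.differentiable)
      (fun q => hcs (P q)) (hbound hcd hcb) (hbound hsd hsb) hφc hφs
  have hs1 := h₁ φs fun q hq => by
    rw [hφs]
    by_cases h : q ∈ S
    · rw [hs0 (P q) (not_le.1 fun h' => hq (hS₁ q h h'))]; simp
    · rw [hφ q h]; simp
  have hc1 := h₂ φc fun q hq => by
    rw [hφc]
    by_cases h : q ∈ S
    · rw [hc0 (P q) (not_le.1 fun h' => hq (hS₂ q h h')).le]; simp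
    · rw [hφ q h]; simp
  have hn : ∫ q, ‖φ q‖ ^ 2 = (∫ q, ‖φc q‖ ^ 2) + ∫ q, ‖φs q‖ ^ 2 := by
    rw [← integral_add (integrable_normSq φc) (integrable_normSq φs)]
    refine integral_congr_ae (Filter.Eventually.of_forall fun x => ?_)
    simp only
    rw [hφc, hφs, norm_mul, norm_mul, Complex.norm_real, Complex.norm_real, mul_pow, mul_pow,
      Real.norm_eq_abs, Real.norm_eq_abs, sq_abs, sq_abs, ← add_mul, hcs, one_mul]
  have hw := (abs_le.1 (hpart (polyBounded_weight α))).1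
  have hp := (abs_le.1 (hpart (polyBounded_potential α L₁ L₂))).2
  have hwc := energy_nonneg hQ.posSemidef (weight_nonneg h0) φc
  have hws := energy_nonneg hQ.posSemidef (weight_nonneg h0) φs
  have nc : 0 ≤ ∫ q, ‖φc q‖ ^ 2 := integral_nonneg fun y => by positivity
  have ns : 0 ≤ ∫ q, ‖φs q‖ ^ 2 := integral_nonneg fun y => by positivity
  have n0 : 0 ≤ ∫ q, ‖φ q‖ ^ 2 := integral_nonneg fun y => by positivity
  set δ := min δ₁ δ₂
  have hδ0 : 0 < δ := lt_min hδ₁ hδ₂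
  have hδ1 : δ ≤ 1 := (min_le_left _ _).trans hδ₁'
  have i1 := mul_le_mul_of_nonneg_right (min_le_left δ₁ δ₂) hws
  have i2 := mul_le_mul_of_nonneg_right (min_le_right δ₁ δ₂) hwc
  have i3 := mul_le_mul_of_nonneg_right (le_max_left C₁ C₂) ns
  have i4 := mul_le_mul_of_nonneg_right (le_max_right C₁ C₂) nc
  have i5 : δ * energy Q (weight α) φ ≤
      δ * (energy Q (weight α) φc + energy Q (weight α) φs + D * ∫ x, ‖φ x‖ ^ 2) :=
    mul_le_mul_of_nonneg_left (by linarith) hδ0.le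
  have i6 : δ * (D * ∫ x, ‖φ x‖ ^ 2) ≤ 1 * (D * ∫ x, ‖φ x‖ ^ 2) :=
    mul_le_mul_of_nonneg_right hδ1 (by positivity)
  have i7 : max C₁ C₂ * (∫ q, ‖φ q‖ ^ 2) = max C₁ C₂ * (∫ q, ‖φc q‖ ^ 2) +
      max C₁ C₂ * ∫ q, ‖φs q‖ ^ 2 := by rw [hn]; ring
  linarith

theorem coerciveOn_sndPart_le {Q : Matrix (Fin r₁ ⊕ Fin r₂) (Fin r₁ ⊕ Fin r₂) ℝ} (hQ : Q.PosDef)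
    {L₁ : Fin r₁ → ℝ} (L₂ : Fin r₂ → ℝ)
    (hpos : ∀ (x : Fin r₁ → ℝ) (y : Fin r₂ → ℝ), x ≠ 0 → y ≠ 0 → 0 < quartic α x y)
    (h0 : ∀ x y, 0 ≤ quartic α x y)
    (h : ∀ x : Fin r₁ → ℝ, x ≠ 0 →
      OperatorGT (schrodinger Q.toBlocks₂₂ (fun y => quartic α x y)) (∑ i, L₁ i * x i)) :
    CoerciveOn Q α L₁ L₂ {q | ‖sndPart q‖ ≤ 2} := by
  obtain ⟨δ, C, hδ, hδ1, h'⟩ := coercive_of_sndPart_le hQ L₂ hpos h0 h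
  exact ⟨δ, C, hδ, hδ1, fun φ hφ => h' φ fun q hq => hφ q (not_le.2 hq)⟩

theorem coerciveOn_fstPart_le {Q : Matrix (Fin r₁ ⊕ Fin r₂) (Fin r₁ ⊕ Fin r₂) ℝ} (hQ : Q.PosDef)
    (L₁ : Fin r₁ → ℝ) {L₂ : Fin r₂ → ℝ}
    (hpos : ∀ (x : Fin r₁ → ℝ) (y : Fin r₂ → ℝ), x ≠ 0 → y ≠ 0 → 0 < quartic α x y)
    (h0 : ∀ x y, 0 ≤ quartic α x y)
    (h : ∀ y : Fin r₂ → ℝ, y ≠ 0 →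
      OperatorGT (schrodinger Q.toBlocks₁₁ (fun x => quartic α x y)) (∑ k, L₂ k * y k)) :
    CoerciveOn Q α L₁ L₂ {q | ‖fstPart q‖ ≤ 2} := by
  set e := Equiv.sumComm (Fin r₂) (Fin r₁)
  have hQ' : (Q.submatrix e e).PosDef := hQ.submatrix e.injective
  obtain ⟨δ, C, hδ, hδ1, h'⟩ := coerciveOn_sndPart_le (α := fun k l i j => α i j k l) hQ'
    (L₁ := L₂) L₁ (fun y x hy hx => by rw [quartic_swap]; exact hpos x y hx hy)
    (fun y x => by rw [quartic_swap]; exact h0 x y)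
    (fun y hy => by simp only [quartic_swap]; exact h y hy)
  refine ⟨δ, C, hδ, hδ1, fun φ hφ => ?_⟩
  obtain ⟨ψ, hψ, hn, hE⟩ := energy_reindex e Q φ
  have hf : ∀ q, fstPart (LinearIsometryEquiv.piLpCongrLeft 2 ℝ ℝ e q) = sndPart q := fun q => rfl
  have hs : ∀ q, sndPart (LinearIsometryEquiv.piLpCongrLeft 2 ℝ ℝ e q) = fstPart q := fun q => rfl
  have h2 := h' ψ fun q hq => by
    rw [hψ]
    refine hφ _ fun h3 => hq ?_
    have h4 : ‖fstPart (LinearIsometryEquiv.piLpCongrLeft 2 ℝ ℝ e q)‖ ≤ 2 := h3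
    rwa [hf] at h4
  have ew : weight (fun k l i j => α i j k l) =
      fun q => weight α (LinearIsometryEquiv.piLpCongrLeft 2 ℝ ℝ e q) := funext fun q => by
    rw [weight, weight, hf, hs, quartic_swap, LinearIsometryEquiv.norm_map]
  have ep : potential (fun k l i j => α i j k l) L₂ L₁ =
      fun q => potential α L₁ L₂ (LinearIsometryEquiv.piLpCongrLeft 2 ℝ ℝ e q) := funext fun q => by
    rw [potential_eq, potential_eq, hf, hs, quartic_swap]
    ring
  rwa [ew, ep, hE, hE, hn] at h2

/-- When both parts have norm at least one, `‖q₁‖² ‖q₂‖² ≥ ‖q‖² / 2`, so the quartic grows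
quadratically and beats the linear terms pointwise. Completing the square gives the constant `K² /
c`. -/
theorem coerciveOn_parts_ge {Q : Matrix (Fin r₁ ⊕ Fin r₂) (Fin r₁ ⊕ Fin r₂) ℝ} (hQ : Q.PosDef)
    (L₁ : Fin r₁ → ℝ) (L₂ : Fin r₂ → ℝ)
    (hpos : ∀ (x : Fin r₁ → ℝ) (y : Fin r₂ → ℝ), x ≠ 0 → y ≠ 0 → 0 < quartic α x y) :
    CoerciveOn Q α L₁ L₂ {q | 1 ≤ ‖fstPart q‖ ∧ 1 ≤ ‖sndPart q‖} := by
  obtain ⟨c, M, hc, hM, hb⟩ := quartic_bounds hpos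
  set K := (∑ i, |L₁ i|) + (∑ k, |L₂ k|) + 1 with hK
  refine ⟨1 / 2, K ^ 2 / c, by norm_num, by norm_num, fun φ hφ => ?_⟩
  have hIw := (integrable_energy Q (polyBounded_weight α) φ).const_mul (1 / 2)
  have hIp := integrable_energy Q (polyBounded_potential α L₁ L₂) φ
  have hIn := (integrable_normSq φ).const_mul (K ^ 2 / c)
  rw [energy, energy, ← integral_const_mul, ← integral_const_mul]
  refine (integral_mono hIw (hIp.add hIn) fun q => ?_).trans (integral_add hIp hIn).le
  simp only [Pi.add_apply]
  have hH := hermForm_nonneg hQ.posSemidef (grad φ q)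
  by_cases hq : 1 ≤ ‖fstPart q‖ ∧ 1 ≤ ‖sndPart q‖
  swap
  · rw [hφ q hq]
    simp only [norm_zero, ne_eq, OfNat.ofNat_ne_zero, not_false_eq_true, zero_pow, mul_zero]
    linarith
  have key : 1 / 2 * weight α q ≤ potential α L₁ L₂ q + K ^ 2 / c := by
    obtain ⟨h1, h2⟩ := hq
    have h3 := (hb (fstPart q) (sndPart q)).1
    have h4 := norm_sq_parts q
    have g1 : 1 ≤ ‖fstPart q‖ ^ 2 := one_le_pow₀ h1
    have g2 : 1 ≤ ‖sndPart q‖ ^ 2 := one_le_pow₀ h2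
    have g3 : ‖q‖ ^ 2 / 2 ≤ ‖fstPart q‖ ^ 2 * ‖sndPart q‖ ^ 2 := by
      rw [h4]; nlinarith
    have g4 := mul_le_mul_of_nonneg_left g3 hc.le
    have n1 : ‖fstPart q‖ ≤ ‖q‖ := by
      refine abs_le_of_sq_le_sq' ?_ (norm_nonneg _) |>.2
      nlinarith
    have n2 : ‖sndPart q‖ ≤ ‖q‖ := by
      refine abs_le_of_sq_le_sq' ?_ (norm_nonneg _) |>.2
      nlinarith
    have a1 := (neg_abs_le (∑ i, L₁ i * fstPart q i))
    have a2 := (neg_abs_le (∑ k, L₂ k * sndPart q k))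
    have a3 := (abs_sum_mul_le L₁ (fstPart q)).trans
      (mul_le_mul_of_nonneg_left n1 (Finset.sum_nonneg fun i _ => abs_nonneg _))
    have a4 := (abs_sum_mul_le L₂ (sndPart q)).trans
      (mul_le_mul_of_nonneg_left n2 (Finset.sum_nonneg fun i _ => abs_nonneg _))
    have a5 : K * ‖q‖ ≤ c / 4 * ‖q‖ ^ 2 + K ^ 2 / c := by
      have : c / 4 * ‖q‖ ^ 2 + K ^ 2 / c - K * ‖q‖ = (c * ‖q‖ / 2 - K) ^ 2 / c := by
        field_simp
        ring
      have h5 : 0 ≤ (c * ‖q‖ / 2 - K) ^ 2 / c := by positivity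
      linarith
    have a6 : K * ‖q‖ = (∑ i, |L₁ i|) * ‖q‖ + (∑ k, |L₂ k|) * ‖q‖ + ‖q‖ := by rw [hK]; ring
    have a7 := norm_nonneg q
    rw [weight, potential_eq]
    linarith
  have := mul_le_mul_of_nonneg_right key (sq_nonneg ‖φ q‖)
  linarith

/-- The energy of the model operator controls the kinetic energy, the quartic potential and a
linear weight. -/
theorem coerciveOn_univ {Q : Matrix (Fin r₁ ⊕ Fin r₂) (Fin r₁ ⊕ Fin r₂) ℝ} {L₁ : Fin r₁ → ℝ}
    {L₂ : Fin r₂ → ℝ} (hP : Admissible Q α L₁ L₂)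
    (hpos : ∀ (x : Fin r₁ → ℝ) (y : Fin r₂ → ℝ), x ≠ 0 → y ≠ 0 → 0 < quartic α x y) :
    CoerciveOn Q α L₁ L₂ Set.univ := by
  have hQ := hP.quadratic_pos
  have h0 := hP.quartic_nonneg
  let P₁ : EuclideanSpace ℝ (Fin r₁ ⊕ Fin r₂) →ₗ[ℝ] EuclideanSpace ℝ (Fin r₁) :=
    { toFun := fstPart, map_add' := fun _ _ => rfl, map_smul' := fun _ _ => rfl }
  let P₂ : EuclideanSpace ℝ (Fin r₁ ⊕ Fin r₂) →ₗ[ℝ] EuclideanSpace ℝ (Fin r₂) :=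
    { toFun := sndPart, map_add' := fun _ _ => rfl, map_smul' := fun _ _ => rfl }
  -- Cutting by `‖q₁‖` joins one horn to the region away from both subspaces; cutting by `‖q₂‖` then
  -- adds the other horn.
  have h1 : CoerciveOn Q α L₁ L₂ {q | 1 ≤ ‖sndPart q‖} :=
    (coerciveOn_fstPart_le hQ L₁ hpos h0 hP.transverse₂).union hQ h0
      (coerciveOn_parts_ge hQ L₁ L₂ hpos) (LinearMap.toContinuousLinearMap P₁)
      (fun q _ h => h) (fun q hq h => ⟨h, hq⟩)
  exact (coerciveOn_sndPart_le hQ L₂ hpos h0 hP.transverse₁).union hQ h0 h1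
    (LinearMap.toContinuousLinearMap P₂) (fun q _ h => h) (fun q _ h => h)

end Coercive

/-! ### Poincaré inequality on convex sets -/

section Poincare

variable {ι : Type} [Fintype ι]

theorem lintegral_comp_smul_add (G : EuclideanSpace ℝ ι → ℝ≥0∞) (hG : Measurable G) {s : ℝ}
    (hs : s ≠ 0) (c : EuclideanSpace ℝ ι) :
    ∫⁻ x, G (s • x + c) = ENNReal.ofReal |(s ^ Fintype.card ι)⁻¹| * ∫⁻ x, G x := by
  have h1 := Measure.map_addHaar_smul (volume : Measure (EuclideanSpace ℝ ι)) hs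
  have h2 : ∫⁻ x, G (s • x + c) =
      ∫⁻ z, G (z + c) ∂((volume : Measure (EuclideanSpace ℝ ι)).map (s • ·)) :=
    (lintegral_map (f := fun z => G (z + c)) (hG.comp (measurable_add_const c))
      (measurable_const_smul s)).symm
  rw [h2, h1, lintegral_smul_measure, lintegral_add_right_eq_self, finrank_euclideanSpace,
    smul_eq_mul]

/-- By convexity the contraction towards `y` maps `Q` into itself, and its Jacobian is at least
`2⁻ⁿ`. -/
theorem setLIntegral_segment_le {Q : Set (EuclideanSpace ℝ ι)} (hQ : Convex ℝ Q)
    (hm : MeasurableSet Q) {G : EuclideanSpace ℝ ι → ℝ≥0∞} (hG : Measurable G) {s : ℝ}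
    (hs : 1 / 2 ≤ s) (hs1 : s ≤ 1) {y : EuclideanSpace ℝ ι} (hy : y ∈ Q) :
    ∫⁻ x in Q, G (s • x + (1 - s) • y) ≤ 2 ^ Fintype.card ι * ∫⁻ x in Q, G x := by
  have hs0 : 0 < s := by linarith
  calc ∫⁻ x in Q, G (s • x + (1 - s) • y)
      = ∫⁻ x, Q.indicator (fun x => G (s • x + (1 - s) • y)) x := (lintegral_indicator hm _).symm
    _ ≤ ∫⁻ x, Q.indicator G (s • x + (1 - s) • y) := by
        refine lintegral_mono fun x => ?_
        by_cases hx : x ∈ Q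
        · have h1 : s • x + (1 - s) • y ∈ Q := hQ hx hy hs0.le (by linarith) (by ring)
          rw [Set.indicator_of_mem hx, Set.indicator_of_mem h1]
        · rw [Set.indicator_of_notMem hx]
          exact zero_le
    _ = ENNReal.ofReal |(s ^ Fintype.card ι)⁻¹| * ∫⁻ x in Q, G x := by
        rw [lintegral_comp_smul_add _ (hG.indicator hm) hs0.ne', lintegral_indicator hm]
    _ ≤ 2 ^ Fintype.card ι * ∫⁻ x in Q, G x := by
        refine mul_le_mul_left ?_ _
        rw [abs_of_pos (by positivity), ← inv_pow, ENNReal.ofReal_pow (by positivity)]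
        refine pow_le_pow_left' ?_ _
        rw [← ENNReal.ofReal_ofNat]
        refine ENNReal.ofReal_le_ofReal ?_
        rw [inv_le_comm₀ hs0 two_pos]
        linarith

/-- One of the weights `t`, `1 - t` is at least `1 / 2`; the substitution is made in the
corresponding variable, which avoids a singular Jacobian at either end. -/
theorem setLIntegral_segment_segment_le {Q : Set (EuclideanSpace ℝ ι)} (hQ : Convex ℝ Q)
    (hm : MeasurableSet Q) {G : EuclideanSpace ℝ ι → ℝ≥0∞} (hG : Measurable G) {t : ℝ}
    (ht : 0 ≤ t) (ht1 : t ≤ 1) :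
    ∫⁻ x in Q, ∫⁻ y in Q, G (t • x + (1 - t) • y) ≤
      2 ^ Fintype.card ι * (∫⁻ x in Q, G x) * volume Q := by
  rcases le_total (1 / 2) t with h | h
  · rw [lintegral_lintegral_swap]
    · rw [← setLIntegral_const]
      exact setLIntegral_mono' hm fun y hy => setLIntegral_segment_le hQ hm hG h ht1 hy
    · exact (hG.comp ((measurable_fst.const_smul t).add
        (measurable_snd.const_smul (1 - t)))).aemeasurable
  · rw [← setLIntegral_const]
    refine setLIntegral_mono' hm fun x hx => ?_
    have h1 := setLIntegral_segment_le hQ hm hG (s := 1 - t) (by linarith) (by linarith) hx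
    refine le_trans (le_of_eq ?_) h1
    refine lintegral_congr fun y => ?_
    rw [add_comm, sub_sub_cancel]

variable [DecidableEq ι]

/-- The squared norm of the gradient. -/
def gradSq (f : EuclideanSpace ℝ ι → ℂ) (x : EuclideanSpace ℝ ι) : ℝ := ∑ i, ‖grad f x i‖ ^ 2

theorem gradSq_nonneg (f : EuclideanSpace ℝ ι → ℂ) (x : EuclideanSpace ℝ ι) : 0 ≤ gradSq f x :=
  Finset.sum_nonneg fun _ _ => sq_nonneg _

theorem integrable_gradSq (φ : 𝓢(EuclideanSpace ℝ ι, ℂ)) : Integrable (gradSq φ) := by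
  refine integrable_finsetSum _ fun i _ => ?_
  exact integrable_normSq (∂_{EuclideanSpace.single i (1 : ℝ)} φ)

theorem continuous_gradSq (φ : 𝓢(EuclideanSpace ℝ ι, ℂ)) : Continuous (gradSq φ) := by
  refine continuous_finsetSum _ fun i _ => ?_
  exact ((∂_{EuclideanSpace.single i (1 : ℝ)} φ : 𝓢(EuclideanSpace ℝ ι, ℂ)).continuous.norm.pow 2)

theorem norm_fderiv_sq_le (f : EuclideanSpace ℝ ι → ℂ) (x v : EuclideanSpace ℝ ι) :
    ‖fderiv ℝ f x v‖ ^ 2 ≤ ‖v‖ ^ 2 * gradSq f x := by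
  have h1 : fderiv ℝ f x v = ∑ i, v i • grad f x i := by
    have h2 : v = ∑ i, v i • EuclideanSpace.single i (1 : ℝ) := by
      ext j
      simp [Finset.sum_apply, Pi.single_apply]
    conv_lhs => rw [h2, map_sum]
    simp only [map_smul]
    rfl
  have h3 : ‖fderiv ℝ f x v‖ ≤ ∑ i, |v i| * ‖grad f x i‖ := by
    rw [h1]
    refine (norm_sum_le _ _).trans (le_of_eq ?_)
    refine Finset.sum_congr rfl fun i _ => ?_
    rw [norm_smul, Real.norm_eq_abs]
  refine (pow_le_pow_left₀ (norm_nonneg _) h3 2).trans ((Finset.sum_mul_sq_le_sq_mul_sq _ _ _).trans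
    (le_of_eq ?_))
  rw [EuclideanSpace.norm_sq_eq]
  rfl

/-- Fundamental theorem of calculus along the segment, then Cauchy–Schwarz in `t`. -/
theorem enorm_sub_sq_le (φ : 𝓢(EuclideanSpace ℝ ι, ℂ)) (x y : EuclideanSpace ℝ ι) :
    ‖φ x - φ y‖ₑ ^ 2 ≤ ENNReal.ofReal (‖x - y‖ ^ 2) *
      ∫⁻ t in Set.Ioc (0 : ℝ) 1, ENNReal.ofReal (gradSq φ (t • x + (1 - t) • y)) := by
  set g : ℝ → ℂ := fun t => fderiv ℝ φ (t • x + (1 - t) • y) (x - y) with hg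
  have hγ : ∀ t : ℝ, HasDerivAt (fun t : ℝ => t • x + (1 - t) • y) (x - y) t := fun t => by
    refine (((hasDerivAt_id t).smul_const x).fun_add
      (((hasDerivAt_id t).const_sub 1).smul_const y)).congr_deriv ?_
    rw [one_smul, neg_smul, one_smul, sub_eq_add_neg]
  have hgc : Continuous g := by
    have h1 : Continuous (fderiv ℝ φ) := φ.smooth'.continuous_fderiv (by simp)
    exact (h1.comp (by fun_prop)).clm_apply continuous_const
  have hftc : φ x - φ y = ∫ t in Set.Ioc (0 : ℝ) 1, g t := by
    rw [← intervalIntegral.integral_of_le zero_le_one,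
      intervalIntegral.integral_eq_sub_of_hasDerivAt (f := fun t : ℝ => φ (t • x + (1 - t) • y))
        (fun t _ => (φ.hasFDerivAt _).comp_hasDerivAt t (hγ t)) (hgc.intervalIntegrable _ _)]
    simp
  have hcs := lintegral_mul_sq_le (volume.restrict (Set.Ioc (0 : ℝ) 1)) (a := fun t => ‖g t‖ₑ)
    (γ := fun _ => 1) hgc.enorm.aemeasurable aemeasurable_const (by simp)
  simp only [mul_one] at hcs
  rw [hftc]
  refine (pow_le_pow_left' (enorm_integral_le_lintegral_enorm _) 2).trans (hcs.trans ?_)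
  rw [← lintegral_const_mul' _ _ ENNReal.ofReal_ne_top]
  refine lintegral_mono fun t => ?_
  rw [← ofReal_norm, ← ENNReal.ofReal_pow (norm_nonneg _),
    ← ENNReal.ofReal_mul (by positivity)]
  exact ENNReal.ofReal_le_ofReal (norm_fderiv_sq_le _ _ _)

theorem lintegral_enorm_sub_sq_le {Q : Set (EuclideanSpace ℝ ι)} (hQ : Convex ℝ Q)
    (hm : MeasurableSet Q) {d : ℝ} (hd : ∀ x ∈ Q, ∀ y ∈ Q, ‖x - y‖ ^ 2 ≤ d)
    (φ : 𝓢(EuclideanSpace ℝ ι, ℂ)) :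
    ∫⁻ x in Q, ∫⁻ y in Q, ‖φ x - φ y‖ₑ ^ 2 ≤ ENNReal.ofReal d *
      (2 ^ Fintype.card ι * (∫⁻ x in Q, ENNReal.ofReal (gradSq φ x)) * volume Q) := by
  set G : EuclideanSpace ℝ ι → ℝ≥0∞ := fun x => ENNReal.ofReal (gradSq φ x) with hGdef
  have hG : Measurable G := (continuous_gradSq φ).measurable.ennreal_ofReal
  have hGm2 : Measurable fun p : EuclideanSpace ℝ ι × ℝ =>
      ∫⁻ y in Q, G (p.2 • p.1 + (1 - p.2) • y) := by
    refine Measurable.lintegral_prod_right' (f := fun p : (EuclideanSpace ℝ ι × ℝ) × EuclideanSpace ℝ ι =>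
      G (p.1.2 • p.1.1 + (1 - p.1.2) • p.2)) (hG.comp (by fun_prop))
  calc ∫⁻ x in Q, ∫⁻ y in Q, ‖φ x - φ y‖ₑ ^ 2
      ≤ ∫⁻ x in Q, ∫⁻ y in Q, ENNReal.ofReal d *
          ∫⁻ t in Set.Ioc (0 : ℝ) 1, G (t • x + (1 - t) • y) :=
        setLIntegral_mono' hm fun x hx => setLIntegral_mono' hm fun y hy =>
          (enorm_sub_sq_le φ x y).trans
            (mul_le_mul_left (ENNReal.ofReal_le_ofReal (hd x hx y hy)) _)
    _ = ENNReal.ofReal d * ∫⁻ x in Q, ∫⁻ y in Q, ∫⁻ t in Set.Ioc (0 : ℝ) 1,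
          G (t • x + (1 - t) • y) := by
        rw [← lintegral_const_mul' _ _ ENNReal.ofReal_ne_top]
        refine lintegral_congr fun x => ?_
        rw [lintegral_const_mul' _ _ ENNReal.ofReal_ne_top]
    _ = ENNReal.ofReal d * ∫⁻ t in Set.Ioc (0 : ℝ) 1, ∫⁻ x in Q, ∫⁻ y in Q,
          G (t • x + (1 - t) • y) := by
        congr 1
        have h1 : ∀ x, ∫⁻ y in Q, ∫⁻ t in Set.Ioc (0 : ℝ) 1, G (t • x + (1 - t) • y) =
            ∫⁻ t in Set.Ioc (0 : ℝ) 1, ∫⁻ y in Q, G (t • x + (1 - t) • y) := fun x =>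
          lintegral_lintegral_swap (hG.comp (by fun_prop)).aemeasurable
        simp_rw [h1]
        exact lintegral_lintegral_swap hGm2.aemeasurable
    _ ≤ ENNReal.ofReal d * ∫⁻ t in Set.Ioc (0 : ℝ) 1,
          (2 ^ Fintype.card ι * (∫⁻ x in Q, G x) * volume Q) := by
        refine mul_le_mul_right ?_ _
        exact setLIntegral_mono' measurableSet_Ioc fun t ht =>
          setLIntegral_segment_segment_le hQ hm hG ht.1.le ht.2
    _ = _ := by simp

/-- The Poincaré inequality on a bounded convex set. -/
theorem poincare {Q : Set (EuclideanSpace ℝ ι)} (hQ : Convex ℝ Q) (hm : MeasurableSet Q)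
    (hfin : volume Q ≠ ∞) {d : ℝ} (hd0 : 0 ≤ d) (hd : ∀ x ∈ Q, ∀ y ∈ Q, ‖x - y‖ ^ 2 ≤ d)
    (φ : 𝓢(EuclideanSpace ℝ ι, ℂ)) :
    volume.real Q * (∫ x in Q, ‖φ x‖ ^ 2) - ‖∫ x in Q, φ x‖ ^ 2 ≤
      d * 2 ^ Fintype.card ι * (∫ x in Q, gradSq φ x) * volume.real Q := by
  have hi : Integrable φ (volume.restrict Q) := φ.integrable.restrict
  have hi2 : Integrable (fun x => ‖φ x‖ ^ 2) (volume.restrict Q) := (integrable_normSq φ).restrict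
  have hig : Integrable (gradSq φ) (volume.restrict Q) := (integrable_gradSq φ).restrict
  have hf : IsFiniteMeasure (volume.restrict Q) := ⟨by simpa using hfin.lt_top⟩
  set I := ∫ x in Q, φ x with hI
  set A := ∫ x in Q, ‖φ x‖ ^ 2 with hA
  set v := volume.real Q with hv
  have hexp : ∀ a b : ℂ, ‖a - b‖ ^ 2 = ‖a‖ ^ 2 + ‖b‖ ^ 2 - 2 * ((starRingEnd ℂ) a * b).re := fun a b => by
    simp only [← Complex.normSq_eq_norm_sq, Complex.normSq_apply]
    simp
    ring
  have hii : ∀ x, Integrable (fun y => ((starRingEnd ℂ) (φ x) * φ y).re) (volume.restrict Q) :=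
    fun x => (hi.const_mul ((starRingEnd ℂ) (φ x))).re
  have hinner : ∀ x, ∫ y in Q, ‖φ x - φ y‖ ^ 2 =
      ‖φ x‖ ^ 2 * v + A - 2 * ((starRingEnd ℂ) (φ x) * I).re := fun x => by
    simp_rw [hexp]
    have e1 : ∫ y in Q, ((starRingEnd ℂ) (φ x) * φ y).re = ((starRingEnd ℂ) (φ x) * I).re := by
      rw [hI, ← integral_const_mul]
      exact integral_re (hi.const_mul ((starRingEnd ℂ) (φ x)))
    have i1 : Integrable (fun y => ‖φ x‖ ^ 2 + ‖φ y‖ ^ 2) (volume.restrict Q) :=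
      (integrable_const _).add hi2
    rw [integral_sub i1 ((hii x).const_mul 2),
      integral_add (integrable_const _) hi2, integral_const_mul, e1, integral_const]
    simp only [hv, measureReal_def, Measure.restrict_apply_univ, smul_eq_mul, mul_comm]
    rw [hA]
  have hintx : ∀ x, Integrable (fun y => ‖φ x - φ y‖ ^ 2) (volume.restrict Q) := fun x => by
    simp_rw [hexp]
    exact ((integrable_const _).add hi2).sub ((hii x).const_mul 2)
  have hio : Integrable (fun x => ((starRingEnd ℂ) (φ x) * I).re) (volume.restrict Q) := by
    have h1 : Integrable (fun x => (starRingEnd ℂ) (φ x)) (volume.restrict Q) :=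
      (Complex.conjCLE : ℂ →L[ℝ] ℂ).integrable_comp hi
    exact (h1.mul_const I).re
  have hintt : Integrable (fun x => ∫ y in Q, ‖φ x - φ y‖ ^ 2) (volume.restrict Q) := by
    simp_rw [hinner]
    exact ((hi2.mul_const v).add (integrable_const A)).sub (hio.const_mul 2)
  -- The variance identity: the mean square difference over pairs is twice the left-hand side of the
  -- claim.
  have htotal : ∫ x in Q, ∫ y in Q, ‖φ x - φ y‖ ^ 2 = 2 * (v * A - ‖I‖ ^ 2) := by
    simp_rw [hinner]
    have e1 : ∫ x in Q, ((starRingEnd ℂ) (φ x) * I).re = ‖I‖ ^ 2 := by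
      have h1 : Integrable (fun x => (starRingEnd ℂ) (φ x)) (volume.restrict Q) :=
        (Complex.conjCLE : ℂ →L[ℝ] ℂ).integrable_comp hi
      have h2 : ∫ x in Q, (starRingEnd ℂ) (φ x) = (starRingEnd ℂ) I := integral_conj
      have h3 := integral_re (𝕜 := ℂ) (h1.mul_const I)
      rw [integral_mul_const, h2, ← Complex.normSq_eq_conj_mul_self] at h3
      refine h3.trans ?_
      rw [Complex.normSq_eq_norm_sq]
      exact Complex.ofReal_re _
    have i1 : Integrable (fun x => ‖φ x‖ ^ 2 * v + A) (volume.restrict Q) :=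
      (hi2.mul_const v).add (integrable_const A)
    rw [integral_sub i1 (hio.const_mul 2),
      integral_add (hi2.mul_const v) (integrable_const A), integral_const_mul, e1, integral_mul_const,
      integral_const]
    simp [measureReal_def, hv, hA]
    ring
  have hen : ∫⁻ x in Q, ∫⁻ y in Q, ‖φ x - φ y‖ₑ ^ 2 = ENNReal.ofReal (2 * (v * A - ‖I‖ ^ 2)) := by
    rw [← htotal, ofReal_integral_eq_lintegral_ofReal hintt
      (Filter.Eventually.of_forall fun x => integral_nonneg fun y => by positivity)]
    refine lintegral_congr fun x => ?_
    rw [ofReal_integral_eq_lintegral_ofReal (hintx x)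
      (Filter.Eventually.of_forall fun x => by positivity)]
    refine lintegral_congr fun y => ?_
    rw [← ofReal_norm, ENNReal.ofReal_pow (norm_nonneg _)]
  have hfinal := lintegral_enorm_sub_sq_le hQ hm hd φ
  have hg0 : 0 ≤ ∫ x in Q, gradSq φ x := integral_nonneg fun x => gradSq_nonneg φ x
  have hv0 : 0 ≤ v := measureReal_nonneg
  rw [hen, ← ofReal_integral_eq_lintegral_ofReal hig
    (Filter.Eventually.of_forall fun x => gradSq_nonneg φ x),
    show volume Q = ENNReal.ofReal v from (ENNReal.ofReal_toReal hfin).symm,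
    show (2 : ℝ≥0∞) ^ Fintype.card ι = ENNReal.ofReal (2 ^ Fintype.card ι) by
      rw [ENNReal.ofReal_pow zero_le_two, ENNReal.ofReal_ofNat],
    ← ENNReal.ofReal_mul (by positivity), ← ENNReal.ofReal_mul (by positivity),
    ← ENNReal.ofReal_mul (by positivity),
    ENNReal.ofReal_le_ofReal_iff (by positivity)] at hfinal
  have h5 : 0 ≤ d * 2 ^ Fintype.card ι * (∫ x in Q, gradSq φ x) * v := by positivity
  linarith

end Poincare

/-! ### Form bounds from a covering by cubes -/

section Cells

variable {ι : Type}

/-- The half-open cubes of side `h` in a lattice. -/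
def cube (h : ℝ) (m : ι → ℤ) : Set (EuclideanSpace ℝ ι) :=
  {x | ∀ i, h * m i ≤ x i ∧ x i < h * (m i + 1)}

theorem convex_cube (h : ℝ) (m : ι → ℤ) : Convex ℝ (cube h m) := by
  have : cube h m = ⋂ i, (EuclideanSpace.proj i : EuclideanSpace ℝ ι →L[ℝ] ℝ) ⁻¹'
      Set.Ico (h * m i) (h * (m i + 1)) := by
    ext x
    simp [cube]
  rw [this]
  exact convex_iInter fun i => (convex_Ico _ _).linear_preimage
    (EuclideanSpace.proj i : EuclideanSpace ℝ ι →L[ℝ] ℝ).toLinearMap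

theorem mem_cube_floor {h : ℝ} (hh : 0 < h) (x : EuclideanSpace ℝ ι) :
    x ∈ cube h (fun i => ⌊x i / h⌋) := fun i => by
  have h1 := Int.floor_le (x i / h)
  have h2 := Int.lt_floor_add_one (x i / h)
  rw [le_div_iff₀ hh] at h1
  rw [div_lt_iff₀ hh] at h2
  constructor <;> linarith

theorem pairwise_disjoint_cube {h : ℝ} (hh : 0 < h) :
    Pairwise (Function.onFun Disjoint (cube h : (ι → ℤ) → Set (EuclideanSpace ℝ ι))) := by
  intro m m' hmm
  refine Set.disjoint_left.2 fun x hx hx' => hmm (funext fun i => ?_)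
  have key : ∀ {a b : ℤ}, h * a ≤ x i → x i < h * (b + 1) → a ≤ b := fun {a b} h1 h2 => by
    have h3 : (a : ℝ) < b + 1 := lt_of_mul_lt_mul_left (h1.trans_lt h2) hh.le
    exact Int.lt_add_one_iff.1 (by exact_mod_cast h3)
  exact le_antisymm (key (hx i).1 (hx' i).2) (key (hx' i).1 (hx i).2)

variable [Fintype ι]

theorem measurableSet_cube (h : ℝ) (m : ι → ℤ) : MeasurableSet (cube h m) := by
  have : cube h m = ⋂ i, (EuclideanSpace.proj i : EuclideanSpace ℝ ι →L[ℝ] ℝ) ⁻¹'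
      Set.Ico (h * m i) (h * (m i + 1)) := by
    ext x
    simp [cube]
  rw [this]
  exact MeasurableSet.iInter fun i =>
    measurableSet_Ico.preimage (EuclideanSpace.proj i : EuclideanSpace ℝ ι →L[ℝ] ℝ).continuous.measurable

theorem norm_sub_sq_le_of_mem_cube {h : ℝ} {m : ι → ℤ} {x y : EuclideanSpace ℝ ι}
    (hx : x ∈ cube h m) (hy : y ∈ cube h m) : ‖x - y‖ ^ 2 ≤ Fintype.card ι * h ^ 2 := by
  rw [EuclideanSpace.norm_sq_eq, ← nsmul_eq_mul, ← Finset.card_univ]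
  refine Finset.sum_le_card_nsmul _ _ _ fun i _ => ?_
  rw [Real.norm_eq_abs, sq_abs, PiLp.sub_apply]
  obtain ⟨h1, h2⟩ := hx i
  obtain ⟨h3, h4⟩ := hy i
  refine sq_le_sq' ?_ ?_ <;> linarith

theorem volume_cube_ne_top (h : ℝ) (m : ι → ℤ) : volume (cube h m) ≠ ∞ := by
  refine (Bornology.IsBounded.measure_lt_top (Metric.isBounded_iff.2
    ⟨Real.sqrt (Fintype.card ι * h ^ 2), fun x hx y hy => ?_⟩)).ne
  rw [dist_eq_norm]
  exact Real.le_sqrt_of_sq_le (norm_sub_sq_le_of_mem_cube hx hy)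

theorem exists_integral_functional {Q : Set (EuclideanSpace ℝ ι)} (hm : MeasurableSet Q)
    (hfin : volume Q ≠ ∞) : ∃ ℓ : L2 ι →L[ℂ] ℂ, ∀ φ : 𝓢(EuclideanSpace ℝ ι, ℂ),
      ℓ (incl ι φ) = ∫ x in Q, φ x := by
  refine ⟨innerSL ℂ (indicatorConstLp 2 hm hfin (1 : ℂ)), fun φ => ?_⟩
  rw [innerSL_apply_apply, L2.inner_indicatorConstLp_one]
  have h2 : incl ι φ =ᵐ[volume] φ := SchwartzMap.coeFn_toLp φ 2 volume
  exact integral_congr_ae (ae_restrict_of_ae h2)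

theorem FormBound.mono {T : 𝓢(EuclideanSpace ℝ ι, ℂ) →ₗ[ℂ] 𝓢(EuclideanSpace ℝ ι, ℂ)} {Λ Λ' : ℝ}
    {N N' : ℕ} (h : FormBound T Λ N) (hΛ : Λ' ≤ Λ) (hN : N ≤ N') : FormBound T Λ' N' := by
  obtain ⟨F, i1, i2, i3, ℓ, K, hf, hF⟩ := h
  refine ⟨F, i1, i2, i3, ℓ, K, hf.trans hN, fun φ => le_trans ?_ (hF φ)⟩
  have := mul_le_mul_of_nonneg_right hΛ (sq_nonneg ‖incl ι φ‖)
  linarith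

variable [DecidableEq ι]

/-- On a cell small enough for the level `X`, kinetic energy alone exceeds `X`, up to the mean value
of `φ`. -/
theorem poincare_cell {Q : Set (EuclideanSpace ℝ ι)} (hQ : Convex ℝ Q) (hm : MeasurableSet Q)
    (hfin : volume Q ≠ ∞) {d X κ : ℝ} (hd0 : 0 ≤ d) (hd : ∀ x ∈ Q, ∀ y ∈ Q, ‖x - y‖ ^ 2 ≤ d)
    (hX : 0 ≤ X) (hdX : d * 2 ^ Fintype.card ι * X ≤ κ) (φ : 𝓢(EuclideanSpace ℝ ι, ℂ)) :
    X * (∫ x in Q, ‖φ x‖ ^ 2) ≤ κ * (∫ x in Q, gradSq φ x) +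
      X * ((volume.real Q)⁻¹ * ‖∫ x in Q, φ x‖ ^ 2) := by
  have hg0 : 0 ≤ ∫ x in Q, gradSq φ x := integral_nonneg fun x => gradSq_nonneg φ x
  rcases eq_or_lt_of_le (measureReal_nonneg (μ := volume) (s := Q)) with hv | hv
  · have h0 : volume Q = 0 := by
      have := (ENNReal.toReal_eq_zero_iff _).1 hv.symm
      exact this.resolve_right hfin
    rw [← hv, Measure.restrict_eq_zero.2 h0]
    simp
  · have h1 := poincare hQ hm hfin hd0 hd φ
    set v := volume.real Q
    set A := ∫ x in Q, ‖φ x‖ ^ 2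
    set G := ∫ x in Q, gradSq φ x
    have h2 : A ≤ d * 2 ^ Fintype.card ι * G + v⁻¹ * ‖∫ x in Q, φ x‖ ^ 2 := by
      have h3 : v⁻¹ * (v * A) ≤ v⁻¹ * (d * 2 ^ Fintype.card ι * G * v + ‖∫ x in Q, φ x‖ ^ 2) :=
        mul_le_mul_of_nonneg_left (by linarith) (by positivity)
      have h4 : v⁻¹ * (v * A) = A := by field_simp
      have h5 : v⁻¹ * (d * 2 ^ Fintype.card ι * G * v + ‖∫ x in Q, φ x‖ ^ 2) =
          d * 2 ^ Fintype.card ι * G + v⁻¹ * ‖∫ x in Q, φ x‖ ^ 2 := by field_simp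
      linarith
    have h6 := mul_le_mul_of_nonneg_left h2 hX
    have h7 := mul_le_mul_of_nonneg_right hdX hg0
    linarith

/-- A lower bound on the quadratic form from a covering of the region where the weight is small by
small convex cells. -/
theorem formBound_of_cells {σ : Type}
    {T : 𝓢(EuclideanSpace ℝ ι, ℂ) →ₗ[ℂ] 𝓢(EuclideanSpace ℝ ι, ℂ)} {w : EuclideanSpace ℝ ι → ℝ}
    (hw : PolyBounded w) (hw0 : ∀ x, 0 ≤ w x) {κ δ C Λ X d : ℝ} (hκ : 0 ≤ κ) (hδ : 0 ≤ δ)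
    (hT : ∀ φ : 𝓢(EuclideanSpace ℝ ι, ℂ), δ * (∫ x, (κ * gradSq φ x + w x * ‖φ x‖ ^ 2)) ≤
      (inner ℂ (incl ι φ) (incl ι (T φ))).re + C * ‖incl ι φ‖ ^ 2)
    (hX : δ * X = Λ + C) (hX0 : 0 ≤ X) (cell : σ → Set (EuclideanSpace ℝ ι))
    (hconv : ∀ m, Convex ℝ (cell m)) (hmeas : ∀ m, MeasurableSet (cell m))
    (hfin : ∀ m, volume (cell m) ≠ ∞) (hdisj : Pairwise (Function.onFun Disjoint cell))
    (hd0 : 0 ≤ d) (hd : ∀ m, ∀ x ∈ cell m, ∀ y ∈ cell m, ‖x - y‖ ^ 2 ≤ d)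
    (hdX : d * 2 ^ Fintype.card ι * X ≤ κ) (S : Finset σ)
    (hcover : ∀ x, w x < X → ∃ m ∈ S, x ∈ cell m) : FormBound T Λ S.card := by
  choose ℓ hℓ using fun m => exists_integral_functional (hmeas m) (hfin m)
  set K := δ * (X * ∑ m ∈ S, (volume.real (cell m))⁻¹) with hK
  -- The functionals are the integrals over the cells in `S`, so their number is the number of cells
  -- needed to cover the region `w < X`.
  refine ⟨S → ℂ, inferInstance, inferInstance, inferInstance,
    ContinuousLinearMap.pi fun m : S => ℓ m, K, by simp, fun φ => ?_⟩
  set u := (ContinuousLinearMap.pi fun m : S => ℓ m) (incl ι φ) with hu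
  have hum : ∀ m ∈ S, ‖∫ x in cell m, φ x‖ ≤ ‖u‖ := fun m hm => by
    rw [← hℓ]
    exact norm_le_pi_norm u ⟨m, hm⟩
  set F : EuclideanSpace ℝ ι → ℝ := fun x => κ * gradSq φ x + w x * ‖φ x‖ ^ 2 - X * ‖φ x‖ ^ 2 with hF
  have hi1 := (integrable_gradSq φ).const_mul κ
  have hi2 := integrable_polyBounded_normSq hw φ
  have hi3 := (integrable_normSq φ).const_mul X
  have hi12 : Integrable (fun x => κ * gradSq φ x + w x * ‖φ x‖ ^ 2) := hi1.add hi2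
  have hFi : Integrable F := hi12.sub hi3
  have hmain : -(X * ∑ m ∈ S, (volume.real (cell m))⁻¹) * ‖u‖ ^ 2 ≤ ∫ x, F x := by
    set U := ⋃ m ∈ S, cell m with hU
    have hUm : MeasurableSet U := S.measurableSet_biUnion fun m _ => hmeas m
    rw [← integral_add_compl hUm hFi]
    -- Off the chosen cells the weight alone exceeds `X`; inside them it is discarded and Poincaré
    -- takes over.
    have h1 : 0 ≤ ∫ x in Uᶜ, F x := by
      refine setIntegral_nonneg hUm.compl fun x hx => ?_
      have h2 : X ≤ w x := by
        by_contra h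
        obtain ⟨m, hm, hxm⟩ := hcover x (not_le.1 h)
        exact hx (Set.mem_biUnion hm hxm)
      have h3 := mul_le_mul_of_nonneg_right h2 (sq_nonneg ‖φ x‖)
      have h4 := mul_nonneg hκ (gradSq_nonneg φ x)
      simp only [hF]
      linarith
    have h2 : ∫ x in U, F x = ∑ m ∈ S, ∫ x in cell m, F x :=
      integral_biUnion_finset S (fun m _ => hmeas m) (fun a _ b _ hab => hdisj hab)
        fun m _ => hFi.integrableOn
    have h3 : ∀ m ∈ S, -(X * (volume.real (cell m))⁻¹ * ‖u‖ ^ 2) ≤ ∫ x in cell m, F x := by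
      intro m hm
      have h4 := poincare_cell (hconv m) (hmeas m) (hfin m) hd0 (hd m) hX0 hdX φ
      have h5 : ∫ x in cell m, F x = κ * (∫ x in cell m, gradSq φ x) +
          (∫ x in cell m, w x * ‖φ x‖ ^ 2) - X * ∫ x in cell m, ‖φ x‖ ^ 2 := by
        rw [hF, integral_sub hi12.restrict hi3.restrict, integral_add hi1.restrict hi2.restrict,
          integral_const_mul, integral_const_mul]
      have h6 : 0 ≤ ∫ x in cell m, w x * ‖φ x‖ ^ 2 :=
        integral_nonneg fun x => mul_nonneg (hw0 x) (sq_nonneg _)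
      have h7 : X * ((volume.real (cell m))⁻¹ * ‖∫ x in cell m, φ x‖ ^ 2) ≤
          X * ((volume.real (cell m))⁻¹ * ‖u‖ ^ 2) := by
        have := pow_le_pow_left₀ (norm_nonneg _) (hum m hm) 2
        have hv : 0 ≤ (volume.real (cell m))⁻¹ := inv_nonneg.2 measureReal_nonneg
        gcongr
      rw [h5]
      linarith
    have h4 := Finset.sum_le_sum h3
    rw [h2]
    refine le_trans (le_of_eq ?_) (le_add_of_le_of_nonneg h4 h1)
    rw [Finset.sum_neg_distrib, ← Finset.sum_mul, ← Finset.mul_sum, neg_mul]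
  have hsplit : ∫ x, F x = (∫ x, (κ * gradSq φ x + w x * ‖φ x‖ ^ 2)) - X * ‖incl ι φ‖ ^ 2 := by
    rw [hF, integral_sub hi12 hi3, integral_const_mul, norm_incl_sq]
  have h1 := hT φ
  have h2 := mul_le_mul_of_nonneg_left hmain hδ
  rw [hsplit] at h2
  have h3 : δ * (X * ‖incl ι φ‖ ^ 2) = Λ * ‖incl ι φ‖ ^ 2 + C * ‖incl ι φ‖ ^ 2 := by
    rw [← mul_assoc, hX]; ring
  have h4 : K * ‖u‖ ^ 2 = -(δ * (-(X * ∑ m ∈ S, (volume.real (cell m))⁻¹) * ‖u‖ ^ 2)) := by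
    rw [hK]; ring
  rw [h4]
  linarith

end Cells

/-! ### Counting lattice points in the hyperbolic region -/

section Counting

/-- A union of boxes covering the lattice points near the coordinate subspaces. -/
def dyadicBoxes (r Y : ℕ) : Finset (Fin r ⊕ Fin r → ℤ) :=
  (Finset.range (Nat.log 2 (2 * Y) + 1)).biUnion fun j => Fintype.piFinset
    (Sum.elim (fun _ => Finset.Icc (-((2 ^ (j + 1) : ℕ) : ℤ)) ((2 ^ (j + 1) : ℕ) : ℤ))
      (fun _ => Finset.Icc (-((4 * Y / 2 ^ j : ℕ) : ℤ)) ((4 * Y / 2 ^ j : ℕ) : ℤ)))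

/-- In each box the two side lengths have product at most `50 Y`, whatever `j` is. The number of
scales `j` produces the logarithm. -/
theorem card_dyadicBoxes_le {r Y : ℕ} (hY : 1 ≤ Y) :
    (dyadicBoxes r Y).card ≤ (Nat.log 2 (2 * Y) + 1) * (50 * Y) ^ r := by
  have hcard : ∀ k : ℕ, (Finset.Icc (-(k : ℤ)) k).card = 2 * k + 1 := fun k => by
    rw [Int.card_Icc]
    omega
  rw [dyadicBoxes]
  refine Finset.card_biUnion_le.trans ((Finset.sum_le_card_nsmul _ _ ((50 * Y) ^ r) ?_).trans
    (by simp))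
  intro j hj
  rw [Fintype.card_piFinset, Fintype.prod_sum_type]
  simp only [Sum.elim_inl, Sum.elim_inr, hcard, Finset.prod_const, Finset.card_univ, Fintype.card_fin]
  rw [← mul_pow]
  refine Nat.pow_le_pow_left ?_ r
  have h1 : 2 ^ j ≤ 2 * Y := by
    have h2 : j ≤ Nat.log 2 (2 * Y) := by
      have := Finset.mem_range.1 hj
      omega
    exact (Nat.pow_le_pow_right two_pos h2).trans (Nat.pow_log_le_self 2 (by omega))
  have h2 : 2 ^ j * (4 * Y / 2 ^ j) ≤ 4 * Y := Nat.mul_div_le _ _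
  have h3 : 1 ≤ 2 ^ j := Nat.one_le_two_pow
  rw [pow_succ]
  set p := 2 ^ j
  set t := 4 * Y / p
  nlinarith

theorem abs_floor_le (t : ℝ) : ((|⌊t⌋| : ℤ) : ℝ) ≤ |t| + 1 := by
  have h1 := Int.floor_le t
  have h2 := Int.lt_floor_add_one t
  rw [Int.cast_abs]
  rcases abs_cases t with ⟨h3, _⟩ | ⟨h3, _⟩ <;> rcases abs_cases (⌊t⌋ : ℝ) with ⟨h4, _⟩ | ⟨h4, _⟩ <;>
    linarith

theorem floor_mem_dyadicBoxes {r Y : ℕ} (hY : 1 ≤ Y) {h : ℝ} (hh : 0 < h)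
    (q : EuclideanSpace ℝ (Fin r ⊕ Fin r)) (h1 : ‖fstPart q‖ / h ≤ Y) (h2 : ‖sndPart q‖ / h ≤ Y)
    (h12 : ‖fstPart q‖ / h * (‖sndPart q‖ / h) ≤ Y) :
    (fun i => ⌊q i / h⌋) ∈ dyadicBoxes r Y := by
  set a := ‖fstPart q‖ / h with ha
  set b := ‖sndPart q‖ / h with hb
  have ha0 : 0 ≤ a := by positivity
  have hb0 : 0 ≤ b := by positivity
  have hY' : (1 : ℝ) ≤ Y := by exact_mod_cast hY
  -- Using `a + 1` guarantees a scale `j ≥ 0` and absorbs the rounding by the floor; the hypotheses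
  -- give `(a + 1) * (b + 1) ≤ 4 * Y`.
  obtain ⟨j, hj1, hj2⟩ := exists_nat_pow_near (show 1 ≤ a + 1 by linarith) one_lt_two
  have hfa : ∀ i, ((|⌊q (Sum.inl i) / h⌋| : ℤ) : ℝ) ≤ a + 1 := fun i => by
    refine (abs_floor_le _).trans ?_
    rw [abs_div, abs_of_pos hh]
    have : |q (Sum.inl i)| ≤ ‖fstPart q‖ := PiLp.norm_apply_le (fstPart q) i
    gcongr
    exact div_le_div_of_nonneg_right this hh.le
  have hfb : ∀ i, ((|⌊q (Sum.inr i) / h⌋| : ℤ) : ℝ) ≤ b + 1 := fun i => by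
    refine (abs_floor_le _).trans ?_
    rw [abs_div, abs_of_pos hh]
    have : |q (Sum.inr i)| ≤ ‖sndPart q‖ := PiLp.norm_apply_le (sndPart q) i
    gcongr
    exact div_le_div_of_nonneg_right this hh.le
  rw [dyadicBoxes, Finset.mem_biUnion]
  refine ⟨j, ?_, ?_⟩
  · rw [Finset.mem_range]
    have h3 : 2 ^ j ≤ 2 * Y := by
      have : (2 : ℝ) ^ j ≤ 2 * Y := by linarith
      exact_mod_cast this
    exact Nat.lt_succ_of_le (Nat.le_log_of_pow_le one_lt_two h3)
  · rw [Fintype.mem_piFinset]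
    rintro (i | i)
    · simp only [Sum.elim_inl, Finset.mem_Icc]
      rw [← abs_le]
      have : ((|⌊q (Sum.inl i) / h⌋| : ℤ) : ℝ) ≤ ((2 ^ (j + 1) : ℕ) : ℝ) := by
        push_cast
        have := hfa i
        push_cast at this
        linarith
      exact_mod_cast this
    · simp only [Sum.elim_inr, Finset.mem_Icc]
      rw [← abs_le]
      have h3 : (2 : ℝ) ^ j * (b + 1) ≤ 4 * Y := by
        have : (2 : ℝ) ^ j * (b + 1) ≤ (a + 1) * (b + 1) :=
          mul_le_mul_of_nonneg_right hj1 (by linarith)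
        nlinarith
      have h4 : ((|⌊q (Sum.inr i) / h⌋|.toNat * 2 ^ j : ℕ) : ℝ) ≤ ((4 * Y : ℕ) : ℝ) := by
        have h5 : ((|⌊q (Sum.inr i) / h⌋|.toNat : ℕ) : ℝ) = ((|⌊q (Sum.inr i) / h⌋| : ℤ) : ℝ) := by
          rw [← Int.cast_natCast, Int.toNat_of_nonneg (abs_nonneg _)]
        rw [Nat.cast_mul, h5]
        push_cast
        have := hfb i
        push_cast at this
        have h6 : (0 : ℝ) < 2 ^ j := by positivity
        nlinarith
      have h7 : |⌊q (Sum.inr i) / h⌋|.toNat ≤ 4 * Y / 2 ^ j := by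
        rw [Nat.le_div_iff_mul_le (by positivity)]
        exact_mod_cast h4
      have h8 := Int.toNat_of_nonneg (abs_nonneg ⌊q (Sum.inr i) / h⌋)
      omega

end Counting

/-! ### Upper estimate -/

section UpperBound

theorem exists_pos_mul_gradSq_le {ι : Type} [Fintype ι] [DecidableEq ι] {Q : Matrix ι ι ℝ}
    (hQ : Q.PosDef) : ∃ κ > 0, ∀ (f : EuclideanSpace ℝ ι → ℂ) (x : EuclideanSpace ℝ ι),
      κ * gradSq f x ≤ hermForm Q (grad f x) := by
  have hreal : ∃ κ > 0, ∀ v : EuclideanSpace ℝ ι, κ * ‖v‖ ^ 2 ≤ v ⬝ᵥ (Q *ᵥ v) := by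
    have hc : Continuous fun v : EuclideanSpace ℝ ι => (v : ι → ℝ) ⬝ᵥ (Q *ᵥ v) := by
      simp only [dotProduct, Matrix.mulVec]
      fun_prop
    have hp : ∀ v : EuclideanSpace ℝ ι, v ≠ 0 → 0 < (v : ι → ℝ) ⬝ᵥ (Q *ᵥ v) := fun v hv => by
      have h1 := hQ.dotProduct_mulVec_pos (x := v) fun h => hv (by ext i; exact congrFun h i)
      simpa using h1
    have hred : ∀ κ : ℝ, (∀ v ∈ Metric.sphere (0 : EuclideanSpace ℝ ι) 1,
        κ ≤ (v : ι → ℝ) ⬝ᵥ (Q *ᵥ v)) → ∀ v : EuclideanSpace ℝ ι, κ * ‖v‖ ^ 2 ≤ v ⬝ᵥ (Q *ᵥ v) := by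
      intro κ h v
      by_cases hv : v = 0
      · simp [hv]
      · have hn : ‖v‖ ≠ 0 := norm_ne_zero_iff.2 hv
        have h1 := h (‖v‖⁻¹ • v) (by simp [norm_smul, hn])
        have h2 : ((‖v‖⁻¹ • v : EuclideanSpace ℝ ι) : ι → ℝ) = ‖v‖⁻¹ • (v : ι → ℝ) := rfl
        rw [h2, Matrix.mulVec_smul, smul_dotProduct, dotProduct_smul, smul_eq_mul, smul_eq_mul,
          ← mul_assoc, ← sq] at h1
        have h3 : (0 : ℝ) < ‖v‖ ^ 2 := by positivity
        have h4 := mul_le_mul_of_nonneg_right h1 h3.le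
        have h5 : ‖v‖⁻¹ ^ 2 * ((v : ι → ℝ) ⬝ᵥ (Q *ᵥ v)) * ‖v‖ ^ 2 = (v : ι → ℝ) ⬝ᵥ (Q *ᵥ v) := by
          field_simp
        linarith
    rcases (Metric.sphere (0 : EuclideanSpace ℝ ι) 1).eq_empty_or_nonempty with he | hne
    · exact ⟨1, one_pos, hred 1 (by simp [he])⟩
    · obtain ⟨v, hv, hmin⟩ := (isCompact_sphere (0 : EuclideanSpace ℝ ι) 1).exists_isMinOn hne
        hc.continuousOn
      refine ⟨_, hp v ?_, hred _ fun w hw => hmin hw⟩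
      rintro rfl
      simp at hv
  obtain ⟨κ, hκ, h⟩ := hreal
  refine ⟨κ, hκ, fun f x => ?_⟩
  rw [hermForm_eq_re_add_im]
  have h1 := h (WithLp.toLp 2 fun i => (grad f x i).re)
  have h2 := h (WithLp.toLp 2 fun i => (grad f x i).im)
  have h3 : gradSq f x = ‖(WithLp.toLp 2 fun i => (grad f x i).re : EuclideanSpace ℝ ι)‖ ^ 2 +
      ‖(WithLp.toLp 2 fun i => (grad f x i).im : EuclideanSpace ℝ ι)‖ ^ 2 := by
    rw [EuclideanSpace.norm_sq_eq, EuclideanSpace.norm_sq_eq, ← Finset.sum_add_distrib, gradSq]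
    refine Finset.sum_congr rfl fun i _ => ?_
    rw [← Complex.normSq_eq_norm_sq, Complex.normSq_apply]
    simp [sq]
  rw [h3, mul_add]
  exact add_le_add h1 h2

/-- `log (2 Y) ≤ log (2 D) + 3/2 log Λ ≤ 5/2 log Λ`; dividing by `log 2 > 1/2` gives five
logarithms, and `1 ≤ log Λ` supplies the sixth. -/
theorem log_two_mul_le {D Λ : ℝ} {Y : ℕ} (hY : 1 ≤ Y) (hD : 0 < D) (hΛ3 : 3 ≤ Λ) (hΛD : 2 * D ≤ Λ)
    (hYD : (Y : ℝ) ≤ D * Real.sqrt Λ ^ 3) :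
    ((Nat.log 2 (2 * Y) + 1 : ℕ) : ℝ) ≤ 6 * Real.log Λ := by
  have hΛ0 : 0 < Λ := by linarith
  have hY' : (1 : ℝ) ≤ Y := by exact_mod_cast hY
  have h1 : Real.log (2 * Y) ≤ 5 / 2 * Real.log Λ := by
    have h2 : Real.log (2 * Y) ≤ Real.log (2 * D * Real.sqrt Λ ^ 3) :=
      Real.log_le_log (by positivity) (by linarith)
    have hs : 0 < Real.sqrt Λ := Real.sqrt_pos.2 hΛ0
    rw [Real.log_mul (x := 2 * D) (by positivity) (by positivity), Real.log_pow, Real.log_sqrt hΛ0.le] at h2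
    have h3 := Real.log_le_log (by positivity) hΛD
    push_cast at h2
    linarith
  have h4 : 1 ≤ Real.log Λ := by
    rw [Real.le_log_iff_exp_le hΛ0]
    linarith [Real.exp_one_lt_d9]
  have h5 : ((Nat.log 2 (2 * Y) : ℕ) : ℝ) * Real.log 2 ≤ Real.log (2 * Y) := by
    rw [← Real.log_pow]
    refine Real.log_le_log (by positivity) ?_
    exact_mod_cast Nat.pow_log_le_self 2 (by omega)
  have h6 : 1 / 2 < Real.log 2 := by linarith [Real.log_two_gt_d9]
  have h7 : ((Nat.log 2 (2 * Y) : ℕ) : ℝ) * (1 / 2) ≤ ((Nat.log 2 (2 * Y) : ℕ) : ℝ) * Real.log 2 :=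
    mul_le_mul_of_nonneg_left h6.le (Nat.cast_nonneg _)
  push_cast
  linarith

/-- The form bound behind the upper estimate of the counting function. -/
theorem exists_formBound {r : ℕ} (hr : 0 < r) {Q : Matrix (Fin r ⊕ Fin r) (Fin r ⊕ Fin r) ℝ}
    {α : Fin r → Fin r → Fin r → Fin r → ℝ} {L₁ L₂ : Fin r → ℝ} (hP : Admissible Q α L₁ L₂)
    (hpos : ∀ (x : Fin r → ℝ) (y : Fin r → ℝ), x ≠ 0 → y ≠ 0 → 0 < quartic α x y) :
    ∃ C Λ₀ : ℝ, 0 < C ∧ ∀ Λ ≥ Λ₀, ∃ N : ℕ, FormBound (modelSchwartz Q α L₁ L₂) Λ N ∧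
      (N : ℝ) ≤ C * (Real.sqrt Λ ^ 3) ^ r * Real.log Λ := by
  have hQ := hP.quadratic_pos
  have h0 := hP.quartic_nonneg
  obtain ⟨κ, hκ, hgrad⟩ := exists_pos_mul_gradSq_le hQ
  obtain ⟨δ, C, hδ, hδ1, hco⟩ := coerciveOn_univ hP hpos
  obtain ⟨c, M, hc, -, hb⟩ := quartic_bounds hpos
  set n := Fintype.card (Fin r ⊕ Fin r) with hn
  have hn0 : 0 < n := by simp [hn]; omega
  have hn0' : (0 : ℝ) < n := by exact_mod_cast hn0
  -- With mesh `h` such that `h² X = η`, the size condition of `formBound_of_cells` holds with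
  -- equality.
  set η := κ / (n * 2 ^ n) with hη
  have hη0 : 0 < η := by positivity
  -- In units of `h = √η / s`, where `s = √X`, the bound `‖q‖ < X` becomes `s³ / √η` and `‖q₁‖ ‖q₂‖
  -- ≤ √(X / c)` becomes `s³ / (η √c)`. Both are at most `B s³`, so the single number `Y` serves for
  -- both conditions.
  set B := max 1 (max (1 / Real.sqrt η) (1 / (η * Real.sqrt c))) with hB
  have hB1 : 1 ≤ B := le_max_left _ _
  have hB2 : 1 / Real.sqrt η ≤ B := (le_max_left _ _).trans (le_max_right _ _)
  have hB3 : 1 / (η * Real.sqrt c) ≤ B := (le_max_right _ _).trans (le_max_right _ _)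
  set D := 2 * B * Real.sqrt (2 / δ) ^ 3 with hD
  have hD0 : 0 < D := by positivity
  refine ⟨6 * (50 * D) ^ r, max (|C| + 1) (max 3 (2 * D)), by positivity, fun Λ hΛ => ?_⟩
  have hΛC : |C| + 1 ≤ Λ := (le_max_left _ _).trans hΛ
  have hΛ3 : 3 ≤ Λ := (le_max_left _ _).trans ((le_max_right _ _).trans hΛ)
  have hΛD : 2 * D ≤ Λ := (le_max_right _ _).trans ((le_max_right _ _).trans hΛ)
  set X := (Λ + C) / δ with hX
  have hδX : δ * X = Λ + C := by rw [hX]; field_simp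
  have hX1 : 1 ≤ X := by
    rw [hX, le_div_iff₀ hδ]
    linarith [neg_abs_le C]
  have hX2 : X ≤ 2 / δ * Λ := by
    rw [hX, div_mul_eq_mul_div]
    exact div_le_div_of_nonneg_right (by linarith [le_abs_self C]) hδ.le
  set s := Real.sqrt X with hs
  have hs1 : 1 ≤ s := Real.one_le_sqrt.2 hX1
  have hs0 : 0 < s := by linarith
  have hsX : s ^ 2 = X := Real.sq_sqrt (by linarith)
  have hsΛ : s ≤ Real.sqrt (2 / δ) * Real.sqrt Λ := by
    rw [← Real.sqrt_mul (by positivity)]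
    exact Real.sqrt_le_sqrt hX2
  set Y := ⌈B * s ^ 3⌉₊ with hYdef
  have hBs : 1 ≤ B * s ^ 3 := by nlinarith [one_le_pow₀ hs1 (n := 3)]
  have hY0 : B * s ^ 3 ≤ Y := Nat.le_ceil _
  have hY1 : 1 ≤ Y := by exact_mod_cast hBs.trans hY0
  have hYD : (Y : ℝ) ≤ D * Real.sqrt Λ ^ 3 := by
    have h1 : (Y : ℝ) < B * s ^ 3 + 1 := Nat.ceil_lt_add_one (by positivity)
    have h2 : s ^ 3 ≤ (Real.sqrt (2 / δ) * Real.sqrt Λ) ^ 3 := pow_le_pow_left₀ hs0.le hsΛ 3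
    rw [mul_pow] at h2
    have h3 := mul_le_mul_of_nonneg_left h2 (show 0 ≤ 2 * B by positivity)
    rw [hD]
    linarith
  set h := Real.sqrt η / s with hh
  have hh0 : 0 < h := by positivity
  have hh2 : h ^ 2 * X = η := by
    rw [hh, div_pow, Real.sq_sqrt hη0.le, hsX]
    field_simp
  refine ⟨(dyadicBoxes r Y).card, ?_, ?_⟩
  · refine formBound_of_cells (σ := Fin r ⊕ Fin r → ℤ) (polyBounded_weight α) (weight_nonneg h0)
      hκ.le hδ.le (fun φ => ?_) hδX (by linarith) (cube h) (convex_cube h) (measurableSet_cube h)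
      (volume_cube_ne_top h) (pairwise_disjoint_cube hh0) (d := n * h ^ 2) (by positivity)
      (fun m x hx y hy => norm_sub_sq_le_of_mem_cube hx hy) ?_ _ (fun q hq => ?_)
    · rw [modelSchwartz, re_inner_schrodinger _ (potential_hasTemperateGrowth α L₁ L₂), norm_incl_sq]
      refine le_trans (mul_le_mul_of_nonneg_left ?_ hδ.le) (hco φ fun q hq => absurd (Set.mem_univ q) hq)
      refine integral_mono (((integrable_gradSq φ).const_mul κ).add
        (integrable_polyBounded_normSq (polyBounded_weight α) φ))
        (integrable_energy Q (polyBounded_weight α) φ) fun x => ?_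
      exact add_le_add (hgrad φ x) le_rfl
    · have h1 : (n : ℝ) * h ^ 2 * 2 ^ n * X = n * 2 ^ n * (h ^ 2 * X) := by ring
      rw [h1, hh2, hη]
      apply le_of_eq
      field_simp
    · refine ⟨_, floor_mem_dyadicBoxes hY1 hh0 q ?_ ?_ ?_, mem_cube_floor hh0 q⟩
      all_goals
        have hw1 : ‖q‖ < X := by
          have := h0 (fstPart q) (sndPart q)
          rw [weight] at hq
          linarith
        have hw2 : quartic α (fstPart q) (sndPart q) < X := by
          have := norm_nonneg q
          rw [weight] at hq
          linarith
        have hqs := norm_sq_parts q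
        have hbig : ‖q‖ / h ≤ Y := by
          refine le_trans ?_ hY0
          have h1 : ‖q‖ / h ≤ X / h := div_le_div_of_nonneg_right hw1.le hh0.le
          have h2 : X / h = 1 / Real.sqrt η * s ^ 3 := by
            rw [hh, ← hsX]
            field_simp
          rw [h2] at h1
          exact h1.trans (mul_le_mul_of_nonneg_right hB2 (by positivity))
      · refine le_trans (div_le_div_of_nonneg_right ?_ hh0.le) hbig
        refine abs_le_of_sq_le_sq' ?_ (norm_nonneg _) |>.2
        nlinarith [sq_nonneg ‖sndPart q‖]
      · refine le_trans (div_le_div_of_nonneg_right ?_ hh0.le) hbig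
        refine abs_le_of_sq_le_sq' ?_ (norm_nonneg _) |>.2
        nlinarith [sq_nonneg ‖fstPart q‖]
      · refine le_trans ?_ hY0
        have h1 := ((hb (fstPart q) (sndPart q)).1.trans hw2.le)
        have h2 : Real.sqrt c * (‖fstPart q‖ * ‖sndPart q‖) ≤ s := by
          rw [hs]
          refine Real.le_sqrt_of_sq_le ?_
          rw [mul_pow, Real.sq_sqrt hc.le, mul_pow]
          exact h1
        have hsc : 0 < Real.sqrt c := Real.sqrt_pos.2 hc
        have h3 : ‖fstPart q‖ / h * (‖sndPart q‖ / h) =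
            1 / (η * Real.sqrt c) * s ^ 2 * (Real.sqrt c * (‖fstPart q‖ * ‖sndPart q‖)) := by
          rw [hsX]
          rw [← hh2]
          field_simp
        rw [h3]
        have h4 : 1 / (η * Real.sqrt c) * s ^ 2 * (Real.sqrt c * (‖fstPart q‖ * ‖sndPart q‖)) ≤
            B * s ^ 2 * s :=
          mul_le_mul (mul_le_mul_of_nonneg_right hB3 (by positivity)) h2 (by positivity)
            (by positivity)
        refine h4.trans (le_of_eq (by ring))
  · have h1 : ((dyadicBoxes r Y).card : ℝ) ≤ ((Nat.log 2 (2 * Y) + 1 : ℕ) : ℝ) * (50 * Y) ^ r := by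
      exact_mod_cast card_dyadicBoxes_le (r := r) hY1
    have h2 := log_two_mul_le hY1 hD0 hΛ3 hΛD hYD
    have h3 : (50 * (Y : ℝ)) ^ r ≤ (50 * (D * Real.sqrt Λ ^ 3)) ^ r :=
      pow_le_pow_left₀ (by positivity) (by linarith) r
    have hl : 0 ≤ Real.log Λ := Real.log_nonneg (by linarith)
    calc ((dyadicBoxes r Y).card : ℝ) ≤ ((Nat.log 2 (2 * Y) + 1 : ℕ) : ℝ) * (50 * Y) ^ r := h1
      _ ≤ 6 * Real.log Λ * (50 * (D * Real.sqrt Λ ^ 3)) ^ r :=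
          mul_le_mul h2 h3 (by positivity) (by positivity)
      _ = _ := by
          rw [← mul_assoc 50 D, mul_pow]
          ring

end UpperBound

/-! ### Disjointly supported test functions -/

section TestFunctions

variable {ι : Type} [Fintype ι]

theorem hermForm_const_mul (A : Matrix ι ι ℝ) (c : ℂ) (ξ : ι → ℂ) :
    hermForm A (fun i => c * ξ i) = ‖c‖ ^ 2 * hermForm A ξ := by
  simp only [hermForm, Finset.mul_sum]
  refine Finset.sum_congr rfl fun i _ => Finset.sum_congr rfl fun j _ => ?_
  rw [← Complex.normSq_eq_norm_sq, Complex.normSq_apply]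
  simp
  ring

theorem integral_comp_inv_smul_add (F : EuclideanSpace ℝ ι → ℝ) {h : ℝ} (hh : 0 < h)
    (c : EuclideanSpace ℝ ι) :
    ∫ x, F (h⁻¹ • x + c) = h ^ Fintype.card ι * ∫ x, F x := by
  have h1 := Measure.integral_comp_inv_smul_of_nonneg (volume : Measure (EuclideanSpace ℝ ι))
    (fun x => F (x + c)) hh.le
  rw [integral_add_right_eq_self, finrank_euclideanSpace, smul_eq_mul] at h1
  exact h1

variable [DecidableEq ι]

theorem grad_sum_smul {σ : Type} [Fintype σ] (φ : σ → 𝓢(EuclideanSpace ℝ ι, ℂ)) (c : σ → ℂ)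
    (x : EuclideanSpace ℝ ι) :
    grad (∑ m, c m • φ m : 𝓢(EuclideanSpace ℝ ι, ℂ)) x = fun i => ∑ m, c m * grad (φ m) x i := by
  ext i
  simp only [grad_apply]
  have h : ∀ v : EuclideanSpace ℝ ι, (∂_{v} (∑ m, c m • φ m) : 𝓢(EuclideanSpace ℝ ι, ℂ)) =
      ∑ m, c m • ∂_{v} (φ m) := fun v => by
    refine (map_sum (LineDeriv.lineDerivOpCLM ℂ 𝓢(EuclideanSpace ℝ ι, ℂ) v) (fun m => c m • φ m)
      Finset.univ).trans ?_
    simp only [map_smul]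
    rfl
  rw [h]
  simp

/-- The energy is diagonal on functions with disjoint supports. -/
theorem energy_sum_smul {σ : Type} [Fintype σ] (A : Matrix ι ι ℝ) {W : EuclideanSpace ℝ ι → ℝ}
    (hW : PolyBounded W) (φ : σ → 𝓢(EuclideanSpace ℝ ι, ℂ))
    (hφ : ∀ x m m', m ≠ m' → (φ m x = 0 ∧ grad (φ m) x = 0) ∨ (φ m' x = 0 ∧ grad (φ m') x = 0))
    (c : σ → ℂ) :
    energy A W (∑ m, c m • φ m : 𝓢(EuclideanSpace ℝ ι, ℂ)) = ∑ m, ‖c m‖ ^ 2 * energy A W (φ m) := by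
  classical
  simp only [energy, ← integral_const_mul]
  rw [← integral_finsetSum _ fun m _ => (integrable_energy A hW (φ m)).const_mul _]
  refine integral_congr_ae (Filter.Eventually.of_forall fun x => ?_)
  simp only [grad_sum_smul, sum_apply, smul_apply, smul_eq_mul]
  have hz : hermForm A (0 : ι → ℂ) = 0 := by simp [hermForm]
  by_cases h : ∃ m₀, ¬ (φ m₀ x = 0 ∧ grad (φ m₀) x = 0)
  · obtain ⟨m₀, h₀⟩ := h
    have hm : ∀ m, m ≠ m₀ → φ m x = 0 ∧ grad (φ m) x = 0 := fun m hmm =>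
      (hφ x m m₀ hmm).resolve_right h₀
    have e1 : (fun i => ∑ m, c m * grad (φ m) x i) = fun i => c m₀ * grad (φ m₀) x i := by
      ext i
      refine Finset.sum_eq_single m₀ (fun m _ hmm => ?_) (by simp)
      rw [(hm m hmm).2]
      simp
    have e2 : ∑ m, c m * φ m x = c m₀ * φ m₀ x := by
      refine Finset.sum_eq_single m₀ (fun m _ hmm => ?_) (by simp)
      rw [(hm m hmm).1]
      simp
    rw [e1, e2, hermForm_const_mul, Finset.sum_eq_single m₀ (fun m _ hmm => ?_) (by simp), norm_mul]
    · ring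
    · rw [(hm m hmm).1, (hm m hmm).2, hz]
      simp
  · push Not at h
    have e1 : (fun i => ∑ m, c m * grad (φ m) x i) = 0 := by
      ext i
      refine Finset.sum_eq_zero fun m _ => ?_
      rw [(h m).2]
      simp
    have e2 : ∑ m, c m * φ m x = 0 := Finset.sum_eq_zero fun m _ => by rw [(h m).1, mul_zero]
    rw [e1, e2, hz, Finset.sum_eq_zero fun m _ => ?_]
    · simp
    · rw [(h m).1, (h m).2, hz]
      simp

/-- With disjoint supports both sides are diagonal in the coefficients, so the strict inequality for
each function passes to the whole span. -/
theorem energy_linearCombination_lt {σ : Type} [Fintype σ] {A : Matrix ι ι ℝ}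
    {W : EuclideanSpace ℝ ι → ℝ} (hW : PolyBounded W) {φ : σ → 𝓢(EuclideanSpace ℝ ι, ℂ)}
    (hφ : ∀ x m m', m ≠ m' → (φ m x = 0 ∧ grad (φ m) x = 0) ∨ (φ m' x = 0 ∧ grad (φ m') x = 0))
    {Λ : ℝ} (hlt : ∀ m, energy A W (φ m) < Λ * ∫ x, ‖φ m x‖ ^ 2) {v : σ → ℂ} (hv : v ≠ 0) :
    energy A W (Fintype.linearCombination ℂ φ v) <
      Λ * ‖incl ι (Fintype.linearCombination ℂ φ v)‖ ^ 2 := by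
  have hΦ : Fintype.linearCombination ℂ φ v = ∑ p, v p • φ p := Fintype.linearCombination_apply ..
  have hn : ‖incl ι (∑ p, v p • φ p)‖ ^ 2 = ∑ p, ‖v p‖ ^ 2 * ∫ x, ‖φ p x‖ ^ 2 := by
    -- The `L²` norm is the energy with zero kinetic form and potential one.
    have h1 := energy_sum_smul 0 (PolyBounded.const 1) φ hφ v
    have h2 : ∀ ψ : 𝓢(EuclideanSpace ℝ ι, ℂ), energy 0 (fun _ => 1) ψ = ∫ x, ‖ψ x‖ ^ 2 :=
      fun ψ => by simp [energy, hermForm]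
    simp only [h2] at h1
    rw [norm_incl_sq, h1]
  rw [hΦ, hn, energy_sum_smul A hW φ hφ, Finset.mul_sum]
  obtain ⟨p₀, hp₀⟩ := Function.ne_iff.1 hv
  refine Finset.sum_lt_sum (fun p _ => ?_) ⟨p₀, Finset.mem_univ _, ?_⟩
  · rw [mul_left_comm]
    exact mul_le_mul_of_nonneg_left (hlt p).le (sq_nonneg _)
  · rw [mul_left_comm]
    have : 0 < ‖v p₀‖ := norm_pos_iff.2 hp₀
    exact mul_lt_mul_of_pos_left (hlt p₀) (by positivity)

theorem exists_bump (ι : Type) [Fintype ι] [DecidableEq ι] : ∃ η : 𝓢(EuclideanSpace ℝ ι, ℂ),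
    (0 < ∫ x, ‖η x‖ ^ 2) ∧
    ∀ x : EuclideanSpace ℝ ι, ¬ (∀ i, 0 < x i ∧ x i < 1) → η x = 0 ∧ grad η x = 0 := by
  set z : EuclideanSpace ℝ ι := WithLp.toLp 2 fun _ => 1 / 2 with hz
  let b : ContDiffBump z := ⟨1 / 8, 1 / 4, by norm_num, by norm_num⟩
  have hbc : HasCompactSupport (fun x => (b x : ℂ)) :=
    b.hasCompactSupport.comp_left (g := fun t : ℝ => (t : ℂ)) (by simp)
  have hbs : ContDiff ℝ (⊤ : ℕ∞) (fun x => (b x : ℂ)) := Complex.ofRealCLM.contDiff.comp b.contDiff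
  have hts : tsupport (fun x => (b x : ℂ)) ⊆ Metric.closedBall z (1 / 4) := by
    refine (closure_mono ?_).trans b.tsupport_eq.subset
    intro x hx h
    exact hx (by simp [h])
  refine ⟨hbc.toSchwartzMap hbs, ?_, fun x hx => ?_⟩
  · rw [← norm_incl_sq]
    have hne : hbc.toSchwartzMap hbs ≠ 0 := fun h => by
      have h1 := congrArg (fun f : 𝓢(EuclideanSpace ℝ ι, ℂ) => f z) h
      have h2 : (b z : ℂ) = 0 := h1
      rw [b.one_of_mem_closedBall (Metric.mem_closedBall_self (by norm_num))] at h2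
      simp at h2
    have : incl ι (hbc.toSchwartzMap hbs) ≠ 0 := fun h =>
      hne (incl_injective ι (h.trans (map_zero _).symm))
    positivity
  · have hx' : x ∉ tsupport (fun x => (b x : ℂ)) := fun h => hx fun i => by
      have h1 := hts h
      rw [mem_closedBall_iff_norm] at h1
      have h2 : |x i - 1 / 2| ≤ 1 / 4 := (PiLp.norm_apply_le (x - z) i).trans h1
      rw [abs_le] at h2
      constructor <;> linarith
    refine ⟨image_eq_zero_of_notMem_tsupport hx', ?_⟩
    ext i
    have h1 : fderiv ℝ (fun x => (b x : ℂ)) x = 0 := fderiv_of_notMem_tsupport ℝ hx'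
    change fderiv ℝ (fun x => (b x : ℂ)) x _ = 0
    rw [h1]
    rfl

/-- A rescaled bump function in a small cube. -/
theorem exists_scaled_bump {η : 𝓢(EuclideanSpace ℝ ι, ℂ)}
    (hη : ∀ x : EuclideanSpace ℝ ι, ¬ (∀ i, 0 < x i ∧ x i < 1) → η x = 0 ∧ grad η x = 0)
    (A : Matrix ι ι ℝ) {h : ℝ} (hh : 0 < h) (m : ι → ℤ) : ∃ φ : 𝓢(EuclideanSpace ℝ ι, ℂ),
      (∀ x, x ∉ cube h m → φ x = 0 ∧ grad φ x = 0) ∧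
      (∫ x, ‖φ x‖ ^ 2 = h ^ Fintype.card ι * ∫ x, ‖η x‖ ^ 2) ∧
      ∀ (W : EuclideanSpace ℝ ι → ℝ) (w : ℝ), PolyBounded W → (∀ x ∈ cube h m, W x ≤ w) →
        energy A W φ ≤ h ^ Fintype.card ι *
          ((h ^ 2)⁻¹ * (∫ x, hermForm A (grad η x)) + w * ∫ x, ‖η x‖ ^ 2) := by
  set c : EuclideanSpace ℝ ι := -WithLp.toLp 2 fun i => (m i : ℝ) with hc
  set T : EuclideanSpace ℝ ι →L[ℝ] EuclideanSpace ℝ ι := h⁻¹ • ContinuousLinearMap.id ℝ _ with hT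
  obtain ⟨φ, hφ⟩ := exists_comp_affine T
    (fun a b hab => by simpa [hT, hh.ne'] using hab) c η
  have hTx : ∀ x, T x + c = h⁻¹ • x + c := fun x => rfl
  have hg : ∀ x, grad φ x = fun i => ((h⁻¹ : ℝ) : ℂ) * grad η (h⁻¹ • x + c) i := fun x => by
    ext i
    have h1 := grad_comp_affine T c η x i
    have h2 : (fun y => η (T y + c)) = φ := funext fun y => (hφ y).symm
    rw [h2] at h1
    rw [h1]
    simp [grad, hT]
  have hφ' : ∀ x, φ x = η (h⁻¹ • x + c) := hφ
  have hsupp : ∀ x, x ∉ cube h m → φ x = 0 ∧ grad φ x = 0 := fun x hx => by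
    have h1 := hη (h⁻¹ • x + c) fun h2 => hx fun i => by
      obtain ⟨h3, h4⟩ := h2 i
      have h5 : (h⁻¹ • x + c) i = x i / h - m i := by
        simp [hc]
        ring
      rw [h5] at h3 h4
      have h6 : (m i : ℝ) < x i / h := by linarith
      have h7 : x i / h < m i + 1 := by linarith
      rw [lt_div_iff₀ hh] at h6
      rw [div_lt_iff₀ hh] at h7
      constructor <;> linarith
    refine ⟨by rw [hφ', h1.1], ?_⟩
    rw [hg, h1.2]
    ext i
    simp
  refine ⟨φ, hsupp, ?_, fun W w hW hw => ?_⟩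
  · simp_rw [hφ']
    exact integral_comp_inv_smul_add (fun x => ‖η x‖ ^ 2) hh c
  · have hi1 := (integrable_hermForm_grad A η).const_mul (h ^ 2)⁻¹
    have hi2 := (integrable_normSq η).const_mul w
    have e : h ^ Fintype.card ι *
          ((h ^ 2)⁻¹ * (∫ x, hermForm A (grad η x)) + w * ∫ x, ‖η x‖ ^ 2) =
        ∫ x, (hermForm A (grad φ x) + w * ‖φ x‖ ^ 2) := by
      rw [← integral_const_mul, ← integral_const_mul, ← integral_add hi1 hi2,
        ← integral_comp_inv_smul_add _ hh c]
      refine integral_congr_ae (Filter.Eventually.of_forall fun x => ?_)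
      simp only
      rw [hg, hermForm_smul_left, hφ', inv_pow]
    rw [e, energy]
    refine integral_mono (integrable_energy A hW φ)
      (integrable_energy A (PolyBounded.const w) φ) fun x => ?_
    refine add_le_add le_rfl ?_
    by_cases hx : x ∈ cube h m
    · exact mul_le_mul_of_nonneg_right (hw x hx) (sq_nonneg _)
    · rw [(hsupp x hx).1]
      simp

end TestFunctions

/-! ### Lower estimate -/

section LowerBound

/-- An index set for lattice points near the coordinate subspaces. -/
abbrev DyadicIndex (r J : ℕ) : Type :=
  Σ j : Fin (J + 1), (Fin r → Fin (2 ^ (j : ℕ))) × (Fin r → Fin (2 ^ (J - (j : ℕ))))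

/-- The lattice point with a given index. -/
def dyadicPoint {r J : ℕ} (p : DyadicIndex r J) : Fin r ⊕ Fin r → ℤ :=
  Sum.elim (fun i => ((2 ^ (p.1 : ℕ) + (p.2.1 i : ℕ) : ℕ) : ℤ)) (fun k => ((p.2.2 k : ℕ) : ℤ))

/-- Each of the `J + 1` scales contributes equally because the two blocks have the same dimension
`r`; this is the source of the logarithm. -/
theorem card_dyadicIndex (r J : ℕ) : Fintype.card (DyadicIndex r J) = (J + 1) * (2 ^ J) ^ r := by
  rw [Fintype.card_sigma]
  simp only [Fintype.card_prod, Fintype.card_fun, Fintype.card_fin]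
  have : ∀ j : Fin (J + 1), (2 ^ (j : ℕ)) ^ r * (2 ^ (J - (j : ℕ))) ^ r = (2 ^ J) ^ r := fun j => by
    rw [← mul_pow, ← pow_add, Nat.add_sub_cancel' (Nat.le_of_lt_succ j.2)]
  simp [this]

/-- The scale `j` is the binary logarithm of any coordinate of the first block, which needs `0 < r`.
-/
theorem dyadicPoint_injective {r J : ℕ} (hr : 0 < r) :
    Function.Injective (dyadicPoint : DyadicIndex r J → _) := by
  rintro ⟨j, a, b⟩ ⟨j', a', b'⟩ h
  have h1 : ∀ i, 2 ^ (j : ℕ) + (a i : ℕ) = 2 ^ (j' : ℕ) + (a' i : ℕ) := fun i => by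
    have := congrFun h (Sum.inl i)
    exact Int.ofNat_inj.1 this
  have h2 : ∀ k, (b k : ℕ) = (b' k : ℕ) := fun k => by
    have := congrFun h (Sum.inr k)
    exact Int.ofNat_inj.1 this
  have hlog : ∀ (l t : ℕ), t < 2 ^ l → Nat.log 2 (2 ^ l + t) = l := fun l t ht => by
    refine Nat.log_eq_of_pow_le_of_lt_pow (by omega) ?_
    rw [pow_succ]
    omega
  have hj : j = j' := Fin.ext (by
    have h3 := congrArg (Nat.log 2) (h1 ⟨0, hr⟩)
    rwa [hlog _ _ (a _).2, hlog _ _ (a' _).2] at h3)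
  subst hj
  have ha : a = a' := funext fun i => Fin.ext (by have := h1 i; omega)
  have hb : b = b' := funext fun k => Fin.ext (h2 k)
  rw [ha, hb]

theorem norm_sq_le_of_coord {r : ℕ} {x : EuclideanSpace ℝ (Fin r)} {t : ℝ}
    (h : ∀ i, 0 ≤ x i ∧ x i ≤ t) : ‖x‖ ^ 2 ≤ r * t ^ 2 := by
  rw [EuclideanSpace.norm_sq_eq]
  have : ∑ i, ‖x i‖ ^ 2 ≤ ∑ _i : Fin r, t ^ 2 := Finset.sum_le_sum fun i _ => by
    rw [Real.norm_eq_abs, sq_abs]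
    exact pow_le_pow_left₀ (h i).1 (h i).2 2
  simpa using this

/-- The bounds `h 2^(j+1)` and `h 2^(J-j)` on the two blocks have a product independent of `j`, so
all cubes lie in one hyperbolic region. -/
theorem parts_le_of_mem_cube {r J : ℕ} {h : ℝ} (hh : 0 < h) (p : DyadicIndex r J)
    {q : EuclideanSpace ℝ (Fin r ⊕ Fin r)} (hq : q ∈ cube h (dyadicPoint p)) :
    ‖fstPart q‖ ^ 2 * ‖sndPart q‖ ^ 2 ≤ 4 * r ^ 2 * (h ^ 2 * 2 ^ J) ^ 2 ∧
      ‖q‖ ^ 2 ≤ r * (3 * (h * 2 ^ J)) ^ 2 := by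
  obtain ⟨j, a, b⟩ := p
  have hj : (j : ℕ) ≤ J := Nat.le_of_lt_succ j.2
  have h1 : ‖fstPart q‖ ^ 2 ≤ r * (h * 2 ^ ((j : ℕ) + 1)) ^ 2 := by
    refine norm_sq_le_of_coord fun i => ?_
    obtain ⟨h2, h3⟩ := hq (Sum.inl i)
    have h4 : dyadicPoint ⟨j, a, b⟩ (Sum.inl i) = ((2 ^ (j : ℕ) + (a i : ℕ) : ℕ) : ℤ) := rfl
    rw [h4] at h2 h3
    have h5 : ((2 ^ (j : ℕ) + (a i : ℕ) : ℕ) : ℝ) + 1 ≤ 2 ^ ((j : ℕ) + 1) := by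
      have : 2 ^ (j : ℕ) + (a i : ℕ) + 1 ≤ 2 ^ ((j : ℕ) + 1) := by
        have := (a i).2
        rw [pow_succ]
        omega
      exact_mod_cast this
    have h6 : (0 : ℝ) ≤ ((2 ^ (j : ℕ) + (a i : ℕ) : ℕ) : ℝ) := Nat.cast_nonneg _
    rw [Int.cast_natCast] at h2 h3
    exact ⟨(by positivity : (0 : ℝ) ≤ _).trans h2, h3.le.trans (mul_le_mul_of_nonneg_left h5 hh.le)⟩
  have h2 : ‖sndPart q‖ ^ 2 ≤ r * (h * 2 ^ (J - (j : ℕ))) ^ 2 := by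
    refine norm_sq_le_of_coord fun i => ?_
    obtain ⟨h2, h3⟩ := hq (Sum.inr i)
    have h4 : dyadicPoint ⟨j, a, b⟩ (Sum.inr i) = ((b i : ℕ) : ℤ) := rfl
    rw [h4] at h2 h3
    have h5 : ((b i : ℕ) : ℝ) + 1 ≤ 2 ^ (J - (j : ℕ)) := by
      exact_mod_cast (b i).2
    rw [Int.cast_natCast] at h2 h3
    exact ⟨(by positivity : (0 : ℝ) ≤ _).trans h2, h3.le.trans (mul_le_mul_of_nonneg_left h5 hh.le)⟩
  have hpow : (2 : ℝ) ^ (j : ℕ) * 2 ^ (J - (j : ℕ)) = 2 ^ J := by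
    rw [← pow_add, Nat.add_sub_cancel' hj]
  constructor
  · calc ‖fstPart q‖ ^ 2 * ‖sndPart q‖ ^ 2
        ≤ (r * (h * 2 ^ ((j : ℕ) + 1)) ^ 2) * (r * (h * 2 ^ (J - (j : ℕ))) ^ 2) :=
          mul_le_mul h1 h2 (by positivity) (by positivity)
      _ = _ := by rw [← hpow, pow_succ]; ring
  · rw [norm_sq_parts]
    have h3 : (h * 2 ^ ((j : ℕ) + 1)) ^ 2 ≤ (h * (2 * 2 ^ J)) ^ 2 := by
      rw [pow_succ (2 : ℝ) (j : ℕ), mul_comm _ (2 : ℝ)]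
      have : (2 : ℝ) ^ (j : ℕ) ≤ 2 ^ J := pow_le_pow_right₀ one_le_two hj
      gcongr
    have h4 : (h * 2 ^ (J - (j : ℕ))) ^ 2 ≤ (h * 2 ^ J) ^ 2 := by
      have : (2 : ℝ) ^ (J - (j : ℕ)) ≤ 2 ^ J := pow_le_pow_right₀ one_le_two (Nat.sub_le _ _)
      gcongr
    have h5 := mul_le_mul_of_nonneg_left (add_le_add h3 h4) (Nat.cast_nonneg r : (0 : ℝ) ≤ r)
    have h6 : (0 : ℝ) ≤ r * (h * 2 ^ J) ^ 2 := by positivity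
    nlinarith

set_option maxHeartbeats 1000000 in
/-- The test functions behind the lower estimate of the counting function. -/
theorem exists_testFunctions {r : ℕ} (hr : 0 < r) (Q : Matrix (Fin r ⊕ Fin r) (Fin r ⊕ Fin r) ℝ)
    {α : Fin r → Fin r → Fin r → Fin r → ℝ} (L₁ L₂ : Fin r → ℝ)
    (hpos : ∀ (x : Fin r → ℝ) (y : Fin r → ℝ), x ≠ 0 → y ≠ 0 → 0 < quartic α x y) :
    ∃ c Λ₀ : ℝ, 0 < c ∧ ∀ Λ ≥ Λ₀, ∃ (J : ℕ)
      (Φ : (DyadicIndex r J → ℂ) →ₗ[ℂ] 𝓢(EuclideanSpace ℝ (Fin r ⊕ Fin r), ℂ)),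
      (∀ v ≠ 0, energy Q (potential α L₁ L₂) (Φ v) < Λ * ‖incl _ (Φ v)‖ ^ 2) ∧
      c * (Real.sqrt Λ ^ 3) ^ r * Real.log Λ ≤ Fintype.card (DyadicIndex r J) := by
  obtain ⟨c₀, M, -, hM, hb⟩ := quartic_bounds hpos
  obtain ⟨η, hη0, hη⟩ := exists_bump (Fin r ⊕ Fin r)
  set N₀ := ∫ x, ‖η x‖ ^ 2 with hN₀
  set E₀ := ∫ x, hermForm Q (grad η x) with hE₀
  -- Cubes of side `k / √Λ` give the rescaled bump a kinetic energy at most `Λ / 4` relative to its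
  -- norm; the `+ 1` keeps `k` positive.
  set k := Real.sqrt (4 * (|E₀| + 1) / N₀) with hk
  have hk0 : 0 < k := Real.sqrt_pos.2 (by positivity)
  have hk2 : k ^ 2 = 4 * (|E₀| + 1) / N₀ := Real.sq_sqrt (by positivity)
  set K := (∑ i, |L₁ i|) + ∑ i, |L₂ i| with hK
  have hK0 : 0 ≤ K := add_nonneg (Finset.sum_nonneg fun i _ => abs_nonneg _)
    (Finset.sum_nonneg fun i _ => abs_nonneg _)
  have hr' : (1 : ℝ) ≤ r := by exact_mod_cast hr
  -- The range `2 ^ J ≤ c Λ^(3/2)` with small `c` keeps the quartic and the linear part each below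
  -- `Λ / 4` on all cubes.
  obtain ⟨c, hc0, hcM, hcK⟩ : ∃ c : ℝ, 0 < c ∧ M * (4 * r ^ 2 * (k ^ 2 * c) ^ 2) ≤ 1 / 4 ∧
      K * (r * (3 * (k * c))) ≤ 1 / 4 := by
    have t1 : Filter.Tendsto (fun c : ℝ => M * (4 * r ^ 2 * (k ^ 2 * c) ^ 2)) (nhdsWithin 0 (Set.Ioi 0))
        (nhds (M * (4 * r ^ 2 * (k ^ 2 * 0) ^ 2))) :=
      ((by fun_prop : Continuous fun c : ℝ => M * (4 * r ^ 2 * (k ^ 2 * c) ^ 2)).tendsto 0).mono_left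
        nhdsWithin_le_nhds
    have t2 : Filter.Tendsto (fun c : ℝ => K * (r * (3 * (k * c)))) (nhdsWithin 0 (Set.Ioi 0))
        (nhds (K * (r * (3 * (k * 0))))) :=
      ((by fun_prop : Continuous fun c : ℝ => K * (r * (3 * (k * c)))).tendsto 0).mono_left
        nhdsWithin_le_nhds
    have e1 := t1.eventually (gt_mem_nhds (show M * (4 * r ^ 2 * (k ^ 2 * 0) ^ 2) < 1 / 4 by norm_num))
    have e2 := t2.eventually (gt_mem_nhds (show K * (r * (3 * (k * 0))) < 1 / 4 by norm_num))
    obtain ⟨c, ⟨h1, h2⟩, h3⟩ := ((e1.and e2).and self_mem_nhdsWithin).exists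
    exact ⟨c, h3, h1.le, h2.le⟩
  refine ⟨(c / 2) ^ r, max 1 (max (1 / c) ((1 / c) ^ 2)), by positivity, fun Λ hΛ => ?_⟩
  have hΛ1 : 1 ≤ Λ := (le_max_left _ _).trans hΛ
  have hΛc : 1 / c ≤ Λ := (le_max_left _ _).trans ((le_max_right _ _).trans hΛ)
  have hΛc2 : (1 / c) ^ 2 ≤ Λ := (le_max_right _ _).trans ((le_max_right _ _).trans hΛ)
  have hΛ0 : 0 < Λ := by linarith
  set s := Real.sqrt Λ with hs
  have hs1 : 1 ≤ s := Real.one_le_sqrt.2 hΛ1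
  have hs0 : 0 < s := by linarith
  have hsΛ : s ^ 2 = Λ := Real.sq_sqrt hΛ0.le
  have hcs : 1 ≤ c * s := by
    have : 1 / c ≤ s := Real.le_sqrt_of_sq_le hΛc2
    rwa [div_le_iff₀ hc0, mul_comm] at this
  have hcs3 : 1 ≤ c * s ^ 3 := by nlinarith [one_le_pow₀ hs1 (n := 2)]
  obtain ⟨J, hJ1, hJ2⟩ := exists_nat_pow_near hcs3 one_lt_two
  set h := k / s with hh
  have hh0 : 0 < h := by positivity
  have hhinv : (h ^ 2)⁻¹ = Λ / k ^ 2 := by rw [hh, div_pow, hsΛ, inv_div]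
  have hpotb : ∀ (p : DyadicIndex r J), ∀ q ∈ cube h (dyadicPoint p),
      potential α L₁ L₂ q ≤ Λ / 2 := by
    intro p q hq
    obtain ⟨h1, h2⟩ := parts_le_of_mem_cube hh0 p hq
    have hV : quartic α (fstPart q) (sndPart q) ≤ Λ / 4 := by
      refine (hb _ _).2.trans ?_
      have h3 : h ^ 2 * 2 ^ J ≤ k ^ 2 * c * s := by
        calc h ^ 2 * 2 ^ J ≤ h ^ 2 * (c * s ^ 3) := mul_le_mul_of_nonneg_left hJ1 (by positivity)
          _ = _ := by rw [hh]; field_simp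
      have h4 : (h ^ 2 * 2 ^ J) ^ 2 ≤ (k ^ 2 * c * s) ^ 2 := pow_le_pow_left₀ (by positivity) h3 2
      calc M * (‖fstPart q‖ ^ 2 * ‖sndPart q‖ ^ 2) ≤ M * (4 * r ^ 2 * (k ^ 2 * c * s) ^ 2) := by
            refine mul_le_mul_of_nonneg_left (h1.trans ?_) hM.le
            exact mul_le_mul_of_nonneg_left h4 (by positivity)
        _ = M * (4 * r ^ 2 * (k ^ 2 * c) ^ 2) * Λ := by rw [← hsΛ]; ring
        _ ≤ 1 / 4 * Λ := mul_le_mul_of_nonneg_right hcM hΛ0.le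
        _ = Λ / 4 := by ring
    have hn : ‖q‖ ≤ r * (3 * (k * c)) * Λ := by
      have h3 : h * 2 ^ J ≤ k * c * Λ := by
        calc h * 2 ^ J ≤ h * (c * s ^ 3) := mul_le_mul_of_nonneg_left hJ1 hh0.le
          _ = k * c * s ^ 2 := by rw [hh]; field_simp
          _ = _ := by rw [hsΛ]
      have h4 : ‖q‖ ^ 2 ≤ (r * (3 * (h * 2 ^ J))) ^ 2 := by
        refine h2.trans ?_
        rw [mul_pow (r : ℝ)]
        refine mul_le_mul_of_nonneg_right ?_ (by positivity)
        nlinarith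
      have h5 := abs_le_of_sq_le_sq' h4 (by positivity) |>.2
      refine h5.trans ?_
      calc (r : ℝ) * (3 * (h * 2 ^ J)) ≤ r * (3 * (k * c * Λ)) := by gcongr
        _ = _ := by ring
    have n1 : ‖fstPart q‖ ≤ ‖q‖ := by
      have := norm_sq_parts q
      refine abs_le_of_sq_le_sq' ?_ (norm_nonneg _) |>.2
      nlinarith [sq_nonneg ‖sndPart q‖]
    have n2 : ‖sndPart q‖ ≤ ‖q‖ := by
      have := norm_sq_parts q
      refine abs_le_of_sq_le_sq' ?_ (norm_nonneg _) |>.2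
      nlinarith [sq_nonneg ‖fstPart q‖]
    have a3 := ((le_abs_self _).trans (abs_sum_mul_le L₁ (fstPart q))).trans
      (mul_le_mul_of_nonneg_left n1 (Finset.sum_nonneg fun i _ => abs_nonneg _))
    have a4 := ((le_abs_self _).trans (abs_sum_mul_le L₂ (sndPart q))).trans
      (mul_le_mul_of_nonneg_left n2 (Finset.sum_nonneg fun i _ => abs_nonneg _))
    have a5 : K * ‖q‖ ≤ Λ / 4 := by
      calc K * ‖q‖ ≤ K * (r * (3 * (k * c)) * Λ) := mul_le_mul_of_nonneg_left hn hK0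
        _ = K * (r * (3 * (k * c))) * Λ := by ring
        _ ≤ 1 / 4 * Λ := mul_le_mul_of_nonneg_right hcK hΛ0.le
        _ = Λ / 4 := by ring
    have a6 : K * ‖q‖ = (∑ i, |L₁ i|) * ‖q‖ + (∑ k, |L₂ k|) * ‖q‖ := by rw [hK]; ring
    rw [potential_eq]
    linarith
  choose φ hφ0 hφn hφE using fun p : DyadicIndex r J => exists_scaled_bump hη Q hh0 (dyadicPoint p)
  have hdis : ∀ x p p', p ≠ p' → (φ p x = 0 ∧ grad (φ p) x = 0) ∨ (φ p' x = 0 ∧ grad (φ p') x = 0) := by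
    intro x p p' hpp
    have h1 := pairwise_disjoint_cube hh0 (fun h2 => hpp (dyadicPoint_injective hr h2))
    by_cases hx : x ∈ cube h (dyadicPoint p)
    · exact Or.inr (hφ0 p' x fun hx' => Set.disjoint_left.1 h1 hx hx')
    · exact Or.inl (hφ0 p x hx)
  have hlt : ∀ p, energy Q (potential α L₁ L₂) (φ p) < Λ * ∫ x, ‖φ p x‖ ^ 2 := by
    intro p
    refine (hφE p _ (Λ / 2) (polyBounded_potential α L₁ L₂) (hpotb p)).trans_lt ?_
    rw [hφn, mul_left_comm]
    refine mul_lt_mul_of_pos_left ?_ (by positivity)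
    rw [hhinv, hk2]
    have h1 : Λ / (4 * (|E₀| + 1) / N₀) * E₀ ≤ Λ * N₀ / 4 := by
      have h2 : E₀ ≤ |E₀| + 1 := by linarith [le_abs_self E₀]
      have h3 : Λ / (4 * (|E₀| + 1) / N₀) * E₀ ≤ Λ / (4 * (|E₀| + 1) / N₀) * (|E₀| + 1) :=
        mul_le_mul_of_nonneg_left h2 (by positivity)
      refine h3.trans (le_of_eq ?_)
      field_simp
    have h4 : 0 < Λ * N₀ := by positivity
    linarith
  refine ⟨J, Fintype.linearCombination ℂ φ, fun v hv => ?_, ?_⟩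
  · exact energy_linearCombination_lt (polyBounded_potential α L₁ L₂) hdis hlt hv
  · rw [card_dyadicIndex]
    push_cast
    have h1 : c / 2 * s ^ 3 ≤ 2 ^ J := by
      rw [pow_succ (2 : ℝ) J] at hJ2
      linarith
    have h2 : (c / 2) ^ r * (s ^ 3) ^ r ≤ (2 ^ J) ^ r := by
      rw [← mul_pow]
      exact pow_le_pow_left₀ (by positivity) h1 r
    -- The threshold on `Λ` gives `c √Λ ≥ 1`, hence `Λ ≤ c Λ^(3/2) < 2 ^ (J + 1)`.
    have h3 : Real.log Λ ≤ J + 1 := by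
      have h4 : Real.log Λ ≤ Real.log (c * s ^ 3) := by
        refine Real.log_le_log hΛ0 ?_
        calc Λ = 1 * s ^ 2 := by rw [hsΛ, one_mul]
          _ ≤ c * s * s ^ 2 := mul_le_mul_of_nonneg_right hcs (by positivity)
          _ = c * s ^ 3 := by ring
      have h5 : Real.log (c * s ^ 3) ≤ Real.log (2 ^ (J + 1)) :=
        Real.log_le_log (by positivity) hJ2.le
      rw [Real.log_pow] at h5
      have h6 : Real.log 2 ≤ 1 := by linarith [Real.log_two_lt_d9]
      have h7 : ((J + 1 : ℕ) : ℝ) * Real.log 2 ≤ ((J + 1 : ℕ) : ℝ) * 1 :=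
        mul_le_mul_of_nonneg_left h6 (Nat.cast_nonneg _)
      push_cast at h5 h7
      linarith
    calc (c / 2) ^ r * (s ^ 3) ^ r * Real.log Λ ≤ (2 ^ J) ^ r * (J + 1) :=
          mul_le_mul h2 h3 (Real.log_nonneg hΛ1) (by positivity)
      _ = _ := by ring

end LowerBound

/-! ### Conclusion: two-sided eigenvalue bounds -/

section Counting

variable {r : ℕ} {Q : Matrix (Fin r ⊕ Fin r) (Fin r ⊕ Fin r) ℝ}
  {α : Fin r → Fin r → Fin r → Fin r → ℝ} {L₁ L₂ : Fin r → ℝ}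

/-- The model operator is bounded from below. -/
theorem Admissible.exists_lower_bound (hP : Admissible Q α L₁ L₂)
    (hpos : ∀ (x : Fin r → ℝ) (y : Fin r → ℝ), x ≠ 0 → y ≠ 0 → 0 < quartic α x y) :
    ∃ s : ℝ, ∀ φ : 𝓢(EuclideanSpace ℝ (Fin r ⊕ Fin r), ℂ),
      (1 - s) * ‖incl _ φ‖ ^ 2 ≤ energy Q (potential α L₁ L₂) φ := by
  obtain ⟨δ, C, hδ, -, h⟩ := coerciveOn_univ hP hpos
  refine ⟨1 + C, fun φ => ?_⟩
  have h1 := h φ fun q hq => absurd (Set.mem_univ q) hq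
  have h2 : 0 ≤ energy Q (weight α) φ :=
    energy_nonneg hP.quadratic_pos.posSemidef (weight_nonneg hP.quartic_nonneg) φ
  have h3 := mul_nonneg hδ.le h2
  rw [norm_incl_sq]
  linarith

theorem sqrt_cube_pow {Λ : ℝ} (hΛ : 0 ≤ Λ) (r : ℕ) :
    (Real.sqrt Λ ^ 3) ^ r = Λ ^ ((3 / 2 : ℝ) * (r : ℝ)) := by
  rw [Real.rpow_mul hΛ, Real.rpow_natCast, Real.sqrt_eq_rpow, ← Real.rpow_natCast (Λ ^ (1 / 2 : ℝ)),
    ← Real.rpow_mul hΛ]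
  norm_num

/-- Two-sided bounds for the number of eigenvalues of the model operator below `Λ`. -/
theorem Admissible.exists_eigenvalueCount_bounds (hr : 0 < r) (hP : Admissible Q α L₁ L₂)
    (hpos : ∀ (x : Fin r → ℝ) (y : Fin r → ℝ), x ≠ 0 → y ≠ 0 → 0 < quartic α x y) :
    ∃ c C : ℝ, 0 < c ∧ c < C ∧ ∀ᶠ Λ : ℝ in Filter.atTop,
      ENNReal.ofReal (c * Λ ^ ((3 / 2 : ℝ) * (r : ℝ)) * Real.log Λ) ≤
        eigenvalueCount (modelOperator Q α L₁ L₂) Λ ∧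
      eigenvalueCount (modelOperator Q α L₁ L₂) Λ ≤
        ENNReal.ofReal (C * Λ ^ ((3 / 2 : ℝ) * (r : ℝ)) * Real.log Λ) := by
  have hQ : Q.IsSymm := by simpa using hP.quadratic_pos.isHermitian
  have hgrowth := potential_hasTemperateGrowth α L₁ L₂
  have hsymm : ∀ φ ψ, inner ℂ (incl _ (modelSchwartz Q α L₁ L₂ φ)) (incl _ ψ) =
      inner ℂ (incl _ φ) (incl _ (modelSchwartz Q α L₁ L₂ ψ)) :=
    schrodinger_symm Q hQ _ hgrowth
  have henergy : ∀ φ, (inner ℂ (incl _ φ) (incl _ (modelSchwartz Q α L₁ L₂ φ))).re =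
      energy Q (potential α L₁ L₂) φ := re_inner_schrodinger Q hgrowth
  obtain ⟨s, hs⟩ := hP.exists_lower_bound hpos
  have hdense : DenseRange fun φ => incl _ (modelSchwartz Q α L₁ L₂ φ + (s : ℂ) • φ) :=
    denseRange_schrodinger hQ hgrowth (polyBounded_potential α L₁ L₂) hs
  have hbelow : ∀ φ, (1 - s) * ‖incl _ φ‖ ^ 2 ≤
      (inner ℂ (incl _ φ) (incl _ (modelSchwartz Q α L₁ L₂ φ))).re := fun φ =>
    (hs φ).trans_eq (henergy φ).symm
  obtain ⟨C, Λ₁, -, hC⟩ := exists_formBound hr hP hpos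
  -- A form bound at a higher level is one at any lower level, so the large-`Λ` estimate already
  -- provides the compactness needed below.
  have hform : ∀ Λ, ∃ N, FormBound (modelSchwartz Q α L₁ L₂) Λ N := fun Λ => by
    obtain ⟨N, hN, -⟩ := hC (max Λ Λ₁) (le_max_right _ _)
    exact ⟨N, hN.mono (le_max_left _ _) le_rfl⟩
  obtain ⟨c, Λ₂, hc, hlow⟩ := exists_testFunctions hr Q L₁ L₂ hpos
  -- Enlarging the upper constant secures `c < C`.
  refine ⟨c, max C (c + 1), hc, (lt_add_one c).trans_le (le_max_right _ _), ?_⟩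
  filter_upwards [Filter.eventually_ge_atTop Λ₁, Filter.eventually_ge_atTop Λ₂,
    Filter.eventually_ge_atTop 1, Filter.eventually_gt_atTop (-s)] with Λ h₁ h₂ h₃ h₄
  have hlog := Real.log_nonneg h₃
  rw [← sqrt_cube_pow (by linarith) r]
  constructor
  · obtain ⟨J, Φ, hΦ, hcard⟩ := hlow Λ h₂
    refine le_trans ?_ (le_eigenvalueCount hsymm hbelow hdense hform (by linarith) Φ fun v hv => ?_)
    · rw [← ENNReal.ofReal_natCast]
      exact ENNReal.ofReal_le_ofReal hcard
    · rw [henergy]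
      exact hΦ v hv
  · obtain ⟨N, hN, hNC⟩ := hC Λ h₁
    refine (eigenvalueCount_le hsymm hbelow hdense hN).trans ?_
    rw [← ENNReal.ofReal_natCast]
    refine ENNReal.ofReal_le_ofReal (hNC.trans ?_)
    gcongr
    exact le_max_left _ _

end Counting

end CrossingModel

end

theorem mainTheorem7 (r₁ r₂ : ℕ) (hr : r₁ = r₂) (hr₁ : 0 < r₁)
    (Q : Matrix (Fin r₁ ⊕ Fin r₂) (Fin r₁ ⊕ Fin r₂) ℝ)
    (α : Fin r₁ → Fin r₁ → Fin r₂ → Fin r₂ → ℝ) (L₁ : Fin r₁ → ℝ) (L₂ : Fin r₂ → ℝ)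
    (hP : CrossingModel.Admissible Q α L₁ L₂)
    (hpos : ∀ (q₁ : Fin r₁ → ℝ) (q₂ : Fin r₂ → ℝ), q₁ ≠ 0 → q₂ ≠ 0 →
      CrossingModel.MatrixPositive (CrossingModel.partial₁ α q₁) ∧
      CrossingModel.MatrixPositive (CrossingModel.partial₂ α q₂)) :
    ∃ c C : ℝ, 0 < c ∧ c < C ∧ ∀ᶠ Λ : ℝ in Filter.atTop,
      ENNReal.ofReal (c * Λ ^ ((3 / 2 : ℝ) * (r₁ : ℝ)) * Real.log Λ) ≤
        CrossingModel.eigenvalueCount (CrossingModel.modelOperator Q α L₁ L₂) Λ ∧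
      CrossingModel.eigenvalueCount (CrossingModel.modelOperator Q α L₁ L₂) Λ ≤
        ENNReal.ofReal (C * Λ ^ ((3 / 2 : ℝ) * (r₁ : ℝ)) * Real.log Λ) := by
  subst hr
  exact hP.exists_eigenvalueCount_bounds hr₁
    (CrossingModel.quartic_pos fun x y hx hy => (hpos x y hx hy).1)
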